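/- Let $D=D_1\cup D_2$ be a connected diagram, in the plane $\mathbb R^2$ or in the sphere $S^2=\mathbb R^2\cup\{\infty\}$ with $\infty\notin D$, of an oriented two-component link, where the sub-diagrams $D_1$ and $D_2$ represent the first and the second component. That is, $D_1$ and $D_2$ are smoothly immersed oriented closed curves in $\mathbb R^2$ whose only singularities, taken together, are transverse double points (the crossings), each with over/under information. Let $x_1,\dots,x_n$ be the crossings. Suppose that for some $0\le k<n$ each of $x_1,\dots,x_k$ is a self-crossing of $D_1$ or of $D_2$, that each of $x_{k+1},\dots,x_n$ is a crossing of $D_1$ with $D_2$, and that $D_2$ crosses $D_1$ from the right to the left at $x_n$. Let $\varepsilon_x=1$ if the crossing $x$ is positive and $\varepsilon_x=-1$ if it is negative. Let $\mathcal R$ be the set of regions of $D$, the connected components of the complement of $D$ in the plane or sphere. For a crossing $x_i$ and a region $R$ let $a^{(1)}_{iR}=1$ if $R$ touches $x_i$ at a corner bounded by the underpass and the overpass in this counterclockwise order, $a^{(1)}_{iR}=-1$ if $R$ touches $x_i$ at a corner bounded by them in this clockwise order, and $a^{(1)}_{iR}=0$ if $R$ does not touch $x_i$. Let $a^{(2)}_{iR}=2a^{(1)}_{iR}$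 if $R$ touches $x_i$ at two opposite corners, and $a^{(2)}_{iR}=a^{(1)}_{iR}$ otherwise. Put $A_{a1}=(a^{(1)}_{iR})$ and $A_{a2}=(a^{(2)}_{iR})$, and let $\Phi_{a1},\Phi_{a2}:\mathbb Z^{\mathcal R}\to\mathbb Z^n$ be the homomorphisms $\mathbf u\mapsto A_{a1}\mathbf u$ and $\mathbf u\mapsto A_{a2}\mathbf u$. Define $\mathbf e_1,\dots,\mathbf e_{n-1}\in\mathbb Z^n$ as follows. - For $1\le i\le k$, the $i$-th component of $\mathbf e_i$ is $1$ and all others are $0$. - For $k+1\le i\le n-1$, the $n$-th component of $\mathbf e_i$ is $\varepsilon_{x_n}$, the $i$-th component is $\varepsilon_{x_i}$ if $D_2$ crosses $D_1$ from the left to the right at $x_i$ and $-\varepsilon_{x_i}$ if $D_2$ crosses $D_1$ from the right to the left at $x_i$, and all others are $0$. Then $\mathbf e_1,\dots,\mathbf e_{n-1}$ form a $\mathbb Z$-basis of the image of $\Phi_{a2}$, and the image of $\Phi_{a1}$ equals the image of $\Phi_{a2}$. Consequently, for every $\mathbf c\in\mathbb Z^n$, each of the systems $A_{a1}\mathbf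 u+\mathbf c=\mathbf 0$ and $A_{a2}\mathbf w+\mathbf c=\mathbf 0$ has a solution $\mathbf u$, respectively $\mathbf w$, in $\mathbb Z^{\mathcal R}$ if and only if $\mathbf c$ is an integral linear combination of $\mathbf e_1,\dots,\mathbf e_{n-1}$. -/

import Mathlib

open Filter Topology Function
open scoped ContDiff

noncomputable section

/-! ## Link diagrams -/

/-- The oriented area `det (z, w)` of two plane vectors: it is positive iff `w` points to the left
of `z`, that is, iff the counterclockwise angle from `z` to `w` lies strictly between `0` and `π`. -/
def planeDet (z w : ℂ) : ℝ := z.re * w.im - z.im * w.re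

/-- A passage: a component together with a time in the fundamental period `[0, 1)`. -/
abbrev Passage (l : ℕ) : Type := Fin l × Set.Ico (0 : ℝ) 1

/-- A diagram of an oriented link with `l` ordered components, drawn in the plane `ℂ = ℝ²`.
Each component is a smooth closed curve of period `1`, oriented by its parametrization and
immersed; the only singular points of the union are transverse double points, and
each of them carries over/under information (`overPasses` collects the passages that run above at a
double point; its values at passages that are not through a double point are irrelevant). -/
structure LinkDiagram (l : ℕ) where
  curve : Fin l → ℝ → ℂ
  smooth : ∀ c, ContDiff ℝ ∞ (curve c)
  periodic : ∀ c, Function.Periodic (curve c) 1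
  immersed : ∀ c t, deriv (curve c) t ≠ 0
  transverse : ∀ a b : Passage l, a ≠ b → curve a.1 a.2 = curve b.1 b.2 →
    planeDet (deriv (curve a.1) a.2) (deriv (curve b.1) b.2) ≠ 0
  double : ∀ a b c : Passage l, curve a.1 a.2 = curve b.1 b.2 → curve b.1 b.2 = curve c.1 c.2 →
    a = b ∨ b = c ∨ a = c
  overPasses : Set (Passage l)
  mem_overPasses_iff : ∀ a b : Passage l, a ≠ b → curve a.1 a.2 = curve b.1 b.2 →
    (a ∈ overPasses ↔ b ∉ overPasses)

namespace LinkDiagram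

variable {l : ℕ} (D : LinkDiagram l)

/-- The point of the plane at a passage. -/
def point (a : Passage l) : ℂ := D.curve a.1 a.2

/-- The direction of travel at a passage. -/
def velocity (a : Passage l) : ℂ := deriv (D.curve a.1) a.2

/-- The projection image: the union of all component curves. -/
def image : Set ℂ := {z | ∃ c t, D.curve c t = z}

/-- The diagram is connected as a subset of the plane. -/
def Connected : Prop := IsConnected D.image

/-- A crossing, given by its two passages: the overpass and the underpass. -/
structure Crossing where
  overPass : Passage l
  underPass : Passage l
  ne : overPass ≠ underPass
  same_point : D.point overPass = D.point underPass
  mem_over : overPass ∈ D.overPasses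
  not_mem_over : underPass ∉ D.overPasses

variable {D}

namespace Crossing

/-- The double point of the projection at the crossing. -/
def center (x : D.Crossing) : ℂ := D.point x.overPass

/-- Both strands belong to the same link component. -/
def IsSelf (x : D.Crossing) : Prop := x.overPass.1 = x.underPass.1

/-- The crossing is a crossing of the components `c` and `c'`. -/
def IsBetween (x : D.Crossing) (c c' : Fin l) : Prop :=
  (x.overPass.1 = c ∧ x.underPass.1 = c') ∨ (x.overPass.1 = c' ∧ x.underPass.1 = c)

/-- The sign `ε_x`: it is `1` at a positive (right-handed) crossing, where the understrand points
to the left of the overstrand, and `-1` at a negative one. -/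
def sign (x : D.Crossing) : ℤ :=
  if 0 < planeDet (D.velocity x.overPass) (D.velocity x.underPass) then 1 else -1

/-- At the crossing, the strand of `c'` crosses the strand of `c` from the right to the left. -/
def CrossesRightToLeft (x : D.Crossing) (c c' : Fin l) : Prop :=
  (x.overPass.1 = c ∧ x.underPass.1 = c' ∧
      0 < planeDet (D.velocity x.overPass) (D.velocity x.underPass)) ∨
    (x.underPass.1 = c ∧ x.overPass.1 = c' ∧
      0 < planeDet (D.velocity x.underPass) (D.velocity x.overPass))

end Crossing

/-- The four corners at a crossing: the corner `(σ, τ)` lies between the ray `σ • (overstrand)`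
and the ray `τ • (understrand)`, so that `-κ` is the corner opposite to `κ`. -/
abbrev Corner : Type := ℤˣ × ℤˣ

namespace Crossing

/-- The half of the overpass that bounds the corner. -/
def overRay (x : D.Crossing) (κ : Corner) : ℂ := ((κ.1 : ℤ) : ℂ) * D.velocity x.overPass

/-- The half of the underpass that bounds the corner. -/
def underRay (x : D.Crossing) (κ : Corner) : ℂ := ((κ.2 : ℤ) : ℂ) * D.velocity x.underPass

/-- The corner is bounded by the underpass and the overpass in this counterclockwise order. -/
def IsCounterclockwise (x : D.Crossing) (κ : Corner) : Prop :=
  0 < planeDet (x.underRay κ) (x.overRay κ)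

/-- The corner is bounded by the underpass and the overpass in this clockwise order. -/
def IsClockwise (x : D.Crossing) (κ : Corner) : Prop :=
  planeDet (x.underRay κ) (x.overRay κ) < 0

/-- A point in the corner, at scale `t > 0`, on the ray that leaves the crossing between
the two bounding rays. -/
def cornerPoint (x : D.Crossing) (κ : Corner) (t : ℝ) : ℂ :=
  x.center + (t : ℂ) * (x.overRay κ + x.underRay κ)

end Crossing

end LinkDiagram

/-! ## Regions -/

/-- The surfaces that carry diagrams: the plane `ℝ²`, and the sphere `S² = ℝ² ∪ {∞}`, where the
point `∞` is chosen off the diagram. -/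
inductive DiagramSurface : Type
  | plane
  | sphere

namespace DiagramSurface

/-- The underlying space of the surface. -/
def Carrier : DiagramSurface → Type
  | plane => ℂ
  | sphere => OnePoint ℂ

instance instTopologicalSpaceCarrier : (S : DiagramSurface) → TopologicalSpace S.Carrier
  | plane => inferInstanceAs (TopologicalSpace ℂ)
  | sphere => inferInstanceAs (TopologicalSpace (OnePoint ℂ))

/-- The inclusion of the plane. -/
def incl : (S : DiagramSurface) → ℂ → S.Carrier
  | plane => fun z => z
  | sphere => fun z => (z : OnePoint ℂ)

end DiagramSurface

namespace LinkDiagram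

variable {l : ℕ} (D : LinkDiagram l) (S : DiagramSurface)

/-- The complement of the projection image in the surface. -/
def Complement : Type := {z : S.Carrier // z ∉ S.incl '' D.image}

instance instTopologicalSpaceComplement : TopologicalSpace (D.Complement S) :=
  inferInstanceAs (TopologicalSpace {z : S.Carrier // z ∉ S.incl '' D.image})

/-- The regions: the connected components of the complement of the projection image. -/
def Region : Type := ConnectedComponents (D.Complement S)

variable {D S}

namespace Region

/-- The region `R` touches the crossing `x` at the corner `κ`: it contains all points of the corner
on the chosen ray that are close enough to the crossing. -/
def Touches (R : D.Region S) (x : D.Crossing) (κ : Corner) : Prop :=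
  ∀ᶠ t : ℝ in 𝓝[>] 0, ∃ h : S.incl (x.cornerPoint κ t) ∉ S.incl '' D.image,
    ConnectedComponents.mk (⟨S.incl (x.cornerPoint κ t), h⟩ : D.Complement S) = R

/-- The region `R` touches the crossing `x` twice, at a pair of opposite corners. -/
def TouchesTwice (R : D.Region S) (x : D.Crossing) : Prop :=
  ∃ κ : Corner, R.Touches x κ ∧ R.Touches x (-κ)

theorem Touches.unique {R R' : D.Region S} {x : D.Crossing} {κ : Corner}
    (h : R.Touches x κ) (h' : R'.Touches x κ) : R = R' := by
  obtain ⟨t, ⟨_, ht⟩, _, ht'⟩ := (h.and h').exists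
  exact ht.symm.trans ht'

/-- Only finitely many (in fact at most four) regions touch a given crossing. -/
theorem finite_touches (x : D.Crossing) : {R : D.Region S | ∃ κ, R.Touches x κ}.Finite := by
  have h : {R : D.Region S | ∃ κ, R.Touches x κ} =
      ⋃ κ : Corner, {R : D.Region S | R.Touches x κ} := by
    ext R
    simp
  rw [h]
  exact Set.finite_iUnion fun κ => Set.Subsingleton.finite fun _ hR _ hR' => hR.unique hR'

end Region

/-! ## Region choice matrices -/

open Classical in
/-- The entry of the alternating region choice matrix of the single counting rule. -/
def entryA1 (x : D.Crossing) (R : D.Region S) : ℤ :=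
  if ∃ κ, x.IsCounterclockwise κ ∧ R.Touches x κ then 1
  else if ∃ κ, x.IsClockwise κ ∧ R.Touches x κ then -1
  else 0

open Classical in
/-- The entry of the alternating region choice matrix of the double counting rule. -/
def entryA2 (x : D.Crossing) (R : D.Region S) : ℤ :=
  if R.TouchesTwice x then 2 * entryA1 x R else entryA1 x R

theorem exists_touches_of_entryA1_ne_zero {x : D.Crossing} {R : D.Region S}
    (h : entryA1 x R ≠ 0) : ∃ κ, R.Touches x κ := by
  unfold entryA1 at h
  split_ifs at h with h1 h2
  · exact h1.imp fun _ => And.right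
  · exact h2.imp fun _ => And.right
  · exact absurd rfl h

theorem finite_support_entryA1 (x : D.Crossing) :
    (support fun R : D.Region S => entryA1 x R).Finite :=
  (Region.finite_touches x).subset fun _ h => exists_touches_of_entryA1_ne_zero h

theorem finite_support_entryA2 (x : D.Crossing) :
    (support fun R : D.Region S => entryA2 x R).Finite := by
  refine (finite_support_entryA1 x).subset fun R h h0 => h ?_
  have h0' : entryA1 x R = 0 := h0
  simp [entryA2, h0']

end LinkDiagram

/-- The homomorphism `u ↦ A u` given by an integer matrix all of whose rows have finite support. -/
def matrixHom {m r : Type*} (A : Matrix m r ℤ) (hA : ∀ i, (support (A i)).Finite) :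
    (r → ℤ) →ₗ[ℤ] (m → ℤ) where
  toFun u i := ∑ᶠ R, A i R * u R
  map_add' u v := by
    funext i
    have hs (w : r → ℤ) : (support fun R => A i R * w R).Finite :=
      (hA i).subset (support_mul_subset_left _ _)
    simp only [Pi.add_apply, mul_add]
    exact finsum_add_distrib (hs u) (hs v)
  map_smul' a u := by
    funext i
    have hs : (support fun R => A i R * u R).Finite :=
      (hA i).subset (support_mul_subset_left _ _)
    simp only [Pi.smul_apply, smul_eq_mul, RingHom.id_apply, mul_left_comm]
    exact (mul_finsum _ _).symm

namespace LinkDiagram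

variable {l : ℕ} {D : LinkDiagram l} {n : ℕ}

/-- The alternating region choice matrix of the single counting rule, for the numbering
`x 0, …, x (n - 1)` of the crossings; its columns are indexed by the regions. -/
def matrixA1 (S : DiagramSurface) (x : Fin n ≃ D.Crossing) : Matrix (Fin n) (D.Region S) ℤ :=
  fun i R => entryA1 (x i) R

/-- The alternating region choice matrix of the double counting rule. -/
def matrixA2 (S : DiagramSurface) (x : Fin n ≃ D.Crossing) : Matrix (Fin n) (D.Region S) ℤ :=
  fun i R => entryA2 (x i) R

/-- The homomorphism `u ↦ A u` of the single counting rule. -/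
def homA1 (S : DiagramSurface) (x : Fin n ≃ D.Crossing) :
    (D.Region S → ℤ) →ₗ[ℤ] (Fin n → ℤ) :=
  matrixHom (matrixA1 S x) fun i => finite_support_entryA1 (x i)

/-- The homomorphism `u ↦ A u` of the double counting rule. -/
def homA2 (S : DiagramSurface) (x : Fin n ≃ D.Crossing) :
    (D.Region S → ℤ) →ₗ[ℤ] (Fin n → ℤ) :=
  matrixHom (matrixA2 S x) fun i => finite_support_entryA2 (x i)

open Classical in
/-- The vectors `e_i` for a two-component diagram with `m + 1` crossings, of which the first `k` are
self-crossings: `e_i` is the `i`-th unit vector for `i < k`; for `k ≤ i < m` its last entry is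
`ε` of the last crossing, and its `i`-th entry is `-ε_i` if the second component crosses the first
from the right to the left at the `i`-th crossing, and `ε_i` if from the left to the right. -/
def imageVector {D : LinkDiagram 2} {m : ℕ} (x : Fin (m + 1) ≃ D.Crossing) (k : ℕ) (i : Fin m) :
    Fin (m + 1) → ℤ :=
  if (i : ℕ) < k then Pi.single i.castSucc 1
  else
    Pi.single i.castSucc
        (if (x i.castSucc).CrossesRightToLeft 0 1 then -(x i.castSucc).sign
          else (x i.castSucc).sign) +
      Pi.single (Fin.last m) (x (Fin.last m)).sign

end LinkDiagram

end

noncomputable section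

/-! ## Logarithms of directions -/

/-! For a function `u` on the regions, take at each crossing the sum of its values at the four
corners, with opposite weights at adjacent corners (`altSum`). Adjacent corners lie in different
regions, so a row of the double counting matrix is this alternating sum up to the sign of the
crossing (`homA2_eq_altSum`).

Upper bound. Along a component, the difference between the values of `u` on the left and on the
right changes at every passage through a crossing by plus or minus the alternating sum there, with
opposite signs at the overpass and at the underpass. Over one period the changes add up to zero
(`sum_altSum_eq_zero`). For the first component the two passages of a self-crossing cancel, and what
remains is a single linear relation, with coefficients `±1` at the mixed crossings and `0` at the
self-crossings (`range_homA2_le`).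

Lower bound. The winding number of a closed chain of arcs of the diagram is locally constant off the
diagram and vanishes near infinity, hence is a function on the regions of the plane or the sphere.
Its alternating sum vanishes wherever the chain runs straight through a crossing, so only the ends
of the arcs count (`Crossing.alternating_sum_eq`). A lobe cut off at a self-crossing yields a unit
vector up to sign; a chain along the first component from one mixed crossing to another and back
along the second yields the remaining vectors. They span all solutions of the relation, because its
coefficients at mixed crossings are units (`relationSubmodule_le_span`). The local behaviour of
winding numbers comes from the integral of `dz / (z - w)` as `w` tends to the crossing along a ray:
in combinations of total weight zero the divergent terms cancel, and principal logarithms of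
directions are left (`arcIntegral_half`).

Single counting. The two rules differ only at crossings that a region touches at two opposite
corners. No closed chain can run straight through such a crossing and otherwise avoid it, since its
winding number would differ at opposite corners. Hence the crossing is a self-crossing, its two
lobes do not meet, and the other component meets just one of them (`exists_isolatedLobe`). The
winding number of the isolated lobe, shifted to vanish away from the lobe, produces the unit vector
under the double rule. Under the single rule the result can differ only at doubly touched crossings
on this lobe, whose own isolated lobes are shorter; induction on the length shows that these unit
vectors lie in the image of the single rule (`single_mem_range_homA1`), and the two images agree. -/

open Complex in
theorem Complex.arg_mem_Ioo_of_im_pos {q : ℂ} (h : 0 < q.im) : 0 < arg q ∧ arg q < Real.pi := by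
  refine ⟨lt_of_le_of_ne (arg_nonneg_iff.2 h.le) fun h0 => ?_,
    lt_of_le_of_ne (arg_le_pi q) fun h0 => ?_⟩
  · rw [eq_comm, arg_eq_zero_iff] at h0; exact h.ne' h0.2
  · rw [arg_eq_pi_iff] at h0; exact h.ne' h0.2

open Complex in
theorem Complex.arg_mem_Ioo_of_im_neg {q : ℂ} (h : q.im < 0) : -Real.pi < arg q ∧ arg q < 0 :=
  ⟨neg_pi_lt_arg q, arg_neg_iff.2 h⟩

open Complex in
-- Identities between principal logarithms are reduced to this: the exponentials agree, and the
-- signs of the arguments confine the imaginary parts.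
theorem Complex.eq_of_exp_eq_of_im_lt {x y : ℂ} (h : exp x = exp y)
    (h1 : x.im - y.im < 2 * Real.pi) (h2 : -(2 * Real.pi) < x.im - y.im) : x = y := by
  obtain ⟨n, hn⟩ := exp_eq_exp_iff_exists_int.1 h
  have him : x.im - y.im = n * (2 * Real.pi) := by
    rw [hn]; simp
  have hpi := Real.pi_pos
  have hn0 : n = 0 := by
    have a1 : (n : ℝ) < 1 := by nlinarith
    have a2 : (-1 : ℝ) < n := by nlinarith
    have a1' : n < 1 := by exact_mod_cast a1
    have a2' : -1 < n := by exact_mod_cast a2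
    omega
  simpa [hn0] using hn

open Complex in
theorem im_div_pos_iff {A B : ℂ} : 0 < (A / B).im ↔ 0 < planeDet B A := by
  by_cases hB : B = 0
  · simp [hB, planeDet]
  have : (A / B).im = planeDet B A / normSq B := by
    rw [div_im, planeDet]; ring
  rw [this, div_pos_iff_of_pos_right (normSq_pos.2 hB)]

theorem planeDet_swap (A B : ℂ) : planeDet A B = - planeDet B A := by
  simp only [planeDet]; ring

theorem planeDet_add_right (A B C : ℂ) : planeDet A (B + C) = planeDet A B + planeDet A C := by
  simp only [planeDet, Complex.add_re, Complex.add_im]; ring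

theorem planeDet_self (A : ℂ) : planeDet A A = 0 := by
  simp only [planeDet]; ring

theorem planeDet_intCast_mul_right (A B : ℂ) (n : ℤ) :
    planeDet A ((n : ℂ) * B) = n * planeDet A B := by
  simp [planeDet]; ring

theorem planeDet_ofReal_mul_right (A B : ℂ) (n : ℝ) :
    planeDet A ((n : ℂ) * B) = n * planeDet A B := by
  simp [planeDet]; ring

theorem planeDet_neg_right (A B : ℂ) : planeDet A (-B) = -planeDet A B := by
  simp [planeDet]; ring

theorem planeDet_neg_left (A B : ℂ) : planeDet (-A) B = -planeDet A B := by
  simp [planeDet]; ring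

open Complex in
theorem im_div_neg_iff {A B : ℂ} : (A / B).im < 0 ↔ planeDet B A < 0 := by
  have := @im_div_pos_iff (-A) B
  rw [neg_div, neg_im, planeDet_neg_right] at this
  constructor <;> intro h
  · linarith [this.1 (by linarith)]
  · linarith [this.2 (by linarith)]

theorem mem_slitPlane_of_planeDet_ne_zero {A B : ℂ} (h : planeDet A B ≠ 0) :
    A / B ∈ Complex.slitPlane := by
  refine Or.inr ?_
  rcases h.lt_or_gt with h | h
  · exact (im_div_pos_iff.2 (by rw [planeDet_swap]; linarith)).ne'
  · exact (im_div_neg_iff.2 (by rw [planeDet_swap]; linarith)).ne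

open Complex in
/-- The jump of the logarithm across a straight line of direction `A`. -/
theorem log_neg_div_sub_log_div {A ζ : ℂ} (h : planeDet A ζ ≠ 0) :
    log (-A / ζ) - log (A / ζ) = if 0 < planeDet A ζ then Real.pi * I else -(Real.pi * I) := by
  have hpi := Real.pi_pos
  have hA : A ≠ 0 := by rintro rfl; simp [planeDet] at h
  have hζ : ζ ≠ 0 := by rintro rfl; simp [planeDet] at h
  have e1 : exp (log (-A / ζ)) = -A / ζ := exp_log (div_ne_zero (neg_ne_zero.2 hA) hζ)
  have e2 : exp (log (A / ζ)) = A / ζ := exp_log (div_ne_zero hA hζ)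
  have e3 : exp (-(Real.pi * I)) = -1 := by rw [exp_neg, exp_pi_mul_I]; norm_num
  rw [sub_eq_iff_eq_add]
  split_ifs with hp
  · have h1 : (A / ζ).im < 0 := im_div_neg_iff.2 (by rw [planeDet_swap]; linarith)
    have h2 : 0 < (-A / ζ).im := by rw [neg_div, neg_im]; linarith
    have a1 := arg_mem_Ioo_of_im_neg h1
    have a2 := arg_mem_Ioo_of_im_pos h2
    apply eq_of_exp_eq_of_im_lt
    · rw [exp_add, e1, e2, exp_pi_mul_I]; ring
    · simp only [log_im, add_im, mul_im, ofReal_re, I_im, ofReal_im, I_re]; linarith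
    · simp only [log_im, add_im, mul_im, ofReal_re, I_im, ofReal_im, I_re]; linarith
  · have hp' : planeDet A ζ < 0 := lt_of_le_of_ne (not_lt.1 hp) h
    have h1 : 0 < (A / ζ).im := im_div_pos_iff.2 (by rw [planeDet_swap]; linarith)
    have h2 : (-A / ζ).im < 0 := by rw [neg_div, neg_im]; linarith
    have a1 := arg_mem_Ioo_of_im_pos h1
    have a2 := arg_mem_Ioo_of_im_neg h2
    apply eq_of_exp_eq_of_im_lt
    · rw [exp_add, e1, e2, e3]; ring
    · simp only [log_im, add_im, mul_im, ofReal_re, I_im, ofReal_im, I_re, neg_im]; linarith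
    · simp only [log_im, add_im, mul_im, ofReal_re, I_im, ofReal_im, I_re, neg_im]; linarith

open Complex in
/-- The contribution, as seen in the direction `ζ`, of a path that comes in along `B` and
leaves along `A`. -/
def turnLog (A B ζ : ℂ) : ℂ := log (-A / ζ) - log (B / ζ)

open Complex in
theorem exp_turnLog {A B ζ : ℂ} (hA : A ≠ 0) (hB : B ≠ 0) (hζ : ζ ≠ 0) :
    exp (turnLog A B ζ) = -A / B := by
  rw [turnLog, exp_sub, exp_log (div_ne_zero (neg_ne_zero.2 hA) hζ), exp_log (div_ne_zero hB hζ)]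
  field_simp

open Complex in
-- The exponential is `-A / B` for every `ζ`, so only a multiple of `2πi` is in question. The path
-- occupies the rays `A` and `-B`; all listed directions lie on the same side of it, outside the
-- convex sector between these two rays.
theorem turnLog_of_corner {A B ζ : ℂ} (h : planeDet A B ≠ 0)
    (hζ : ζ = A + B ∨ ζ = -A - B ∨ ζ = B - A ∨ ζ = B) : turnLog A B ζ = log (-A / B) := by
  have hpi := Real.pi_pos
  have hA : A ≠ 0 := by rintro rfl; simp [planeDet] at h
  have hB : B ≠ 0 := by rintro rfl; simp [planeDet] at h
  have hζ0 : ζ ≠ 0 := by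
    rintro rfl
    apply h
    have : B = -A ∨ B = A ∨ B = 0 := by
      rcases hζ with h | h | h | h
      · left; linear_combination -h
      · left; linear_combination h
      · right; left; linear_combination -h
      · right; right; exact h.symm
    rcases this with rfl | rfl | rfl <;> simp [planeDet] <;> ring
  by_cases hζB : ζ = B
  · rw [turnLog, hζB, div_self hB, log_one, sub_zero]
  replace hζ : ζ = A + B ∨ ζ = -A - B ∨ ζ = B - A := by tauto
  apply eq_of_exp_eq_of_im_lt
  · rw [exp_turnLog hA hB hζ0, exp_log (div_ne_zero (neg_ne_zero.2 hA) hB)]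
  all_goals
    rcases hζ with rfl | rfl | rfl
    all_goals
      rw [turnLog]
      simp only [sub_im, log_im]
      rcases h.lt_or_gt with h | h
      · have h1 : (-A / B).im < 0 := im_div_neg_iff.2 (by
          simp only [planeDet, neg_re, neg_im] at h ⊢; linarith)
        have a1 := arg_mem_Ioo_of_im_neg h1
        first
        | (have h2 : (-A / (A + B)).im < 0 := im_div_neg_iff.2 (by
            simp only [planeDet, neg_re, neg_im, add_re, add_im] at h ⊢; linarith)
           have h3 : (B / (A + B)).im < 0 := im_div_neg_iff.2 (by
            simp only [planeDet, neg_re, neg_im, add_re, add_im] at h ⊢; linarith)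
           have a2 := arg_mem_Ioo_of_im_neg h2
           have a3 := arg_mem_Ioo_of_im_neg h3
           linarith)
        | (have h2 : 0 < (-A / (-A - B)).im := im_div_pos_iff.2 (by
            simp only [planeDet, neg_re, neg_im, sub_re, sub_im] at h ⊢; linarith)
           have h3 : 0 < (B / (-A - B)).im := im_div_pos_iff.2 (by
            simp only [planeDet, neg_re, neg_im, sub_re, sub_im] at h ⊢; linarith)
           have a2 := arg_mem_Ioo_of_im_pos h2
           have a3 := arg_mem_Ioo_of_im_pos h3
           linarith)
        | (have h2 : (-A / (B - A)).im < 0 := im_div_neg_iff.2 (by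
            simp only [planeDet, neg_re, neg_im, sub_re, sub_im] at h ⊢; linarith)
           have h3 : 0 < (B / (B - A)).im := im_div_pos_iff.2 (by
            simp only [planeDet, neg_re, neg_im, sub_re, sub_im] at h ⊢; linarith)
           have a2 := arg_mem_Ioo_of_im_neg h2
           have a3 := arg_mem_Ioo_of_im_pos h3
           linarith)
      · have h1 : 0 < (-A / B).im := im_div_pos_iff.2 (by
          simp only [planeDet, neg_re, neg_im] at h ⊢; linarith)
        have a1 := arg_mem_Ioo_of_im_pos h1
        first
        | (have h2 : 0 < (-A / (A + B)).im := im_div_pos_iff.2 (by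
            simp only [planeDet, neg_re, neg_im, add_re, add_im] at h ⊢; linarith)
           have h3 : 0 < (B / (A + B)).im := im_div_pos_iff.2 (by
            simp only [planeDet, neg_re, neg_im, add_re, add_im] at h ⊢; linarith)
           have a2 := arg_mem_Ioo_of_im_pos h2
           have a3 := arg_mem_Ioo_of_im_pos h3
           linarith)
        | (have h2 : (-A / (-A - B)).im < 0 := im_div_neg_iff.2 (by
            simp only [planeDet, neg_re, neg_im, sub_re, sub_im] at h ⊢; linarith)
           have h3 : (B / (-A - B)).im < 0 := im_div_neg_iff.2 (by
            simp only [planeDet, neg_re, neg_im, sub_re, sub_im] at h ⊢; linarith)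
           have a2 := arg_mem_Ioo_of_im_neg h2
           have a3 := arg_mem_Ioo_of_im_neg h3
           linarith)
        | (have h2 : 0 < (-A / (B - A)).im := im_div_pos_iff.2 (by
            simp only [planeDet, neg_re, neg_im, sub_re, sub_im] at h ⊢; linarith)
           have h3 : (B / (B - A)).im < 0 := im_div_neg_iff.2 (by
            simp only [planeDet, neg_re, neg_im, sub_re, sub_im] at h ⊢; linarith)
           have a2 := arg_mem_Ioo_of_im_pos h2
           have a3 := arg_mem_Ioo_of_im_neg h3
           linarith)

open Complex in
-- The direction `A - B` lies inside the convex sector between the outgoing ray `A` and the incoming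
-- ray `-B`, hence on the other side of the path; this costs one full turn.
theorem turnLog_sub {A B : ℂ} (h : planeDet A B ≠ 0) :
    turnLog A B (A - B) = log (-A / B) -
      (if 0 < planeDet A B then 2 * Real.pi * I else -(2 * Real.pi * I)) := by
  have hpi := Real.pi_pos
  have hA : A ≠ 0 := by rintro rfl; simp [planeDet] at h
  have hB : B ≠ 0 := by rintro rfl; simp [planeDet] at h
  have hζ : A - B ≠ 0 := fun h0 => by
    rw [sub_eq_zero] at h0; exact h (by rw [h0, planeDet_self])
  have e1 := exp_turnLog hA hB hζ
  have e2 : exp (log (-A / B)) = -A / B := exp_log (div_ne_zero (neg_ne_zero.2 hA) hB)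
  have e3 : exp (2 * Real.pi * I) = 1 := exp_two_pi_mul_I
  split_ifs with hp
  · have h1 : 0 < (-A / B).im := im_div_pos_iff.2 (by
      simp only [planeDet, neg_re, neg_im] at hp ⊢; linarith)
    have h2 : (-A / (A - B)).im < 0 := im_div_neg_iff.2 (by
      simp only [planeDet, neg_re, neg_im, sub_re, sub_im] at hp ⊢; linarith)
    have h3 : 0 < (B / (A - B)).im := im_div_pos_iff.2 (by
      simp only [planeDet, neg_re, neg_im, sub_re, sub_im] at hp ⊢; linarith)
    have a1 := arg_mem_Ioo_of_im_pos h1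
    have a2 := arg_mem_Ioo_of_im_neg h2
    have a3 := arg_mem_Ioo_of_im_pos h3
    apply eq_of_exp_eq_of_im_lt
    · rw [e1, exp_sub, e2, e3, div_one]
    all_goals
      rw [turnLog]
      simp only [log_im, sub_im, mul_im, ofReal_re, I_im, ofReal_im, I_re, mul_re, re_ofNat,
        im_ofNat]
      linarith
  · have hp' : planeDet A B < 0 := lt_of_le_of_ne (not_lt.1 hp) h
    have h1 : (-A / B).im < 0 := im_div_neg_iff.2 (by
      simp only [planeDet, neg_re, neg_im] at hp' ⊢; linarith)
    have h2 : 0 < (-A / (A - B)).im := im_div_pos_iff.2 (by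
      simp only [planeDet, neg_re, neg_im, sub_re, sub_im] at hp' ⊢; linarith)
    have h3 : (B / (A - B)).im < 0 := im_div_neg_iff.2 (by
      simp only [planeDet, neg_re, neg_im, sub_re, sub_im] at hp' ⊢; linarith)
    have a1 := arg_mem_Ioo_of_im_neg h1
    have a2 := arg_mem_Ioo_of_im_pos h2
    have a3 := arg_mem_Ioo_of_im_neg h3
    apply eq_of_exp_eq_of_im_lt
    · rw [e1, exp_sub, e2, exp_neg, e3]; simp
    all_goals
      rw [turnLog]
      simp only [log_im, sub_im, neg_im, mul_im, ofReal_re, I_im, ofReal_im, I_re, mul_re, re_ofNat,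
        im_ofNat]
      linarith

/-! ## Integrals of `dz / (z - w)` along plane arcs -/

/-- The integral of `dz / (z - w)` along the arc `γ` from time `a` to time `b`. -/
def arcIntegral (γ : ℝ → ℂ) (a b : ℝ) (w : ℂ) : ℂ := ∫ t in a..b, deriv γ t / (γ t - w)

section arcIntegral

variable {γ : ℝ → ℂ} (hγ : ContDiff ℝ 1 γ)
include hγ

theorem continuousAt_arcIntegrand {w : ℂ} {t : ℝ} (h : γ t ≠ w) :
    ContinuousAt (fun t => deriv γ t / (γ t - w)) t :=
  (hγ.continuous_deriv le_rfl).continuousAt.div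
    (hγ.continuous.sub continuous_const).continuousAt (sub_ne_zero.2 h)

theorem arcIntegrable {w : ℂ} {a b : ℝ} (h : ∀ t ∈ Set.uIcc a b, γ t ≠ w) :
    IntervalIntegrable (fun t => deriv γ t / (γ t - w)) MeasureTheory.volume a b :=
  ContinuousOn.intervalIntegrable fun t ht => (continuousAt_arcIntegrand hγ (h t ht)).continuousWithinAt

theorem arcIntegral_add {w : ℂ} {a b c : ℝ} (h : ∀ t ∈ Set.uIcc a b, γ t ≠ w)
    (h' : ∀ t ∈ Set.uIcc b c, γ t ≠ w) :
    arcIntegral γ a b w + arcIntegral γ b c w = arcIntegral γ a c w :=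
  intervalIntegral.integral_add_adjacent_intervals (arcIntegrable hγ h) (arcIntegrable hγ h')

omit hγ in
theorem arcIntegral_symm (a b : ℝ) (w : ℂ) : arcIntegral γ b a w = -arcIntegral γ a b w :=
  intervalIntegral.integral_symm _ _

/-- The integrand is the logarithmic derivative of `γ - w`, so `exp (-∫) * (γ - w)` has derivative
zero. -/
theorem exp_arcIntegral {w : ℂ} {a b : ℝ} (h : ∀ t ∈ Set.uIcc a b, γ t ≠ w) :
    Complex.exp (arcIntegral γ a b w) * (γ a - w) = γ b - w := by
  wlog hab : a ≤ b generalizing a b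
  · have := this (by rwa [Set.uIcc_comm]) (le_of_not_ge hab)
    rw [← this, ← mul_assoc, ← Complex.exp_add, arcIntegral_symm b a]
    simp
  rw [Set.uIcc_of_le hab] at h
  have hd : ∀ t ∈ Set.Icc a b, HasDerivAt
      (fun t => Complex.exp (-arcIntegral γ a t w) * (γ t - w)) 0 t := by
    intro t ht
    have hm : StronglyMeasurableAtFilter (fun t => deriv γ t / (γ t - w)) (𝓝 t) :=
      ((hγ.continuous_deriv le_rfl).measurable.div
        (hγ.continuous.measurable.sub_const w)).stronglyMeasurable.stronglyMeasurableAtFilter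
    have h1 : HasDerivAt (fun t => arcIntegral γ a t w) (deriv γ t / (γ t - w)) t :=
      intervalIntegral.integral_hasDerivAt_right (arcIntegrable hγ fun s hs => h s (by
        rw [Set.uIcc_of_le ht.1] at hs; exact ⟨hs.1, hs.2.trans ht.2⟩)) hm
        (continuousAt_arcIntegrand hγ (h t ht))
    have h2 : HasDerivAt γ (deriv γ t) t := (hγ.differentiable (by simp) t).hasDerivAt
    refine (h1.neg.cexp.mul (h2.sub_const w)).congr_deriv ?_
    have := sub_ne_zero.2 (h t ht)
    rw [mul_assoc, ← mul_add, neg_mul, div_mul_cancel₀ _ this, neg_add_cancel, mul_zero]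
  have := constant_of_has_deriv_right_zero (fun t ht => (hd t ht).continuousAt.continuousWithinAt)
    (fun t ht => (hd t (Set.Ico_subset_Icc_self ht)).hasDerivWithinAt) b (Set.right_mem_Icc.2 hab)
  simp only [arcIntegral, intervalIntegral.integral_same, neg_zero, Complex.exp_zero, one_mul]
    at this ⊢
  rw [← this, ← mul_assoc, ← Complex.exp_add]
  simp

theorem continuousAt_arcIntegral {w : ℂ} {a b : ℝ} (h : ∀ t ∈ Set.uIcc a b, γ t ≠ w) :
    ContinuousAt (arcIntegral γ a b) w := by
  have hK : IsCompact (γ '' Set.uIcc a b) := isCompact_uIcc.image hγ.continuous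
  have hw : w ∉ γ '' Set.uIcc a b := by rintro ⟨t, ht, rfl⟩; exact h t ht rfl
  obtain ⟨r, hr, hball⟩ := Metric.isOpen_iff.1 hK.isClosed.isOpen_compl w hw
  have hfar : ∀ w' ∈ Metric.ball w (r / 2), ∀ t ∈ Set.uIcc a b, r / 2 ≤ ‖γ t - w'‖ := by
    intro w' hw' t ht
    have h1 : γ t ∉ Metric.ball w r := fun hm => hball hm ⟨t, ht, rfl⟩
    rw [Metric.mem_ball, not_lt] at h1
    rw [Metric.mem_ball] at hw'
    have := dist_triangle (γ t) w' w
    rw [← dist_eq_norm]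
    linarith
  have hnhds : Metric.ball w (r / 2) ∈ 𝓝 w := Metric.ball_mem_nhds w (by positivity)
  unfold arcIntegral
  refine intervalIntegral.continuousAt_of_dominated_interval
    (bound := fun t => ‖deriv γ t‖ / (r / 2)) ?_ ?_ ?_ ?_
  · exact Eventually.of_forall fun w' => ((hγ.continuous_deriv le_rfl).measurable.div
        (hγ.continuous.measurable.sub_const w')).aestronglyMeasurable
  · filter_upwards [hnhds] with w' hw'
    refine Eventually.of_forall fun t ht => ?_
    rw [norm_div]
    gcongr
    exact hfar w' hw' t (Set.uIoc_subset_uIcc ht)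
  · exact ((hγ.continuous_deriv le_rfl).norm.div_const _).intervalIntegrable _ _
  · refine Eventually.of_forall fun t ht => ?_
    exact continuousAt_const.div (continuousAt_const.sub continuousAt_id)
      (sub_ne_zero.2 (h t (Set.uIoc_subset_uIcc ht)))

/-- This forces index functions to vanish near infinity, which lets them extend over the point `∞`
of the sphere. -/
theorem tendsto_arcIntegral_cocompact (a b : ℝ) :
    Tendsto (arcIntegral γ a b) (cocompact ℂ) (𝓝 0) := by
  obtain ⟨C, hC⟩ := (isCompact_uIcc (a := a) (b := b)).exists_bound_of_continuousOn
    hγ.continuous.continuousOn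
  obtain ⟨C', hC'⟩ := (isCompact_uIcc (a := a) (b := b)).exists_bound_of_continuousOn
    (hγ.continuous_deriv le_rfl).continuousOn
  have hn : Tendsto (fun w : ℂ => ‖w‖ - C) (cocompact ℂ) atTop :=
    tendsto_atTop_add_const_right _ _ (tendsto_norm_cocompact_atTop (E := ℂ))
  have h0 : Tendsto (fun w : ℂ => C' / (‖w‖ - C) * |b - a|) (cocompact ℂ) (𝓝 0) := by
    simpa using (hn.const_div_atTop C').mul_const |b - a|
  refine squeeze_zero_norm' ?_ h0
  filter_upwards [hn.eventually_gt_atTop 0] with w hw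
  refine intervalIntegral.norm_integral_le_of_norm_le_const fun t ht => ?_
  have ht' := Set.uIoc_subset_uIcc ht
  rw [norm_div]
  have h1 : ‖w‖ - C ≤ ‖γ t - w‖ := by
    have := norm_sub_norm_le w (γ t)
    rw [norm_sub_rev] at this
    linarith [hC t ht']
  have h2 := hC' t ht'
  exact div_le_div₀ ((norm_nonneg _).trans h2) h2 hw h1

end arcIntegral

/-- A point of the slit plane and the positive reals lie in a common open half plane that
is contained in the slit plane. -/
theorem exists_halfPlane_subset_slitPlane {q : ℂ} (hq : q ∈ Complex.slitPlane) :
    ∃ α β : ℝ, 0 < α ∧ 0 < α * q.re + β * q.im ∧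
      ∀ z : ℂ, 0 < α * z.re + β * z.im → z ∈ Complex.slitPlane := by
  have hpos : 0 < ‖q‖ + q.re := by
    by_contra! h
    have h2 := Complex.sq_norm_sub_sq_re q
    have h1 : q.re ≤ 0 := by linarith [norm_nonneg q]
    have h3 : q.im ^ 2 ≤ 0 := by nlinarith [norm_nonneg q]
    have h4 : q.im = 0 := by nlinarith
    rcases hq with h5 | h5
    · linarith
    · exact h5 h4
  have hq0 : 0 < ‖q‖ := norm_pos_iff.2 (Complex.slitPlane_ne_zero hq)
  -- The normal vector of the half plane is `‖q‖ + q`, which bisects the angle between `q` and the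
  -- positive reals.
  refine ⟨‖q‖ + q.re, q.im, hpos, ?_, fun z hz => ?_⟩
  · have h2 := Complex.sq_norm_sub_sq_re q
    nlinarith [mul_pos hq0 hpos]
  · by_cases h : z.im = 0
    · left
      rw [h, mul_zero, add_zero] at hz
      exact (pos_iff_pos_of_mul_pos hz).1 hpos
    · exact Or.inr h

open Complex in
theorem eventually_log_mul_eq {q : ℂ} (hq : q ∈ slitPlane) :
    ∀ᶠ y in 𝓝 (1 : ℂ), log (q * y) = log q + log y := by
  have h1 : Tendsto (fun y => arg q + arg y) (𝓝 1) (𝓝 (arg q + arg 1)) :=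
    (continuousAt_const.add (continuousAt_arg one_mem_slitPlane))
  rw [arg_one, add_zero] at h1
  have h2 := mem_slitPlane_iff_arg.1 hq
  have h3 : arg q ∈ Set.Ioo (-Real.pi) Real.pi :=
    ⟨neg_pi_lt_arg q, lt_of_le_of_ne (arg_le_pi q) h2.1⟩
  filter_upwards [h1.eventually (isOpen_Ioo.mem_nhds h3), eventually_ne_nhds one_ne_zero]
    with y hy hy0
  exact log_mul (slitPlane_ne_zero hq) hy0 (Set.Ioo_subset_Ioc_self hy)

theorem tendsto_of_tendsto_div {w : ℝ → ℂ} {p ζ : ℂ}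
    (hw : Tendsto (fun r : ℝ => (w r - p) / r) (𝓝[>] 0) (𝓝 ζ)) :
    Tendsto w (𝓝[>] 0) (𝓝 p) := by
  have h0 : Tendsto (fun r : ℝ => (r : ℂ)) (𝓝[>] 0) (𝓝 0) :=
    (Complex.continuous_ofReal.tendsto' 0 0 (by simp)).mono_left nhdsWithin_le_nhds
  have h1 := (h0.mul hw).add_const p
  rw [zero_mul, zero_add] at h1
  refine h1.congr' ?_
  filter_upwards [self_mem_nhdsWithin] with r hr
  have : (r : ℂ) ≠ 0 := by exact_mod_cast (Set.mem_Ioi.1 hr).ne'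
  field_simp
  ring

/-! ### Asymptotics of the integral along a half strand -/

section
variable {γ : ℝ → ℂ} (hγ : ContDiff ℝ 1 γ)
include hγ

theorem tendsto_slope_side (t₀ : ℝ) {s : ℝ} (hs : s = 1 ∨ s = -1) :
    Tendsto (fun δ : ℝ => (γ (t₀ + s * δ) - γ t₀) / δ) (𝓝[>] 0) (𝓝 (s * deriv γ t₀)) := by
  have h : HasDerivAt γ (deriv γ t₀) (t₀ + s * 0) := by
    rw [mul_zero, add_zero]; exact (hγ.differentiable (by simp) t₀).hasDerivAt
  have h1 : HasDerivAt (fun δ : ℝ => t₀ + s * δ) s 0 := by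
    simpa using ((hasDerivAt_id (0 : ℝ)).const_mul s).const_add t₀
  have h2 := (h.scomp 0 h1).tendsto_slope_zero_right
  simpa [div_eq_inv_mul] using h2

open Complex in
-- On a short half strand `log ((γ t - w r) / (-ζ))` is a primitive of the integrand. Its value at
-- `t₀` is `log r` up to a term that tends to zero. The limit splits into the logarithm of the
-- direction of the half strand relative to `ζ` and a term that does not involve `ζ`; the latter and
-- `log r` disappear from sums of total weight zero.
theorem arcIntegral_half (t₀ : ℝ) {s : ℝ} (hs : s = 1 ∨ s = -1) {w : ℝ → ℂ} {ζ : ℂ}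
    (hw : Tendsto (fun r : ℝ => (w r - γ t₀) / r) (𝓝[>] 0) (𝓝 ζ))
    (hζ : -(s * deriv γ t₀) / ζ ∈ slitPlane) :
    ∀ᶠ δ : ℝ in 𝓝[>] 0,
      (∀ᶠ r in 𝓝[>] 0, ∀ t ∈ Set.uIcc t₀ (t₀ + s * δ), γ t ≠ w r) ∧
      Tendsto (fun r => arcIntegral γ t₀ (t₀ + s * δ) (w r) + Real.log r) (𝓝[>] 0)
        (𝓝 (log (-(s * deriv γ t₀) / ζ) +
          (log ((γ (t₀ + s * δ) - γ t₀) / δ / (s * deriv γ t₀)) + Real.log δ))) := by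
  have hζ0 : ζ ≠ 0 := by rintro rfl; simp at hζ
  have hv0 : (s * deriv γ t₀ : ℂ) ≠ 0 := by intro h; simp [h] at hζ
  obtain ⟨α, β, hα, hq, hsub⟩ := exists_halfPlane_subset_slitPlane hζ
  have hslope := tendsto_slope_side hγ t₀ hs
  have hcont : Continuous fun z : ℂ => α * z.re + β * z.im := by fun_prop
  have e1 : ∀ᶠ δ : ℝ in 𝓝[>] 0, 0 < α * (-((γ (t₀ + s * δ) - γ t₀) / δ) / ζ).re +
      β * (-((γ (t₀ + s * δ) - γ t₀) / δ) / ζ).im :=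
    ((hcont.tendsto _).comp (hslope.neg.div_const ζ)).eventually_const_lt hq
  have e2 : ∀ᶠ δ : ℝ in 𝓝[>] 0,
      log (-(s * deriv γ t₀) / ζ * ((γ (t₀ + s * δ) - γ t₀) / δ / (s * deriv γ t₀))) =
      log (-(s * deriv γ t₀) / ζ) + log ((γ (t₀ + s * δ) - γ t₀) / δ / (s * deriv γ t₀)) := by
    have := hslope.div_const (s * deriv γ t₀ : ℂ)
    rw [div_self hv0] at this
    exact this.eventually (eventually_log_mul_eq hζ)
  have e3 : ∀ᶠ r : ℝ in 𝓝[>] 0, 0 < α * ((w r - γ t₀) / r / ζ).re +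
      β * ((w r - γ t₀) / r / ζ).im := by
    refine ((hcont.tendsto _).comp (hw.div_const ζ)).eventually_const_lt ?_
    rw [div_self hζ0]; simpa using hα
  obtain ⟨ε, hε, hε1⟩ := mem_nhdsGT_iff_exists_Ioo_subset.1 e1
  filter_upwards [e2, Ioo_mem_nhdsGT hε] with δ hδ2 hδ
  have hss : s * s = 1 := by rcases hs with rfl | rfl <;> norm_num
  -- The quotient is a combination, with nonnegative coefficients `δ'` and `r > 0`, of a chord slope
  -- and of `(w r - γ t₀) / r`, both divided by `±ζ`. These lie in one half plane inside the slit
  -- plane, so no branch cut is crossed.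
  have key : ∀ r : ℝ, 0 < r → 0 < α * ((w r - γ t₀) / r / ζ).re +
      β * ((w r - γ t₀) / r / ζ).im → ∀ t ∈ Set.uIcc t₀ (t₀ + s * δ),
      (γ t - w r) / (-ζ) ∈ slitPlane := by
    intro r hr hr3 t ht
    obtain ⟨δ', h0, h1, rfl⟩ : ∃ δ', 0 ≤ δ' ∧ δ' ≤ δ ∧ t = t₀ + s * δ' := by
      refine ⟨s * (t - t₀), ?_, ?_, by linear_combination (-(t - t₀)) * hss⟩ <;>
        rcases hs with rfl | rfl <;> simp only [Set.uIcc, Set.mem_Icc] at ht <;>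
        have := hδ.1
      · rw [min_eq_left (by linarith)] at ht; linarith
      · rw [min_eq_right (by linarith), max_eq_left (by linarith)] at ht; linarith
      · rw [max_eq_right (by linarith)] at ht; linarith
      · rw [min_eq_right (by linarith)] at ht; linarith
    apply hsub
    have hr0 : (r : ℂ) ≠ 0 := by exact_mod_cast hr.ne'
    rcases h0.eq_or_lt with rfl | h0
    · have : (γ (t₀ + s * 0) - w r) / (-ζ) = r * ((w r - γ t₀) / r / ζ) := by
        rw [mul_zero, add_zero]; field_simp; ring
      rw [this, re_ofReal_mul, im_ofReal_mul]
      nlinarith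
    · have h4 := hε1 ⟨h0, h1.trans_lt hδ.2⟩
      simp only [Set.mem_ofPred_eq] at h4
      have hd0 : (δ' : ℂ) ≠ 0 := by exact_mod_cast h0.ne'
      have : (γ (t₀ + s * δ') - w r) / (-ζ) =
          δ' * (-((γ (t₀ + s * δ') - γ t₀) / δ') / ζ) + r * ((w r - γ t₀) / r / ζ) := by
        field_simp; ring
      rw [this, add_re, add_im, re_ofReal_mul, im_ofReal_mul, re_ofReal_mul, im_ofReal_mul]
      nlinarith [mul_pos h0 h4]
  have hne : ∀ r : ℝ, 0 < r → 0 < α * ((w r - γ t₀) / r / ζ).re +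
      β * ((w r - γ t₀) / r / ζ).im → ∀ t ∈ Set.uIcc t₀ (t₀ + s * δ), γ t ≠ w r := by
    intro r hr hr3 t ht h
    have := key r hr hr3 t ht
    rw [h, sub_self, zero_div] at this
    exact zero_notMem_slitPlane this
  refine ⟨?_, ?_⟩
  · filter_upwards [e3, self_mem_nhdsWithin] with r hr3 hr using hne r hr hr3
  have hw0 := tendsto_of_tendsto_div hw
  set b := t₀ + s * δ with hb
  have hd0 : (δ : ℂ) ≠ 0 := by exact_mod_cast hδ.1.ne'
  have hfac : (γ b - γ t₀) / (-ζ) =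
      δ * (-(s * deriv γ t₀) / ζ * ((γ b - γ t₀) / δ / (s * deriv γ t₀))) := by
    have : ∀ x V : ℂ, V ≠ 0 → x / (-ζ) = δ * (-V / ζ * (x / δ / V)) := by
      intro x V hV; field_simp
    exact this _ _ hv0
  have hbs : (γ b - γ t₀) / (-ζ) ∈ slitPlane := by
    apply hsub
    have h4 := hε1 hδ
    simp only [Set.mem_ofPred_eq] at h4
    have : (γ b - γ t₀) / (-ζ) = δ * (-((γ b - γ t₀) / δ) / ζ) := by field_simp
    rw [this, re_ofReal_mul, im_ofReal_mul]
    nlinarith [mul_pos hδ.1 h4]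
  have hval : log (-(s * deriv γ t₀) / ζ) +
      (log ((γ b - γ t₀) / δ / (s * deriv γ t₀)) + Real.log δ) =
      log ((γ b - γ t₀) / (-ζ)) - log 1 := by
    rw [log_one, hfac, log_ofReal_mul hδ.1, hδ2]
    · push_cast; ring
    · intro h0
      rw [hfac, h0, mul_zero] at hbs
      exact zero_notMem_slitPlane hbs
  rw [hval]
  have l1 : Tendsto (fun r => log ((γ b - w r) / (-ζ))) (𝓝[>] 0)
      (𝓝 (log ((γ b - γ t₀) / (-ζ)))) := ((hw0.const_sub (γ b)).div_const _).clog hbs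
  have l2 : Tendsto (fun r : ℝ => log ((w r - γ t₀) / r / ζ)) (𝓝[>] 0) (𝓝 (log 1)) := by
    have := hw.div_const ζ
    rw [div_self hζ0] at this
    exact this.clog one_mem_slitPlane
  refine (l1.sub l2).congr' ?_
  filter_upwards [e3, self_mem_nhdsWithin] with r hr3 hr
  have hr : 0 < r := hr
  have hr0 : (r : ℂ) ≠ 0 := by exact_mod_cast hr.ne'
  have hI : arcIntegral γ t₀ b (w r) =
      log ((γ b - w r) / (-ζ)) - log ((γ t₀ - w r) / (-ζ)) := by
    refine intervalIntegral.integral_eq_sub_of_hasDerivAt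
      (f := fun t => log ((γ t - w r) / (-ζ))) (fun t ht => ?_) (arcIntegrable hγ (hne r hr hr3))
    have h2 : HasDerivAt γ (deriv γ t) t := (hγ.differentiable (by simp) t).hasDerivAt
    refine (((h2.sub_const (w r)).div_const (-ζ)).clog_real (key r hr hr3 t ht)).congr_deriv ?_
    have := sub_ne_zero.2 (hne r hr hr3 t ht)
    field_simp
  have hlog : log ((γ t₀ - w r) / (-ζ)) = Real.log r + log ((w r - γ t₀) / r / ζ) := by
    rw [← log_ofReal_mul hr]
    · congr 1; field_simp; ring
    · intro h0; simp [h0] at hr3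
  rw [hI, hlog]; ring

end

/-! ## Limits of weighted sums of arc integrals -/

/-- As `r → 0+`, the points `w k r` are off the arc from time `a` to time `b`, and the sum, with
weights `n k`, of the arc integrals at these points tends to `L`. -/
def ArcLim {K : Type*} [Fintype K] (γ : ℝ → ℂ) (n : K → ℂ) (w : K → ℝ → ℂ) (a b : ℝ) (L : ℂ) :
    Prop :=
  (∀ k, ∀ᶠ r in 𝓝[>] 0, ∀ t ∈ Set.uIcc a b, γ t ≠ w k r) ∧
    Tendsto (fun r => ∑ k, n k * arcIntegral γ a b (w k r)) (𝓝[>] 0) (𝓝 L)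

open Classical in
/-- The contribution of the half strand that leaves the point `p` at time `t` in the direction of
time `s`. -/
def sideLog (γ : ℝ → ℂ) (p : ℂ) (t s : ℝ) (ζ : ℂ) : ℂ :=
  if γ t = p then Complex.log (-(s * deriv γ t) / ζ) else 0

section ArcLim

variable {K : Type*} [Fintype K] {γ : ℝ → ℂ} {n : K → ℂ} {w : K → ℝ → ℂ} {a b c : ℝ} {L L' : ℂ}

theorem ArcLim.symm (h : ArcLim γ n w a b L) : ArcLim γ n w b a (-L) := by
  refine ⟨by simpa only [Set.uIcc_comm] using h.1, h.2.neg.congr fun r => ?_⟩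
  simp only [arcIntegral_symm a b, mul_neg, Finset.sum_neg_distrib]

variable (hγ : ContDiff ℝ 1 γ)
include hγ

theorem ArcLim.add (h : ArcLim γ n w a b L) (h' : ArcLim γ n w b c L') :
    ArcLim γ n w a c (L + L') := by
  refine ⟨fun k => ?_, (h.2.add h'.2).congr' ?_⟩
  · filter_upwards [h.1 k, h'.1 k] with r h1 h2 t ht
    rcases Set.uIcc_subset_uIcc_union_uIcc ht with h3 | h3
    exacts [h1 t h3, h2 t h3]
  · filter_upwards [eventually_all.2 h.1, eventually_all.2 h'.1] with r h1 h2
    rw [← Finset.sum_add_distrib]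
    exact Finset.sum_congr rfl fun k _ => by
      rw [← mul_add, arcIntegral_add hγ (h1 k) (h2 k)]

variable (hn : ∑ k, n k = 0) {p : ℂ} {ζ : K → ℂ}
  (hw : ∀ k, Tendsto (fun r : ℝ => (w k r - p) / r) (𝓝[>] 0) (𝓝 (ζ k)))
include hn hw

/-- All the integrals converge to their common value at `p`, and the weights add up to zero. -/
theorem ArcLim.of_forall_ne (h : ∀ t ∈ Set.uIcc a b, γ t ≠ p) : ArcLim γ n w a b 0 := by
  have hp : ∀ᶠ z in 𝓝 p, ∀ t ∈ Set.uIcc a b, γ t ≠ z := by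
    have hK : IsCompact (γ '' Set.uIcc a b) := isCompact_uIcc.image hγ.continuous
    have : (γ '' Set.uIcc a b)ᶜ ∈ 𝓝 p := hK.isClosed.isOpen_compl.mem_nhds (by
      rintro ⟨t, ht, hp⟩; exact h t ht hp)
    filter_upwards [this] with z hz t ht e
    exact hz ⟨t, ht, e⟩
  refine ⟨fun k => (tendsto_of_tendsto_div (hw k)).eventually hp, ?_⟩
  have : Tendsto (fun r => ∑ k, n k * arcIntegral γ a b (w k r)) (𝓝[>] 0)
      (𝓝 (∑ k, n k * arcIntegral γ a b p)) :=
    tendsto_finsetSum _ fun k _ => (((continuousAt_arcIntegral hγ h).tendsto.comp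
      (tendsto_of_tendsto_div (hw k))).const_mul _)
  rwa [← Finset.sum_mul, hn, zero_mul] at this

theorem eventually_arcLim_side (t₀ : ℝ) {s : ℝ} (hs : s = 1 ∨ s = -1)
    (hζ : γ t₀ = p → ∀ k, -(s * deriv γ t₀) / ζ k ∈ Complex.slitPlane) :
    ∀ᶠ δ in 𝓝[>] (0 : ℝ), ArcLim γ n w t₀ (t₀ + s * δ) (∑ k, n k * sideLog γ p t₀ s (ζ k)) := by
  by_cases hp : γ t₀ = p
  · subst hp
    have := eventually_all.2 fun k => arcIntegral_half hγ t₀ hs (hw k) (hζ rfl k)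
    filter_upwards [this] with δ hδ
    refine ⟨fun k => (hδ k).1, ?_⟩
    have h1 := tendsto_finsetSum Finset.univ fun k _ => ((hδ k).2.const_mul (n k))
    -- By `hn`, both the divergent `log r` and the terms that do not depend on `k` cancel.
    simp only [mul_add, Finset.sum_add_distrib, ← Finset.sum_mul, hn, zero_mul, add_zero] at h1
    simpa only [sideLog, if_true] using h1
  · have h0 : ∑ k, n k * sideLog γ p t₀ s (ζ k) = 0 := by simp [sideLog, hp]
    rw [h0]
    have h1 : ∀ᶠ t in 𝓝 t₀, γ t ≠ p := hγ.continuous.continuousAt.eventually_ne hp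
    obtain ⟨ε, hε, h2⟩ := Metric.eventually_nhds_iff.1 h1
    filter_upwards [Ioo_mem_nhdsGT hε] with δ hδ
    refine ArcLim.of_forall_ne hγ hn hw fun t ht => h2 ?_
    have := Set.abs_sub_left_of_mem_uIcc ht
    rw [Real.dist_eq]
    have h3 : |t₀ + s * δ - t₀| = δ := by
      rw [add_sub_cancel_left, abs_mul, abs_of_pos hδ.1]
      rcases hs with rfl | rfl <;> simp
    linarith [hδ.2]

/-- The limit along an arc whose interior does not pass through `p`. -/
theorem ArcLim.of_interior (hab : a < b) (h : ∀ t ∈ Set.Ioo a b, γ t ≠ p)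
    (ha : γ a = p → ∀ k, -deriv γ a / ζ k ∈ Complex.slitPlane)
    (hb : γ b = p → ∀ k, deriv γ b / ζ k ∈ Complex.slitPlane) :
    ArcLim γ n w a b
      (∑ k, n k * sideLog γ p a 1 (ζ k) - ∑ k, n k * sideLog γ p b (-1) (ζ k)) := by
  have h1 := eventually_arcLim_side hγ hn hw a (s := 1) (Or.inl rfl) (by simpa using ha)
  have h2 := eventually_arcLim_side hγ hn hw b (s := -1) (Or.inr rfl) (by simpa using hb)
  -- With `δ` below a third of the length, the two end pieces leave a middle piece that avoids `p`.
  have hpos : 0 < (b - a) / 3 := by linarith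
  obtain ⟨δ, hδ1, hδ2, hδ⟩ := (h1.and (h2.and (Ioo_mem_nhdsGT hpos))).exists
  have h3 : ArcLim γ n w (a + 1 * δ) (b + -1 * δ) 0 := by
    refine ArcLim.of_forall_ne hγ hn hw fun t ht => h t ?_
    rw [Set.uIcc_of_le (by linarith [hδ.2])] at ht
    constructor <;> linarith [hδ.1, ht.1, ht.2]
  have := ArcLim.add hγ (ArcLim.add hγ hδ1 h3) hδ2.symm
  rwa [add_zero, ← sub_eq_add_neg] at this

/-- If straight passages through `p` contribute nothing, then only the ends of an arc contribute. -/
theorem ArcLim.of_straight [Nonempty K]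
    (hζ : ∀ t, γ t = p → ∀ k, -deriv γ t / ζ k ∈ Complex.slitPlane ∧
      deriv γ t / ζ k ∈ Complex.slitPlane)
    (hst : ∀ t, ∑ k, n k * sideLog γ p t 1 (ζ k) = ∑ k, n k * sideLog γ p t (-1) (ζ k))
    (a b : ℝ) :
    ArcLim γ n w a b
      (∑ k, n k * sideLog γ p a 1 (ζ k) - ∑ k, n k * sideLog γ p b 1 (ζ k)) := by
  set m : ℝ → ℂ := fun t => ∑ k, n k * sideLog γ p t 1 (ζ k) with hm
  change ArcLim γ n w a b (m a - m b)
  have hdisc : ∀ t, ∀ᶠ u in 𝓝[≠] t, γ u ≠ p := by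
    intro t
    by_cases ht : γ t = p
    · have hd : HasDerivAt γ (deriv γ t) t := (hγ.differentiable (by simp) t).hasDerivAt
      refine hd.eventually_ne fun h0 => ?_
      have := (hζ t ht (Classical.arbitrary K)).2
      rw [h0, zero_div] at this
      exact Complex.zero_notMem_slitPlane this
    · exact (hγ.continuous.continuousAt.eventually_ne ht).filter_mono nhdsWithin_le_nhds
  -- The claim is symmetric and transitive in the two times, so it suffices to prove it for nearby
  -- times; `m` vanishes at all times close to `x` but different from it.
  refine isPreconnected_univ.induction₂ (fun x y => ArcLim γ n w x y (m x - m y)) ?_ ?_ ?_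
    (Set.mem_univ a) (Set.mem_univ b)
  · intro x _
    have h1 := eventually_arcLim_side hγ hn hw x (s := 1) (Or.inl rfl)
      fun hx k => by simpa using (hζ x hx k).1
    have h2 := eventually_arcLim_side hγ hn hw x (s := -1) (Or.inr rfl)
      fun hx k => by simpa using (hζ x hx k).2
    rw [← hst x] at h2
    have hm0 : ∀ᶠ y in 𝓝[≠] x, m y = 0 := by
      filter_upwards [hdisc x] with y hy
      simp [hm, sideLog, hy]
    obtain ⟨ε₁, hε₁, h1⟩ := mem_nhdsGT_iff_exists_Ioo_subset.1 h1
    obtain ⟨ε₂, hε₂, h2⟩ := mem_nhdsGT_iff_exists_Ioo_subset.1 h2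
    have hxx : ArcLim γ n w x x 0 := by
      have hε₁ : 0 < ε₁ := hε₁
      have h3 : ArcLim γ n w x _ _ := h1 (show ε₁ / 2 ∈ Set.Ioo 0 ε₁ by constructor <;> linarith)
      simpa using ArcLim.add hγ h3 h3.symm
    rw [nhdsWithin_univ]
    filter_upwards [Ioo_mem_nhds (show x - ε₂ < x by simpa using hε₂)
      (show x < x + ε₁ by simpa using hε₁), eventually_nhdsWithin_iff.1 hm0] with y hy hy0
    rcases lt_trichotomy y x with hlt | rfl | hlt
    · rw [hy0 hlt.ne, sub_zero]
      have h3 : ArcLim γ n w x (x + -1 * (x - y)) (m x) :=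
        h2 ⟨by linarith, by linarith [hy.1]⟩
      rwa [show x + -1 * (x - y) = y by ring] at h3
    · rwa [sub_self]
    · rw [hy0 hlt.ne', sub_zero]
      have h3 : ArcLim γ n w x (x + 1 * (y - x)) (m x) :=
        h1 ⟨by linarith, by linarith [hy.2]⟩
      rwa [show x + 1 * (y - x) = y by ring] at h3
  · intro x y z _ _ _ h1 h2
    have := ArcLim.add hγ h1 h2
    rwa [sub_add_sub_cancel] at this
  · intro x y _ _ h1
    have := h1.symm
    rwa [neg_sub] at this

end ArcLim

namespace LinkDiagram

/-! ## Passages and the projection image -/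

section Passages

variable {l : ℕ} (D : LinkDiagram l)

theorem contDiff_one (c : Fin l) : ContDiff ℝ 1 (D.curve c) :=
  (D.smooth c).of_le (by exact_mod_cast le_top)

theorem continuous_curve (c : Fin l) : Continuous (D.curve c) := (D.smooth c).continuous

theorem curve_add_int (c : Fin l) (t : ℝ) (n : ℤ) : D.curve c (t + n) = D.curve c t := by
  simpa using (D.periodic c).int_mul n t

theorem deriv_add_int (c : Fin l) (t : ℝ) (n : ℤ) :
    deriv (D.curve c) (t + n) = deriv (D.curve c) t := by
  rw [← deriv_comp_add_const]
  simp only [curve_add_int]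

/-- The passage of the component `c` at an arbitrary time `t`. -/
def passage (c : Fin l) (t : ℝ) : Passage l := (c, ⟨Int.fract t, Int.fract_nonneg t, Int.fract_lt_one t⟩)

omit D in
@[simp] theorem passage_fst (c : Fin l) (t : ℝ) : (passage c t).1 = c := rfl

omit D in
theorem passage_eq_iff {c c' : Fin l} {t t' : ℝ} :
    passage c t = passage c' t' ↔ c = c' ∧ ∃ n : ℤ, t = t' + n := by
  simp only [passage, Prod.mk.injEq, Subtype.ext_iff, Int.fract_eq_fract]
  refine and_congr_right fun _ => exists_congr fun n => ?_
  rw [sub_eq_iff_eq_add, add_comm]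

omit D in
theorem passage_coe (a : Passage l) : passage a.1 a.2 = a := by
  rcases a with ⟨c, t, ht⟩
  simp only [passage, Prod.mk.injEq, Subtype.ext_iff, true_and]
  exact Int.fract_eq_self.2 ht

omit D in
theorem passage_add_int (c : Fin l) (t : ℝ) (n : ℤ) : passage c (t + n) = passage c t :=
  passage_eq_iff.2 ⟨rfl, n, rfl⟩

@[simp] theorem point_passage (c : Fin l) (t : ℝ) : D.point (passage c t) = D.curve c t := by
  change D.curve c (Int.fract t) = _
  rw [← D.curve_add_int c (Int.fract t) ⌊t⌋, Int.fract_add_floor]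

@[simp] theorem velocity_passage (c : Fin l) (t : ℝ) :
    D.velocity (passage c t) = deriv (D.curve c) t := by
  change deriv (D.curve c) (Int.fract t) = _
  rw [← D.deriv_add_int c (Int.fract t) ⌊t⌋, Int.fract_add_floor]

theorem curve_mem_image (c : Fin l) (t : ℝ) : D.curve c t ∈ D.image := ⟨c, t, rfl⟩

theorem image_eq : D.image = ⋃ c, D.curve c '' Set.Icc 0 1 := by
  ext z
  simp only [image, Set.mem_ofPred_eq, Set.mem_iUnion, Set.mem_image]
  refine exists_congr fun c => ⟨?_, fun ⟨t, _, h⟩ => ⟨t, h⟩⟩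
  rintro ⟨t, rfl⟩
  refine ⟨Int.fract t, ⟨Int.fract_nonneg t, (Int.fract_lt_one t).le⟩, ?_⟩
  rw [← D.curve_add_int c (Int.fract t) ⌊t⌋, Int.fract_add_floor]

theorem isCompact_image : IsCompact D.image := by
  rw [image_eq]
  exact isCompact_iUnion fun c => isCompact_Icc.image (D.continuous_curve c)

/-- Near a point `p`, the projection image consists of points on the strands through `p`. -/
theorem eventually_mem_image_imp (p : ℂ) {ε : ℝ} (hε : 0 < ε) :
    ∀ᶠ q in 𝓝 p, q ∈ D.image →
      ∃ a : Passage l, D.point a = p ∧ ∃ t : ℝ, |t - a.2| < ε ∧ D.curve a.1 t = q := by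
  have key : ∀ c, ∀ᶠ q in 𝓝 p, ∀ t ∈ Set.Icc (0 : ℝ) 1, D.curve c t = q →
      ∃ a : Passage l, D.point a = p ∧ ∃ t : ℝ, |t - a.2| < ε ∧ D.curve a.1 t = q := by
    intro c
    refine isCompact_Icc.eventually_forall_of_forall_eventually fun t' _ => ?_
    by_cases hp : D.curve c t' = p
    · have : ∀ᶠ z : ℂ × ℝ in 𝓝 (p, t'), |z.2 - t'| < ε :=
        (continuous_snd.tendsto (p, t')).eventually (Metric.ball_mem_nhds t' hε)
      filter_upwards [this] with z hz he
      refine ⟨passage c t', by simpa using hp, z.2 + (-⌊t'⌋ : ℤ), ?_, ?_⟩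
      · change |z.2 + (-⌊t'⌋ : ℤ) - Int.fract t'| < ε
        have : z.2 + (-⌊t'⌋ : ℤ) - Int.fract t' = z.2 - t' := by
          rw [Int.fract]; push_cast; ring
        rwa [this]
      · rw [passage_fst, curve_add_int, he]
    · have h1 : Tendsto (fun z : ℂ × ℝ => D.curve c z.2 - z.1) (𝓝 (p, t'))
          (𝓝 (D.curve c t' - p)) :=
        (((D.continuous_curve c).comp continuous_snd).sub continuous_fst).tendsto (p, t')
      filter_upwards [h1.eventually_ne (sub_ne_zero.2 hp)] with z hz he
      exact absurd (sub_eq_zero.2 he) hz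
  filter_upwards [eventually_all.2 key] with q hq hmem
  rw [image_eq] at hmem
  obtain ⟨c, t, ht, e⟩ := Set.mem_iUnion.1 hmem
  exact hq c t ht e

end Passages

/-! ### The rays of the four corners at a crossing -/

section Crossing

variable {l : ℕ} {D : LinkDiagram l} (x : D.Crossing)

theorem Crossing.det_ne_zero :
    planeDet (D.velocity x.overPass) (D.velocity x.underPass) ≠ 0 :=
  D.transverse _ _ x.ne x.same_point

theorem Crossing.eq_or_eq {a : Passage l} (h : D.point a = x.center) :
    a = x.overPass ∨ a = x.underPass := by
  rcases D.double a x.overPass x.underPass h x.same_point with h | h | h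
  · exact Or.inl h
  · exact absurd h x.ne
  · exact Or.inr h

/-- The ray of the corner `κ`. -/
def Crossing.ray (κ : Corner) : ℂ := x.overRay κ + x.underRay κ

theorem Crossing.ray_eq (κ : Corner) :
    x.ray κ = ((κ.1 : ℤ) : ℂ) * D.velocity x.overPass + ((κ.2 : ℤ) : ℂ) * D.velocity x.underPass :=
  rfl

theorem Crossing.ray_neg (κ : Corner) : x.ray (-κ) = -x.ray κ := by
  simp only [ray_eq, Prod.fst_neg, Prod.snd_neg, Units.val_neg]
  push_cast; ring

theorem Crossing.det_over_ray (κ : Corner) : planeDet (D.velocity x.overPass) (x.ray κ) =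
    (κ.2 : ℤ) * planeDet (D.velocity x.overPass) (D.velocity x.underPass) := by
  rw [ray_eq, planeDet_add_right, planeDet_intCast_mul_right, planeDet_intCast_mul_right,
    planeDet_self]
  ring

theorem Crossing.det_under_ray (κ : Corner) : planeDet (D.velocity x.underPass) (x.ray κ) =
    -((κ.1 : ℤ) * planeDet (D.velocity x.overPass) (D.velocity x.underPass)) := by
  rw [ray_eq, planeDet_add_right, planeDet_intCast_mul_right, planeDet_intCast_mul_right,
    planeDet_self, planeDet_swap]
  ring

theorem Crossing.det_ray_ne_zero {a : Passage l} (h : D.point a = x.center) (κ : Corner) :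
    planeDet (D.velocity a) (x.ray κ) ≠ 0 := by
  have := x.det_ne_zero
  rcases x.eq_or_eq h with rfl | rfl
  · rw [det_over_ray]
    exact mul_ne_zero (by exact_mod_cast κ.2.ne_zero) this
  · rw [det_under_ray]
    exact neg_ne_zero.2 (mul_ne_zero (by exact_mod_cast κ.1.ne_zero) this)

theorem Crossing.cornerPoint_eq (κ : Corner) (t : ℝ) :
    x.cornerPoint κ t = x.center + (t : ℂ) * x.ray κ := rfl

end Crossing

/-- A strand does not meet a thin sector around a ray that is not tangent to it. -/
theorem exists_sector_disjoint {γ : ℝ → ℂ} {t₀ : ℝ} {v ζ : ℂ} (hγ : HasDerivAt γ v t₀)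
    (h : planeDet v ζ ≠ 0) :
    ∃ ε > 0, ∀ t, |t - t₀| < ε → ∀ r : ℝ, 0 < r → ∀ ζ', ‖ζ' - ζ‖ < ε → γ t ≠ γ t₀ + r * ζ' := by
  have hcont : Continuous fun z : ℂ × ℂ => planeDet z.1 z.2 := by
    unfold planeDet; fun_prop
  have h1 : ∀ᶠ z : ℂ × ℂ in 𝓝 v ×ˢ 𝓝 ζ, planeDet z.1 z.2 ≠ 0 := by
    rw [← nhds_prod_eq]
    exact hcont.continuousAt.eventually_ne h
  have h2 : ∀ᶠ z : ℝ × ℂ in 𝓝[≠] t₀ ×ˢ 𝓝 ζ, planeDet (slope γ t₀ z.1) z.2 ≠ 0 :=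
    (hγ.tendsto_slope.prodMap tendsto_id).eventually h1
  have hζ : ζ ≠ 0 := by rintro rfl; simp [planeDet] at h
  obtain ⟨p1, hp1, p2, hp2, hp⟩ := eventually_prod_iff.1 h2
  rw [eventually_nhdsWithin_iff] at hp1
  obtain ⟨ε₁, hε₁, h3⟩ := Metric.eventually_nhds_iff.1 hp1
  obtain ⟨ε₂, hε₂, h4⟩ := Metric.eventually_nhds_iff.1 (hp2.and (eventually_ne_nhds hζ))
  refine ⟨min ε₁ ε₂, lt_min hε₁ hε₂, fun t ht r hr ζ' hζ' he => ?_⟩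
  have h5 := h4 (y := ζ') (by rw [dist_eq_norm]; exact hζ'.trans_le (min_le_right _ _))
  by_cases htt : t = t₀
  · rw [htt, left_eq_add, mul_eq_zero] at he
    rcases he with he | he
    · exact hr.ne' (by exact_mod_cast he)
    · exact h5.2 he
  · have h6 := hp (h3 (y := t) (by rw [Real.dist_eq]; exact ht.trans_le (min_le_left _ _)) htt) h5.1
    apply h6
    -- A common point would make the chord slope a real multiple of `ζ'`, so their determinant would
    -- vanish, although it is close to `planeDet v ζ`.
    have : slope γ t₀ t = (((t - t₀)⁻¹ * r : ℝ) : ℂ) * ζ' := by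
      rw [slope_def_module, he, add_sub_cancel_left, Complex.real_smul]; push_cast; ring
    simp only [this]
    rw [planeDet_swap, planeDet_ofReal_mul_right, planeDet_self, mul_zero, neg_zero]

section Corners

variable {l : ℕ} {D : LinkDiagram l} (x : D.Crossing)

theorem hasDerivAt_curve (a : Passage l) : HasDerivAt (D.curve a.1) (D.velocity a) a.2 :=
  ((D.contDiff_one a.1).differentiable (by simp) _).hasDerivAt

/-- A disc around a point of a corner, of radius proportional to the distance from the crossing,
does not meet the projection image. -/
theorem Crossing.exists_ball_disjoint (κ : Corner) :
    ∃ ε > 0, ∀ r : ℝ, 0 < r → r < ε → ∀ z, ‖z - x.cornerPoint κ r‖ < ε * r → z ∉ D.image := by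
  have h : ∀ a : Passage l, D.point a = x.center → ∃ ε > 0, ∀ t : ℝ, |t - a.2| < ε →
      ∀ r : ℝ, 0 < r → ∀ ζ', ‖ζ' - x.ray κ‖ < ε → D.curve a.1 t ≠ x.center + r * ζ' := by
    intro a ha
    have := exists_sector_disjoint (D.hasDerivAt_curve a) (x.det_ray_ne_zero ha κ)
    rwa [show D.curve a.1 a.2 = x.center from ha] at this
  obtain ⟨ε₁, hε₁, h1⟩ := h x.overPass rfl
  obtain ⟨ε₂, hε₂, h2⟩ := h x.underPass x.same_point.symm
  obtain ⟨ρ, hρ, h3⟩ := Metric.eventually_nhds_iff.1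
    (D.eventually_mem_image_imp x.center (lt_min hε₁ hε₂))
  -- The second bound keeps the disc within distance `ρ` of the crossing, where only its two strands
  -- occur.
  set ε := min (min ε₁ ε₂) (ρ / (‖x.ray κ‖ + min ε₁ ε₂)) with hε
  have hm : 0 < min ε₁ ε₂ := lt_min hε₁ hε₂
  have hden : 0 < ‖x.ray κ‖ + min ε₁ ε₂ := by positivity
  refine ⟨ε, lt_min hm (by positivity), fun r hr hr' z hz hmem => ?_⟩
  have hr0 : (r : ℂ) ≠ 0 := by exact_mod_cast hr.ne'
  obtain ⟨ζ', rfl⟩ : ∃ ζ', z = x.center + r * ζ' := ⟨(z - x.center) / r, by field_simp; ring⟩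
  have hζ' : ‖ζ' - x.ray κ‖ < ε := by
    have : x.center + r * ζ' - x.cornerPoint κ r = r * (ζ' - x.ray κ) := by
      rw [cornerPoint_eq]; ring
    rw [this, norm_mul, Complex.norm_real, Real.norm_of_nonneg hr.le, mul_comm] at hz
    exact lt_of_mul_lt_mul_right hz hr.le
  have hζ1 : ‖ζ' - x.ray κ‖ < min ε₁ ε₂ := hζ'.trans_le (min_le_left _ _)
  obtain ⟨a, ha, t, ht, he⟩ := h3 (y := x.center + r * ζ') (by
    rw [dist_eq_norm, add_sub_cancel_left, norm_mul, Complex.norm_real, Real.norm_of_nonneg hr.le]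
    have h4 : ‖ζ'‖ ≤ ‖x.ray κ‖ + min ε₁ ε₂ := by
      have := norm_add_le (ζ' - x.ray κ) (x.ray κ)
      rw [sub_add_cancel] at this
      linarith
    have h5 : r * (‖x.ray κ‖ + min ε₁ ε₂) < ρ :=
      (lt_div_iff₀ hden).1 (hr'.trans_le (min_le_right _ _))
    nlinarith) hmem
  rcases x.eq_or_eq ha with rfl | rfl
  · exact h1 t (ht.trans_le (min_le_left _ _)) r hr ζ' (hζ1.trans_le (min_le_left _ _)) he
  · exact h2 t (ht.trans_le (min_le_right _ _)) r hr ζ' (hζ1.trans_le (min_le_right _ _)) he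

end Corners

/-! ## Functions on regions -/

theorem _root_.DiagramSurface.incl_injective (S : DiagramSurface) : Injective S.incl := by
  cases S
  · exact injective_id
  · exact OnePoint.coe_injective

theorem _root_.DiagramSurface.continuous_incl (S : DiagramSurface) : Continuous S.incl := by
  cases S
  · exact continuous_id
  · exact OnePoint.continuous_coe

section Regions

variable {l : ℕ} {D : LinkDiagram l} {S : DiagramSurface}

theorem incl_notMem {z : ℂ} (h : z ∉ D.image) : S.incl z ∉ S.incl '' D.image := by
  rwa [S.incl_injective.mem_set_image]

variable (S) in
/-- The region that contains a point of the plane off the diagram. -/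
def regionAt (z : ℂ) (h : z ∉ D.image) : D.Region S :=
  ConnectedComponents.mk (⟨S.incl z, incl_notMem h⟩ : D.Complement S)

theorem regionAt_eq_of_isPreconnected {s : Set ℂ} (hs : IsPreconnected s)
    (hd : ∀ z ∈ s, z ∉ D.image) {z z' : ℂ} (hz : z ∈ s) (hz' : z' ∈ s) :
    regionAt S z (hd z hz) = regionAt S z' (hd z' hz') := by
  let f : s → D.Complement S := fun z => ⟨S.incl z.1, incl_notMem (hd z.1 z.2)⟩
  have hf : Continuous f := by
    have : Continuous fun z : s => S.incl z.1 := S.continuous_incl.comp continuous_subtype_val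
    exact this.subtype_mk _
  have : PreconnectedSpace s := isPreconnected_iff_preconnectedSpace.1 hs
  have h1 : IsPreconnected (Set.range f) := isPreconnected_range hf
  exact ConnectedComponents.coe_eq_coe'.2
    (h1.subset_connectedComponent ⟨⟨z', hz'⟩, rfl⟩ ⟨⟨z, hz⟩, rfl⟩)

/-- A locally constant integer function off the diagram that vanishes near infinity is a function
on the regions. -/
theorem exists_region_function {W : ℂ → ℤ} (hW : ∀ z ∉ D.image, ∀ᶠ z' in 𝓝 z, W z' = W z)
    (h0 : ∀ᶠ z in cocompact ℂ, W z = 0) :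
    ∃ u : D.Region S → ℤ, ∀ z (h : z ∉ D.image), u (regionAt S z h) = W z := by
  cases S with
  | plane =>
    let f : D.Complement .plane → ℤ := fun z => W z.1
    have hf : Continuous f := by
      refine continuous_iff_continuousAt.2 fun z => ?_
      have hz : (z.1 : ℂ) ∉ D.image := fun h => z.2 ⟨_, h, rfl⟩
      rw [ContinuousAt, nhds_discrete ℤ, tendsto_pure]
      exact (continuous_subtype_val.tendsto z).eventually (hW z.1 hz)
    exact ⟨hf.connectedComponentsLift, fun z h => hf.connectedComponentsLift_apply_coe _⟩
  | sphere =>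
    -- The value `0` at `∞` makes the extension locally constant there, by `h0`.
    let g : OnePoint ℂ → ℤ := fun z => z.elim 0 W
    let f : D.Complement .sphere → ℤ := fun z => g z.1
    have hf : Continuous f := by
      refine continuous_iff_continuousAt.2 fun z => ?_
      rw [ContinuousAt, nhds_discrete ℤ, tendsto_pure]
      have key : ∀ z : OnePoint ℂ, z ∉ DiagramSurface.sphere.incl '' D.image →
          ∀ᶠ y in 𝓝 z, g y = g z := by
        intro z hz
        induction z using OnePoint.rec with
        | infty =>
          rw [OnePoint.nhds_infty_eq, eventually_sup, eventually_map]
          refine ⟨?_, by simp⟩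
          rw [coclosedCompact_eq_cocompact]
          exact h0
        | coe z =>
          have hz : (z : ℂ) ∉ D.image := fun h => hz ⟨_, h, rfl⟩
          rw [OnePoint.nhds_coe_eq, eventually_map]
          exact hW z hz
      exact (continuous_subtype_val.tendsto z).eventually (key z.1 z.2)
    exact ⟨hf.connectedComponentsLift, fun z h => hf.connectedComponentsLift_apply_coe _⟩

open Classical in
/-- The value of a function on the regions at a point of the plane (zero on the diagram). -/
def evalAt (u : D.Region S → ℤ) (z : ℂ) : ℤ :=
  if h : z ∉ D.image then u (regionAt S z h) else 0

theorem evalAt_of_notMem (u : D.Region S → ℤ) {z : ℂ} (h : z ∉ D.image) :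
    evalAt u z = u (regionAt S z h) := dif_pos h

theorem evalAt_eq_of_isPreconnected (u : D.Region S → ℤ) {s : Set ℂ} (hs : IsPreconnected s)
    (hd : ∀ z ∈ s, z ∉ D.image) {z z' : ℂ} (hz : z ∈ s) (hz' : z' ∈ s) :
    evalAt u z = evalAt u z' := by
  rw [evalAt_of_notMem u (hd z hz), evalAt_of_notMem u (hd z' hz'),
    regionAt_eq_of_isPreconnected hs hd hz hz']

theorem touches_iff {R : D.Region S} {x : D.Crossing} {κ : Corner} :
    R.Touches x κ ↔ ∀ᶠ t : ℝ in 𝓝[>] 0, ∃ h : x.cornerPoint κ t ∉ D.image,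
      regionAt S (x.cornerPoint κ t) h = R := by
  refine eventually_congr (Eventually.of_forall fun t => ⟨?_, ?_⟩)
  · rintro ⟨h, e⟩
    exact ⟨fun hm => h ⟨_, hm, rfl⟩, e⟩
  · rintro ⟨h, e⟩
    exact ⟨incl_notMem h, e⟩

variable (S) in
-- A short open segment of the corner ray is connected and misses the diagram, so it lies in a
-- single region.
theorem exists_touches (x : D.Crossing) (κ : Corner) : ∃ R : D.Region S, R.Touches x κ := by
  obtain ⟨ε, hε, h⟩ := x.exists_ball_disjoint κ
  have hd : ∀ r ∈ Set.Ioo 0 ε, x.cornerPoint κ r ∉ D.image := fun r hr =>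
    h r hr.1 hr.2 _ (by rw [sub_self, norm_zero]; exact mul_pos hε hr.1)
  have hs : IsPreconnected (x.cornerPoint κ '' Set.Ioo 0 ε) := by
    refine isPreconnected_Ioo.image _ (Continuous.continuousOn ?_)
    change Continuous fun r : ℝ => x.center + (r : ℂ) * x.ray κ
    fun_prop
  have hd' : ∀ z ∈ x.cornerPoint κ '' Set.Ioo 0 ε, z ∉ D.image := by
    rintro _ ⟨r, hr, rfl⟩; exact hd r hr
  have hmid : ε / 2 ∈ Set.Ioo 0 ε := by constructor <;> linarith
  refine ⟨regionAt S (x.cornerPoint κ (ε / 2)) (hd _ hmid), touches_iff.2 ?_⟩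
  filter_upwards [Ioo_mem_nhdsGT hε] with r hr
  exact ⟨hd r hr, regionAt_eq_of_isPreconnected hs hd' ⟨r, hr, rfl⟩ ⟨_, hmid, rfl⟩⟩

variable (S) in
/-- The region that touches `x` at the corner `κ`. -/
def cornerRegion (x : D.Crossing) (κ : Corner) : D.Region S := (exists_touches S x κ).choose

theorem touches_cornerRegion (x : D.Crossing) (κ : Corner) : (cornerRegion S x κ).Touches x κ :=
  (exists_touches S x κ).choose_spec

theorem touches_iff_eq {R : D.Region S} {x : D.Crossing} {κ : Corner} :
    R.Touches x κ ↔ cornerRegion S x κ = R :=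
  ⟨fun h => (touches_cornerRegion x κ).unique h, by rintro rfl; exact touches_cornerRegion x κ⟩

theorem eventually_evalAt_cornerPoint (u : D.Region S → ℤ) (x : D.Crossing) (κ : Corner) :
    ∀ᶠ t : ℝ in 𝓝[>] 0, x.cornerPoint κ t ∉ D.image ∧
      evalAt u (x.cornerPoint κ t) = u (cornerRegion S x κ) := by
  filter_upwards [touches_iff.1 (touches_cornerRegion (S := S) x κ)] with t ⟨h, e⟩
  exact ⟨h, by rw [evalAt_of_notMem u h, e]⟩

/-! ## The rows of the region choice matrices -/

theorem sum_corner {M : Type*} [AddCommMonoid M] (f : Corner → M) :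
    ∑ κ, f κ = f (1, 1) + f (1, -1) + (f (-1, 1) + f (-1, -1)) := by
  rw [Fintype.sum_prod_type]
  simp only [show (Finset.univ : Finset ℤˣ) = {1, -1} from rfl]
  rw [Finset.sum_pair (by decide), Finset.sum_pair (by decide), Finset.sum_pair (by decide)]

theorem Crossing.sign_eq (x : D.Crossing) : x.sign = 1 ∨ x.sign = -1 := by
  unfold sign; split_ifs <;> simp

/-- The sign with which the corner `κ` enters the alternating counting rules. -/
def Crossing.cornerSign (x : D.Crossing) (κ : Corner) : ℤ := -(x.sign * ((κ.1 * κ.2 : ℤˣ) : ℤ))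

theorem Crossing.det_rays (x : D.Crossing) (κ : Corner) :
    planeDet (x.underRay κ) (x.overRay κ) = -(((κ.1 * κ.2 : ℤˣ) : ℤ) *
      planeDet (D.velocity x.overPass) (D.velocity x.underPass)) := by
  rw [overRay, underRay, planeDet_intCast_mul_right, planeDet_swap, planeDet_intCast_mul_right]
  push_cast; ring

theorem Crossing.isCounterclockwise_iff (x : D.Crossing) (κ : Corner) :
    x.IsCounterclockwise κ ↔ x.cornerSign κ = 1 := by
  have h := x.det_ne_zero
  rw [IsCounterclockwise, det_rays, cornerSign, sign]
  rcases Int.units_eq_one_or (κ.1 * κ.2) with h1 | h1 <;> rw [h1] <;> split_ifs with h2 <;>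
    rcases h.lt_or_gt with h3 | h3 <;> simp <;> linarith

theorem Crossing.isClockwise_iff (x : D.Crossing) (κ : Corner) :
    x.IsClockwise κ ↔ x.cornerSign κ = -1 := by
  have h := x.det_ne_zero
  rw [IsClockwise, det_rays, cornerSign, sign]
  rcases Int.units_eq_one_or (κ.1 * κ.2) with h1 | h1 <;> rw [h1] <;> split_ifs with h2 <;>
    rcases h.lt_or_gt with h3 | h3 <;> simp <;> linarith

open Classical in
-- By `hx` a region never touches two adjacent corners, so it touches either one corner or two
-- opposite ones, which carry the same sign. The double counting entry is then the sum of the signs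
-- of the touched corners.
theorem entryA2_eq {x : D.Crossing} (R : D.Region S)
    (hx : ∀ κ κ' : Corner, cornerRegion S x κ = cornerRegion S x κ' → κ.1 * κ.2 = κ'.1 * κ'.2) :
    entryA2 x R = ∑ κ, if cornerRegion S x κ = R then x.cornerSign κ else 0 := by
  have hs := x.sign_eq
  unfold entryA2 entryA1 Region.TouchesTwice
  simp only [touches_iff_eq, Crossing.isCounterclockwise_iff, Crossing.isClockwise_iff,
    Crossing.cornerSign, sum_corner, Prod.exists]
  have hex : ∀ P : ℤˣ → ℤˣ → Prop, (∃ a b, P a b) ↔ (P 1 1 ∨ P 1 (-1)) ∨ (P (-1) 1 ∨ P (-1) (-1)) := by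
    intro P
    constructor
    · rintro ⟨a, b, h⟩
      rcases Int.units_eq_one_or a with rfl | rfl <;> rcases Int.units_eq_one_or b with rfl | rfl <;>
        simp [h]
    · rintro ((h | h) | (h | h)) <;> exact ⟨_, _, h⟩
  simp only [hex, Prod.neg_mk, neg_neg, mul_one, one_mul, mul_neg, neg_mul, Units.val_one, Units.val_neg]
  have d1 := hx (1, 1) (1, -1)
  have d2 := hx (1, 1) (-1, 1)
  have d3 := hx (-1, -1) (1, -1)
  have d4 := hx (-1, -1) (-1, 1)
  simp only [mul_one, one_mul, mul_neg, neg_neg, neg_mul] at d1 d2 d3 d4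
  have hne : (1 : ℤˣ) ≠ -1 := by decide
  simp only [hne, imp_false] at d1 d2 d3 d4
  by_cases e1 : cornerRegion S x (1, 1) = R <;> by_cases e2 : cornerRegion S x (1, -1) = R <;>
  by_cases e3 : cornerRegion S x (-1, 1) = R <;> by_cases e4 : cornerRegion S x (-1, -1) = R <;>
  simp_all <;> rcases hs with h | h <;> simp [h]

theorem homA2_apply {n : ℕ} (e : Fin n ≃ D.Crossing) (u : D.Region S → ℤ) (i : Fin n)
    (hx : ∀ κ κ' : Corner, cornerRegion S (e i) κ = cornerRegion S (e i) κ' →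
      κ.1 * κ.2 = κ'.1 * κ'.2) :
    homA2 S e u i = ∑ κ, (e i).cornerSign κ * u (cornerRegion S (e i) κ) := by
  classical
  change ∑ᶠ R, entryA2 (e i) R * u R = _
  simp only [entryA2_eq _ hx, Finset.sum_mul, ite_mul, zero_mul]
  rw [finsum_sum_comm]
  · refine Finset.sum_congr rfl fun κ _ => ?_
    rw [finsum_eq_single _ (cornerRegion S (e i) κ)]
    · rw [if_pos rfl]
    · intro R hR
      rw [if_neg hR.symm]
  · intro κ _
    refine (Set.finite_singleton (cornerRegion S (e i) κ)).subset fun R hR => ?_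
    by_contra h
    exact hR (if_neg fun h' => h h'.symm)

/-- The two counting rules agree at a crossing for a function that vanishes on the regions
that touch the crossing twice. -/
theorem homA1_apply_eq {n : ℕ} (e : Fin n ≃ D.Crossing) (u : D.Region S → ℤ) (i : Fin n)
    (h : ∀ κ, cornerRegion S (e i) κ = cornerRegion S (e i) (-κ) →
      u (cornerRegion S (e i) κ) = 0) :
    homA1 S e u i = homA2 S e u i := by
  change ∑ᶠ R, entryA1 (e i) R * u R = ∑ᶠ R, entryA2 (e i) R * u R
  refine finsum_congr fun R => ?_
  unfold entryA2
  split_ifs with hR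
  · obtain ⟨κ, h1, h2⟩ := hR
    rw [touches_iff_eq] at h1 h2
    have := h κ (h1.trans h2.symm)
    rw [h1] at this
    rw [this, mul_zero, mul_zero]
  · rfl

end Regions

end LinkDiagram

namespace LinkDiagram

/-! ## Closed chains of arcs and their index functions -/

section Chains

variable {l : ℕ} (D : LinkDiagram l) {ι : Type*} [Fintype ι] (c : ι → Fin l) (a b : ι → ℝ)

/-- The sum of the integrals of `dz / (z - w)` along the arcs of a chain. -/
def chainIntegral (w : ℂ) : ℂ := ∑ i, arcIntegral (D.curve (c i)) (a i) (b i) w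

/-- The winding number of a closed chain of arcs. -/
def chainIndex (w : ℂ) : ℤ := round (chainIntegral D c a b w / (2 * Real.pi * Complex.I)).re

/-- The arcs fit together to closed curves: the same points occur as initial points and
as end points. -/
def IsClosedChain : Prop :=
  ∀ w, ∏ i, (D.curve (c i) (b i) - w) = ∏ i, (D.curve (c i) (a i) - w)

/-- The point `w` is not on the arcs of the chain. -/
def ChainAvoids (w : ℂ) : Prop := ∀ i, ∀ t ∈ Set.uIcc (a i) (b i), D.curve (c i) t ≠ w

variable {D c a b}

theorem chainAvoids_of_notMem {w : ℂ} (h : w ∉ D.image) : ChainAvoids D c a b w :=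
  fun i t _ e => h (e ▸ D.curve_mem_image (c i) t)

theorem ChainAvoids.eventually {w : ℂ} (h : ChainAvoids D c a b w) :
    ∀ᶠ w' in 𝓝 w, ChainAvoids D c a b w' := by
  refine eventually_all.2 fun i => ?_
  have hK : IsCompact (D.curve (c i) '' Set.uIcc (a i) (b i)) :=
    isCompact_uIcc.image (D.continuous_curve (c i))
  have : (D.curve (c i) '' Set.uIcc (a i) (b i))ᶜ ∈ 𝓝 w := hK.isClosed.isOpen_compl.mem_nhds (by
    rintro ⟨t, ht, hp⟩; exact h i t ht hp)
  filter_upwards [this] with z hz t ht e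
  exact hz ⟨t, ht, e⟩

/-- The exponential of the integral is the product of the ratios of `γ - w` at the end and at the
start of the arcs. For a closed chain this is `1`, so rounding in `chainIndex` loses nothing. -/
theorem IsClosedChain.chainIntegral_eq (hc : IsClosedChain D c a b) {w : ℂ}
    (h : ChainAvoids D c a b w) :
    chainIntegral D c a b w = 2 * Real.pi * Complex.I * chainIndex D c a b w := by
  have hne : ∏ i, (D.curve (c i) (a i) - w) ≠ 0 :=
    Finset.prod_ne_zero_iff.2 fun i _ => sub_ne_zero.2 (h i _ Set.left_mem_uIcc)
  have h1 : Complex.exp (chainIntegral D c a b w) = 1 := by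
    have : Complex.exp (chainIntegral D c a b w) * ∏ i, (D.curve (c i) (a i) - w) =
        ∏ i, (D.curve (c i) (a i) - w) := by
      rw [chainIntegral, Complex.exp_sum, ← Finset.prod_mul_distrib, ← hc w]
      exact Finset.prod_congr rfl fun i _ => exp_arcIntegral (D.contDiff_one (c i)) (h i)
    exact mul_right_cancel₀ hne (this.trans (one_mul _).symm)
  obtain ⟨n, hn⟩ := Complex.exp_eq_one_iff.1 h1
  have h2 : chainIndex D c a b w = n := by
    rw [chainIndex, hn, mul_div_cancel_right₀ _ Complex.two_pi_I_ne_zero, Complex.intCast_re,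
      round_intCast]
  rw [h2, hn, mul_comm]

theorem continuousAt_chainIntegral {w : ℂ} (h : ChainAvoids D c a b w) :
    ContinuousAt (chainIntegral D c a b) w :=
  tendsto_finsetSum _ fun i _ => continuousAt_arcIntegral (D.contDiff_one (c i)) (h i)

theorem IsClosedChain.eq_of_dist_lt (hc : IsClosedChain D c a b) {w : ℂ}
    (h : ChainAvoids D c a b w) {n : ℤ}
    (h1 : dist (chainIntegral D c a b w) (2 * Real.pi * Complex.I * n) < 2 * Real.pi) :
    chainIndex D c a b w = n := by
  rw [hc.chainIntegral_eq h, dist_eq_norm, ← mul_sub, norm_mul, ← Int.cast_sub,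
    Complex.norm_intCast] at h1
  have h2 : ‖(2 * Real.pi * Complex.I : ℂ)‖ = 2 * Real.pi := by
    simp [abs_of_pos Real.pi_pos]
  rw [h2] at h1
  have h3 : |((chainIndex D c a b w - n : ℤ) : ℝ)| < 1 := by
    have := Real.two_pi_pos
    nlinarith
  have h4 : |chainIndex D c a b w - n| < 1 := by exact_mod_cast h3
  rw [Int.abs_lt_one_iff] at h4
  omega

theorem IsClosedChain.eventually_eq (hc : IsClosedChain D c a b) {w : ℂ}
    (h : ChainAvoids D c a b w) :
    ∀ᶠ w' in 𝓝 w, chainIndex D c a b w' = chainIndex D c a b w := by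
  have h1 := (continuousAt_chainIntegral h).eventually (Metric.ball_mem_nhds _ Real.two_pi_pos)
  filter_upwards [h.eventually, h1] with w' h2 h3
  rw [hc.chainIntegral_eq h] at h3
  exact hc.eq_of_dist_lt h2 h3

theorem IsClosedChain.eventually_cocompact (hc : IsClosedChain D c a b) :
    ∀ᶠ w in cocompact ℂ, chainIndex D c a b w = 0 := by
  have h1 : Tendsto (chainIntegral D c a b) (cocompact ℂ) (𝓝 0) := by
    have := tendsto_finsetSum Finset.univ fun i _ =>
      tendsto_arcIntegral_cocompact (D.contDiff_one (c i)) (a i) (b i)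
    simp only [Finset.sum_const_zero] at this
    exact this
  filter_upwards [D.isCompact_image.compl_mem_cocompact,
    h1.eventually (Metric.ball_mem_nhds _ Real.two_pi_pos)] with w h2 h3
  exact hc.eq_of_dist_lt (chainAvoids_of_notMem h2) (by simpa using h3)

theorem IsClosedChain.eq_of_isPreconnected (hc : IsClosedChain D c a b) {s : Set ℂ}
    (hs : IsPreconnected s) (hd : ∀ z ∈ s, ChainAvoids D c a b z) {z z' : ℂ} (hz : z ∈ s)
    (hz' : z' ∈ s) : chainIndex D c a b z = chainIndex D c a b z' := by
  refine hs.constant (f := chainIndex D c a b) (fun w hw => ?_) hz hz'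
  rw [ContinuousWithinAt, nhds_discrete ℤ, tendsto_pure]
  exact (hc.eventually_eq (hd w hw)).filter_mono nhdsWithin_le_nhds

/-- The index function of a closed chain as a function on the regions. -/
theorem IsClosedChain.exists_region_function (hc : IsClosedChain D c a b) (S : DiagramSurface) :
    ∃ u : D.Region S → ℤ, ∀ z, z ∉ D.image → evalAt u z = chainIndex D c a b z := by
  obtain ⟨u, hu⟩ := LinkDiagram.exists_region_function (S := S) (W := chainIndex D c a b)
    (fun z hz => hc.eventually_eq (chainAvoids_of_notMem hz)) hc.eventually_cocompact
  exact ⟨u, fun z hz => by rw [evalAt_of_notMem u hz, hu z hz]⟩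

/-- The weighted sum of the integrals is eventually constant, equal to the left side, so it
coincides with its limit. This converts the limits along single arcs into statements about winding
numbers near a point. -/
theorem IsClosedChain.sum_eq (hc : IsClosedChain D c a b) {K : Type*} [Fintype K] {n : K → ℂ}
    {w : K → ℝ → ℂ} {L : ι → ℂ}
    (hL : ∀ i, ArcLim (D.curve (c i)) n w (a i) (b i) (L i)) {N : K → ℤ}
    (hN : ∀ k, ∀ᶠ r in 𝓝[>] 0, chainIndex D c a b (w k r) = N k) :
    2 * Real.pi * Complex.I * ∑ k, n k * N k = ∑ i, L i := by
  have h1 : Tendsto (fun r => ∑ i, ∑ k, n k * arcIntegral (D.curve (c i)) (a i) (b i) (w k r))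
      (𝓝[>] 0) (𝓝 (∑ i, L i)) := tendsto_finsetSum _ fun i _ => (hL i).2
  refine tendsto_nhds_unique (tendsto_const_nhds.congr' ?_) h1
  filter_upwards [eventually_all.2 hN,
    eventually_all.2 fun k => eventually_all.2 fun i => (hL i).1 k] with r hr hav
  rw [Finset.sum_comm, Finset.mul_sum]
  refine Finset.sum_congr rfl fun k _ => ?_
  rw [← Finset.mul_sum]
  change _ = n k * chainIntegral D c a b (w k r)
  rw [hc.chainIntegral_eq (hav k), hr k]
  ring

end Chains

/-! ## Index functions at a crossing -/

theorem sideLog_neg_one (γ : ℝ → ℂ) (p : ℂ) (t : ℝ) (ζ : ℂ) :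
    sideLog γ p t (-1) ζ = sideLog γ p t 1 (-ζ) := by
  simp [sideLog, neg_div_neg_eq]

theorem sideLog_of_ne {γ : ℝ → ℂ} {p : ℂ} {t : ℝ} (h : γ t ≠ p) (s : ℝ) (ζ : ℂ) :
    sideLog γ p t s ζ = 0 := if_neg h

section AtCrossing

variable {l : ℕ} {D : LinkDiagram l} (x : D.Crossing)

theorem Crossing.ext_of_center {x y : D.Crossing} (h : x.center = y.center) : x = y := by
  have h1 : x.overPass = y.overPass := by
    rcases y.eq_or_eq (a := x.overPass) h with h1 | h1
    · exact h1
    · exact absurd x.mem_over (h1 ▸ y.not_mem_over)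
  have h2 : x.underPass = y.underPass := by
    rcases y.eq_or_eq (a := x.underPass) (x.same_point.symm.trans h) with h2 | h2
    · exact absurd y.mem_over (h2 ▸ x.not_mem_over)
    · exact h2
  cases x; cases y; cases h1; cases h2; rfl

theorem Crossing.tendsto_cornerPoint (κ : Corner) :
    Tendsto (fun r : ℝ => (x.cornerPoint κ r - x.center) / r) (𝓝[>] 0) (𝓝 (x.ray κ)) := by
  refine tendsto_const_nhds.congr' ?_
  filter_upwards [self_mem_nhdsWithin] with r hr
  have : (r : ℂ) ≠ 0 := by exact_mod_cast (Set.mem_Ioi.1 hr).ne'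
  rw [cornerPoint_eq]
  field_simp
  ring

theorem Crossing.passage_eq {c : Fin l} {t : ℝ} (h : D.curve c t = x.center) :
    passage c t = x.overPass ∨ passage c t = x.underPass :=
  x.eq_or_eq (by rwa [point_passage])

theorem Crossing.curve_eq_of_passage_eq_over {c : Fin l} {t : ℝ} (h : passage c t = x.overPass) :
    D.curve c t = x.center := by rw [← point_passage, h]; rfl

theorem Crossing.curve_eq_of_passage_eq_under {c : Fin l} {t : ℝ} (h : passage c t = x.underPass) :
    D.curve c t = x.center := by rw [← point_passage, h]; exact x.same_point.symm

theorem Crossing.slit {c : Fin l} {t : ℝ} (h : D.curve c t = x.center) (κ : Corner) :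
    -deriv (D.curve c) t / x.ray κ ∈ Complex.slitPlane ∧
      deriv (D.curve c) t / x.ray κ ∈ Complex.slitPlane := by
  have := x.det_ray_ne_zero (a := passage c t) (by rwa [point_passage]) κ
  rw [velocity_passage] at this
  exact ⟨mem_slitPlane_of_planeDet_ne_zero (by rwa [planeDet_neg_left, neg_ne_zero]),
    mem_slitPlane_of_planeDet_ne_zero this⟩

/-- The alternating sum of the contributions of a half strand at the four corners. -/
def Crossing.altLog (c : Fin l) (t : ℝ) : ℂ :=
  ∑ κ : Corner, (((κ.1 * κ.2 : ℤˣ) : ℤ) : ℂ) * sideLog (D.curve c) x.center t 1 (x.ray κ)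

/-- Passing to the opposite corner reverses the ray and keeps the weight. Hence the incoming and the
outgoing half of a straight passage contribute equally and cancel. -/
theorem Crossing.altLog_eq_neg (c : Fin l) (t : ℝ) :
    x.altLog c t = ∑ κ : Corner, (((κ.1 * κ.2 : ℤˣ) : ℤ) : ℂ) *
      sideLog (D.curve c) x.center t (-1) (x.ray κ) := by
  refine Fintype.sum_equiv (Equiv.neg Corner) _ _ fun κ => ?_
  rw [Equiv.neg_apply, ray_neg, sideLog_neg_one, neg_neg, Prod.fst_neg, Prod.snd_neg, neg_mul_neg]

theorem Crossing.altLog_of_ne {c : Fin l} {t : ℝ} (h : D.curve c t ≠ x.center) :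
    x.altLog c t = 0 := by
  simp [altLog, sideLog_of_ne h]

/-- The difference is the alternating sum of `turnLog` over the corners. It takes one value at three
corners, where the weights reduce it to that of the fourth; only the full turn at the corner `(1,
-1)`, of weight `-1`, survives. -/
theorem Crossing.altLog_sub {c c' : Fin l} {t t' : ℝ} (h : passage c t = x.overPass)
    (h' : passage c' t' = x.underPass) :
    x.altLog c t - x.altLog c' t' = 2 * Real.pi * Complex.I * x.sign := by
  rw [altLog_eq_neg x c' t', altLog, ← Finset.sum_sub_distrib]
  have e1 := x.curve_eq_of_passage_eq_over h
  have e2 := x.curve_eq_of_passage_eq_under h'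
  have hdet := x.det_ne_zero
  simp only [sideLog, e1, e2, if_true, ← mul_sub, Complex.ofReal_neg, Complex.ofReal_one, neg_mul,
    one_mul, neg_neg, sum_corner, ← velocity_passage D c t, ← velocity_passage D c' t', h, h']
  change ((1 : ℤˣ) * (1 : ℤˣ) : ℤˣ).1 * turnLog (D.velocity x.overPass) (D.velocity x.underPass) _ +
    ((1 : ℤˣ) * (-1 : ℤˣ) : ℤˣ).1 * turnLog (D.velocity x.overPass) (D.velocity x.underPass) _ +
    (((-1 : ℤˣ) * (1 : ℤˣ) : ℤˣ).1 * turnLog (D.velocity x.overPass) (D.velocity x.underPass) _ +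
    ((-1 : ℤˣ) * (-1 : ℤˣ) : ℤˣ).1 * turnLog (D.velocity x.overPass) (D.velocity x.underPass) _) = _
  rw [turnLog_of_corner hdet (ζ := x.ray (1, 1)) (Or.inl (by simp [ray_eq])),
    turnLog_of_corner hdet (ζ := x.ray (-1, -1)) (Or.inr (Or.inl (by simp [ray_eq]; ring))),
    turnLog_of_corner hdet (ζ := x.ray (-1, 1)) (Or.inr (Or.inr (Or.inl (by simp [ray_eq]; ring)))),
    show x.ray (1, -1) = D.velocity x.overPass - D.velocity x.underPass by simp [ray_eq]; ring,
    turnLog_sub hdet, sign]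
  split_ifs <;> simp <;> ring

section ChainAtCrossing

variable {S : DiagramSurface} {ι : Type*} [Fintype ι] {c : ι → Fin l} {a b : ι → ℝ}
  (hc : IsClosedChain D c a b) {u : D.Region S → ℤ}
  (hu : ∀ z, z ∉ D.image → evalAt u z = chainIndex D c a b z)

include hu in
theorem Crossing.eventually_chainIndex (κ : Corner) :
    ∀ᶠ r in 𝓝[>] 0, chainIndex D c a b (x.cornerPoint κ r) = u (cornerRegion S x κ) := by
  filter_upwards [eventually_evalAt_cornerPoint u x κ] with r ⟨h, e⟩
  rw [← e, hu _ h]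

include hc hu

/-- The alternating sum over the corners of the index function of a closed chain. -/
theorem Crossing.alternating_sum_eq :
    2 * Real.pi * Complex.I *
      ((∑ κ : Corner, ((κ.1 * κ.2 : ℤˣ) : ℤ) * u (cornerRegion S x κ) : ℤ) : ℂ) =
      ∑ i, (x.altLog (c i) (a i) - x.altLog (c i) (b i)) := by
  rw [← hc.sum_eq (K := Corner) (n := fun κ => (((κ.1 * κ.2 : ℤˣ) : ℤ) : ℂ))
    (w := x.cornerPoint) (L := fun i => x.altLog (c i) (a i) - x.altLog (c i) (b i))
    (N := fun κ => u (cornerRegion S x κ)) (fun i => ?_) (x.eventually_chainIndex hu)]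
  · push_cast; rfl
  · refine ArcLim.of_straight (D.contDiff_one (c i)) ?_ x.tendsto_cornerPoint
      (fun t ht κ => x.slit ht κ) (fun t => x.altLog_eq_neg (c i) t) _ _
    simp [sum_corner]

omit hu in
/-- The difference of the values of an index function in two directions at a point. -/
theorem IsClosedChain.sub_eq {p : ℂ} (hab : ∀ i, a i < b i)
    (hint : ∀ i, ∀ t ∈ Set.Ioo (a i) (b i), D.curve (c i) t ≠ p) {w : Bool → ℝ → ℂ} {ζ : Bool → ℂ}
    (hw : ∀ k, Tendsto (fun r : ℝ => (w k r - p) / r) (𝓝[>] 0) (𝓝 (ζ k)))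
    (ha : ∀ i, D.curve (c i) (a i) = p → ∀ k, -deriv (D.curve (c i)) (a i) / ζ k ∈ Complex.slitPlane)
    (hb : ∀ i, D.curve (c i) (b i) = p → ∀ k, deriv (D.curve (c i)) (b i) / ζ k ∈ Complex.slitPlane)
    {N : Bool → ℤ} (hN : ∀ k, ∀ᶠ r in 𝓝[>] 0, chainIndex D c a b (w k r) = N k) :
    2 * Real.pi * Complex.I * (N true - N false : ℂ) =
      ∑ i, ((sideLog (D.curve (c i)) p (a i) 1 (ζ true) - sideLog (D.curve (c i)) p (b i) (-1) (ζ true)) -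
        (sideLog (D.curve (c i)) p (a i) 1 (ζ false) -
          sideLog (D.curve (c i)) p (b i) (-1) (ζ false))) := by
  have := hc.sum_eq (K := Bool) (n := fun k => if k then 1 else -1) (w := w) (N := N)
    (fun i => ArcLim.of_interior (D.contDiff_one (c i)) (by simp) hw (hab i) (hint i) (ha i) (hb i)) hN
  simp only [Fintype.sum_bool, if_true, Bool.false_eq_true, if_false, one_mul, neg_one_mul] at this
  rw [sub_eq_add_neg, this]
  exact Finset.sum_congr rfl fun i _ => by ring

theorem Crossing.sub_eq (hab : ∀ i, a i < b i)
    (hint : ∀ i, ∀ t ∈ Set.Ioo (a i) (b i), D.curve (c i) t ≠ x.center) (κ κ' : Corner) :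
    2 * Real.pi * Complex.I *
      ((u (cornerRegion S x κ) : ℂ) - u (cornerRegion S x κ')) =
      ∑ i, ((sideLog (D.curve (c i)) x.center (a i) 1 (x.ray κ) -
          sideLog (D.curve (c i)) x.center (b i) (-1) (x.ray κ)) -
        (sideLog (D.curve (c i)) x.center (a i) 1 (x.ray κ') -
          sideLog (D.curve (c i)) x.center (b i) (-1) (x.ray κ'))) :=
  hc.sub_eq hab hint (w := fun k => x.cornerPoint (cond k κ κ')) (ζ := fun k => x.ray (cond k κ κ'))
    (N := fun k => u (cornerRegion S x (cond k κ κ')))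
    (fun _ => x.tendsto_cornerPoint _) (fun _ h _ => (x.slit h _).1) (fun _ h _ => (x.slit h _).2)
    (fun _ => x.eventually_chainIndex hu _)

/-- If a closed chain runs straight through a crossing along one of its strands and does not meet
the crossing otherwise, then its index function distinguishes the two sides of this strand. -/
theorem Crossing.ne_of_straight (hab : ∀ i, a i < b i)
    (hint : ∀ i, ∀ t ∈ Set.Ioo (a i) (b i), D.curve (c i) t ≠ x.center) {i₀ i₁ : ι}
    {v : ℂ} (ha₀ : D.curve (c i₀) (a i₀) = x.center) (hb₁ : D.curve (c i₁) (b i₁) = x.center)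
    (hv₀ : deriv (D.curve (c i₀)) (a i₀) = v) (hv₁ : deriv (D.curve (c i₁)) (b i₁) = v)
    (ha : ∀ i, i ≠ i₀ → D.curve (c i) (a i) ≠ x.center)
    (hb : ∀ i, i ≠ i₁ → D.curve (c i) (b i) ≠ x.center)
    {κ κ' : Corner} (h : 0 < planeDet v (x.ray κ)) (h' : planeDet v (x.ray κ') < 0) :
    cornerRegion S x κ ≠ cornerRegion S x κ' := by
  intro he
  have h1 := x.sub_eq hc hu hab hint κ κ'
  rw [he, sub_self, mul_zero] at h1
  have e : ∀ ζ, ∑ i, (sideLog (D.curve (c i)) x.center (a i) 1 ζ -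
      sideLog (D.curve (c i)) x.center (b i) (-1) ζ) =
      Complex.log (-v / ζ) - Complex.log (v / ζ) := by
    intro ζ
    rw [Finset.sum_sub_distrib, Finset.sum_eq_single i₀, Finset.sum_eq_single i₁]
    · simp [sideLog, ha₀, hb₁, hv₀, hv₁]
    · intro i _ hi; exact sideLog_of_ne (hb i hi) _ _
    · simp
    · intro i _ hi; exact sideLog_of_ne (ha i hi) _ _
    · simp
  -- The two sides of the strand contribute `πi` and `-πi`, so equal regions would give `2πi = 0`.
  rw [Finset.sum_sub_distrib, e, e, log_neg_div_sub_log_div h.ne', log_neg_div_sub_log_div h'.ne,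
    if_pos h, if_neg h'.not_gt, sub_neg_eq_add, ← two_mul, ← mul_assoc] at h1
  exact Complex.two_pi_I_ne_zero h1.symm

end ChainAtCrossing

end AtCrossing

end LinkDiagram

/-! ## Collars of smooth curves -/

/-- The collar of a plane curve: the point at height `z.im` on the normal at time `z.re`. -/
def collar (γ : ℝ → ℂ) (z : ℂ) : ℂ := γ z.re + z.im * (Complex.I * deriv γ z.re)

theorem collar_ofReal (γ : ℝ → ℂ) (t : ℝ) : collar γ t = γ t := by simp [collar]

section Collar

variable {γ : ℝ → ℂ} (hγ : ContDiff ℝ ∞ γ)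
include hγ

theorem continuous_collar : Continuous (collar γ) := by
  have h1 := hγ.continuous
  have h2 := hγ.continuous_deriv (by simp)
  unfold collar
  fun_prop

/-- Since the normal is taken as `I * deriv γ`, the real differential on the real axis is
multiplication by `deriv γ t`; the term with the second derivative carries the factor `z.im = 0`.
Angles in collar coordinates are therefore angles in the plane to first order. -/
theorem hasStrictDerivAt_collar (t : ℝ) : HasStrictDerivAt (collar γ) (deriv γ t) (t : ℂ) := by
  have h1 : HasStrictDerivAt γ (deriv γ t) (t : ℂ).re :=
    (hγ.contDiffAt (x := t)).hasStrictDerivAt (by simp)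
  have hd : ContDiff ℝ 1 (deriv γ) :=
    (contDiff_infty_iff_deriv.1 hγ).2.of_le (by exact_mod_cast le_top)
  have h2 : HasStrictDerivAt (deriv γ) (deriv (deriv γ) t) (t : ℂ).re :=
    (hd.contDiffAt (x := t)).hasStrictDerivAt (by simp)
  have hre : HasStrictFDerivAt Complex.re Complex.reCLM (t : ℂ) := Complex.reCLM.hasStrictFDerivAt
  have him : HasStrictFDerivAt (fun z : ℂ => (z.im : ℂ)) (Complex.ofRealCLM.comp Complex.imCLM)
      (t : ℂ) := (Complex.ofRealCLM.comp Complex.imCLM).hasStrictFDerivAt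
  have h3 := (h1.hasStrictFDerivAt.comp (t : ℂ) hre).add
    (him.mul ((h2.hasStrictFDerivAt.comp (t : ℂ) hre).const_mul Complex.I))
  refine HasStrictFDerivAt.of_isLittleO ?_
  refine h3.isLittleO.congr_left fun z => ?_
  simp [collar]
  linear_combination (deriv γ t) * (Complex.re_add_im z.1 - Complex.re_add_im z.2)

theorem exists_injOn_collar {t : ℝ} (ht : deriv γ t ≠ 0) :
    ∃ ρ > 0, Set.InjOn (collar γ) (Metric.ball (t : ℂ) ρ) := by
  have h := (hasStrictDerivAt_collar hγ t).hasStrictFDerivAt_equiv ht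
  set e := h.toOpenPartialHomeomorph _
  obtain ⟨ρ, hρ, hsub⟩ := Metric.isOpen_iff.1 e.open_source _ h.mem_toOpenPartialHomeomorph_source
  exact ⟨ρ, hρ, e.injOn.mono hsub⟩

end Collar

namespace LinkDiagram

/-! ### Values of region functions on the two sides of a strand -/

section Sides

variable {l : ℕ} {D : LinkDiagram l} {S : DiagramSurface}

/-- Near a time at which the curve does not pass through a crossing, only the curve itself lies in
its collar. -/
theorem exists_collar_simple (c : Fin l) (t₀ : ℝ)
    (h : ∀ a, D.point a = D.curve c t₀ → a = passage c t₀) :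
    ∃ ρ > 0, ∀ z : ℂ, ‖z - t₀‖ < ρ → collar (D.curve c) z ∈ D.image → z.im = 0 := by
  obtain ⟨ρ, hρ, hinj⟩ := exists_injOn_collar (D.smooth c) (D.immersed c t₀)
  have h1 : Tendsto (collar (D.curve c)) (𝓝 (t₀ : ℂ)) (𝓝 (D.curve c t₀)) :=
    (continuous_collar (D.smooth c)).tendsto' _ _ (collar_ofReal _ _)
  obtain ⟨ρ', hρ', h2⟩ := Metric.eventually_nhds_iff.1
    (h1.eventually (D.eventually_mem_image_imp (D.curve c t₀) hρ))
  refine ⟨min ρ ρ', lt_min hρ hρ', fun z hz hm => ?_⟩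
  obtain ⟨a, ha, t, ht, e⟩ := h2 (y := z) (by
    rw [dist_eq_norm]; exact hz.trans_le (min_le_right _ _)) hm
  rw [h a ha] at ht e
  change |t - Int.fract t₀| < ρ at ht
  have h3 : z = ((t + ⌊t₀⌋ : ℝ) : ℂ) := by
    refine hinj ?_ ?_ ?_
    · rw [Metric.mem_ball, dist_eq_norm]; exact hz.trans_le (min_le_left _ _)
    · rw [Metric.mem_ball, Complex.dist_eq, ← Complex.ofReal_sub, Complex.norm_real,
        Real.norm_eq_abs]
      have : t + ⌊t₀⌋ - t₀ = t - Int.fract t₀ := by rw [Int.fract]; ring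
      rwa [this]
    · rw [collar_ofReal, curve_add_int]; exact e.symm
  rw [h3, Complex.ofReal_im]

/-- Near a crossing, the collar of one strand meets the diagram only in this strand and in a
thin double sector around the other strand. -/
theorem exists_collar_crossing (c : Fin l) (t₀ : ℝ) {b : Passage l} (hb : D.point b = D.curve c t₀)
    (h : ∀ a, D.point a = D.curve c t₀ → a = passage c t₀ ∨ a = b) {β : ℂ}
    (hβ : D.velocity b / deriv (D.curve c) t₀ = β) (hβ0 : β.im ≠ 0) :
    ∃ ρ > 0, ∀ z : ℂ, ‖z - t₀‖ < ρ → collar (D.curve c) z ∈ D.image → z.im = 0 ∨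
      |(z - t₀).re - z.im / β.im * β.re| ≤ |z.im / β.im| / 2 := by
  obtain ⟨ρ, hρ, hinj⟩ := exists_injOn_collar (D.smooth c) (D.immersed c t₀)
  have h1 : Tendsto (collar (D.curve c)) (𝓝 (t₀ : ℂ)) (𝓝 (D.curve c t₀)) :=
    (continuous_collar (D.smooth c)).tendsto' _ _ (collar_ofReal _ _)
  -- In collar coordinates the other strand has direction `β`.
  have hslope : Tendsto (fun q : ℂ × ℝ => slope (D.curve b.1) b.2 q.2 /
      slope (collar (D.curve c)) t₀ q.1) (𝓝[≠] (t₀ : ℂ) ×ˢ 𝓝[≠] (b.2 : ℝ)) (𝓝 β) := by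
    rw [← hβ]
    exact ((D.hasDerivAt_curve b).tendsto_slope.comp tendsto_snd).div
      ((hasStrictDerivAt_collar (D.smooth c) t₀).hasDerivAt.tendsto_slope.comp tendsto_fst)
      (D.immersed c t₀)
  have hopen : ∀ᶠ ζ : ℂ in 𝓝 β, |ζ.re - ζ.im / β.im * β.re| < |ζ.im / β.im| / 2 := by
    have hc : Continuous fun ζ : ℂ => |ζ.im / β.im| / 2 - |ζ.re - ζ.im / β.im * β.re| := by
      fun_prop
    have := (hc.tendsto β).eventually_const_lt (u := 0) (by simp [div_self hβ0])
    filter_upwards [this] with ζ hζ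
    linarith
  obtain ⟨p1, hp1, p2, hp2, hp⟩ := eventually_prod_iff.1 (hslope.eventually hopen)
  obtain ⟨ρ₁, hρ₁, h3⟩ := Metric.eventually_nhds_iff.1 (eventually_nhdsWithin_iff.1 hp1)
  obtain ⟨ρ₂, hρ₂, h4⟩ := Metric.eventually_nhds_iff.1 (eventually_nhdsWithin_iff.1 hp2)
  obtain ⟨ρ', hρ', h2⟩ := Metric.eventually_nhds_iff.1
    (h1.eventually (D.eventually_mem_image_imp (D.curve c t₀) (lt_min hρ hρ₂)))
  refine ⟨min ρ (min ρ' ρ₁), lt_min hρ (lt_min hρ' hρ₁), fun z hz hm => ?_⟩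
  have hz1 : ‖z - t₀‖ < ρ := hz.trans_le (min_le_left _ _)
  have hz2 : ‖z - t₀‖ < ρ' := hz.trans_le ((min_le_right _ _).trans (min_le_left _ _))
  have hz3 : ‖z - t₀‖ < ρ₁ := hz.trans_le ((min_le_right _ _).trans (min_le_right _ _))
  obtain ⟨a, ha, t, ht, e⟩ := h2 (y := z) (by rwa [dist_eq_norm]) hm
  rcases h a ha with rfl | rfl
  · left
    change |t - Int.fract t₀| < _ at ht
    have h3 : z = ((t + ⌊t₀⌋ : ℝ) : ℂ) := by
      refine hinj ?_ ?_ ?_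
      · rwa [Metric.mem_ball, dist_eq_norm]
      · rw [Metric.mem_ball, Complex.dist_eq, ← Complex.ofReal_sub, Complex.norm_real,
          Real.norm_eq_abs]
        have : t + ⌊t₀⌋ - t₀ = t - Int.fract t₀ := by rw [Int.fract]; ring
        rw [this]
        exact ht.trans_le (min_le_left _ _)
      · rw [collar_ofReal, curve_add_int]; exact e.symm
    rw [h3, Complex.ofReal_im]
  · by_cases hzt : z = t₀
    · left; rw [hzt, Complex.ofReal_im]
    have hta : t ≠ a.2 := by
      rintro rfl
      apply hzt
      refine hinj ?_ ?_ ?_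
      · rwa [Metric.mem_ball, dist_eq_norm]
      · exact Metric.mem_ball_self hρ
      · rw [collar_ofReal, ← ha]; exact e.symm
    right
    have h5 := hp (h3 (y := z) (by rwa [dist_eq_norm]) hzt)
      (h4 (y := t) (by rw [Real.dist_eq]; exact ht.trans_le (min_le_right _ _)) hta)
    -- Thus `z - t₀` is a real multiple of a number close to `β`, and the inequality that defines
    -- the sector is invariant under real scaling.
    have h6 : z - t₀ = ((t - a.2 : ℝ) : ℂ) * (slope (D.curve a.1) a.2 t /
        slope (collar (D.curve c)) t₀ z) := by
      have hz0 : z - t₀ ≠ 0 := sub_ne_zero.2 hzt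
      have ht0 : ((t - a.2 : ℝ) : ℂ) ≠ 0 := by exact_mod_cast sub_ne_zero.2 hta
      have hne : collar (D.curve c) z - D.curve c t₀ ≠ 0 := fun h0 => hzt (by
        refine hinj ?_ ?_ ?_
        · rwa [Metric.mem_ball, dist_eq_norm]
        · exact Metric.mem_ball_self hρ
        · rw [collar_ofReal]; exact sub_eq_zero.1 h0)
      have ha' : D.curve a.1 a.2 = D.curve c t₀ := ha
      rw [slope_def_module, slope_def_field, e, collar_ofReal, ha', Complex.real_smul]
      push_cast at ht0 ⊢
      field_simp
    generalize (slope (D.curve a.1) a.2 t / slope (collar (D.curve c)) t₀ z) = ζ at h5 h6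
    have h7 : z.im = (t - a.2) * ζ.im := by
      have := congrArg Complex.im h6
      rwa [Complex.im_ofReal_mul, Complex.sub_im, Complex.ofReal_im, sub_zero] at this
    rw [h6, h7, Complex.re_ofReal_mul, mul_div_assoc, mul_assoc, ← mul_sub, abs_mul, abs_mul,
      mul_div_assoc]
    exact mul_le_mul_of_nonneg_left h5.le (abs_nonneg _)

/-- The value of a function on the regions next to the curve `c` at time `t`, on the side
given by the sign `s`. -/
def sideValue (u : D.Region S → ℤ) (c : Fin l) (s t : ℝ) : ℤ :=
  Classical.epsilon fun n => ∀ᶠ r : ℝ in 𝓝[>] 0, evalAt u (collar (D.curve c) ⟨t, s * r⟩) = n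

theorem sideValue_eq {u : D.Region S → ℤ} {c : Fin l} {s t : ℝ} {n : ℤ}
    (h : ∀ᶠ r : ℝ in 𝓝[>] 0, evalAt u (collar (D.curve c) ⟨t, s * r⟩) = n) :
    sideValue u c s t = n := by
  have h1 := Classical.epsilon_spec (p := fun n => ∀ᶠ r : ℝ in 𝓝[>] 0,
    evalAt u (collar (D.curve c) ⟨t, s * r⟩) = n) ⟨n, h⟩
  obtain ⟨r, h2, h3⟩ := (h1.and h).exists
  exact h2.symm.trans h3

theorem sideValue_add_one (u : D.Region S → ℤ) (c : Fin l) (s t : ℝ) :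
    sideValue u c s (t + 1) = sideValue u c s t := by
  have h1 := D.curve_add_int c t 1
  have h2 := D.deriv_add_int c t 1
  simp only [Int.cast_one] at h1 h2
  simp only [sideValue, collar, h1, h2]

/-- The open half disc on the side `s` in collar coordinates is convex, and its image misses the
diagram; all nearby side values are taken in this one connected set. -/
theorem eventually_sideValue_simple (u : D.Region S → ℤ) (c : Fin l) {s : ℝ} (hs : s = 1 ∨ s = -1)
    (t₀ : ℝ) (h : ∀ a, D.point a = D.curve c t₀ → a = passage c t₀) :
    ∃ n, ∀ᶠ t in 𝓝 t₀, sideValue u c s t = n := by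
  obtain ⟨ρ, hρ, h1⟩ := exists_collar_simple c t₀ h
  set Q : Set ℂ := Metric.ball (t₀ : ℂ) ρ ∩ {z | 0 < s * z.im} with hQ
  have hconv : Convex ℝ Q := by
    refine (convex_ball _ _).inter ?_
    exact convex_halfSpace_gt (f := fun z : ℂ => s * z.im)
      ⟨fun x y => by simp [mul_add], fun r x => by simp; ring⟩ 0
  have hpre : IsPreconnected (collar (D.curve c) '' Q) :=
    hconv.isPreconnected.image _ (continuous_collar (D.smooth c)).continuousOn
  have hd : ∀ z ∈ collar (D.curve c) '' Q, z ∉ D.image := by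
    rintro _ ⟨z, hz, rfl⟩ hm
    have := h1 z (by simpa [dist_eq_norm] using hz.1) hm
    have h2 := hz.2
    simp [this] at h2
  have hmem : ∀ t, |t - t₀| < ρ → ∀ᶠ r : ℝ in 𝓝[>] 0, (⟨t, s * r⟩ : ℂ) ∈ Q := by
    intro t ht
    have hc : Continuous fun r : ℝ => (⟨t, s * r⟩ : ℂ) := by
      have : (fun r : ℝ => (⟨t, s * r⟩ : ℂ)) = fun r : ℝ => (t : ℂ) + (s * r : ℝ) * Complex.I := by
        funext r; apply Complex.ext <;> simp
      rw [this]; fun_prop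
    have h2 : ∀ᶠ r : ℝ in 𝓝[>] 0, (⟨t, s * r⟩ : ℂ) ∈ Metric.ball (t₀ : ℂ) ρ := by
      refine ((hc.tendsto 0).eventually (Metric.isOpen_ball.mem_nhds ?_)).filter_mono
        nhdsWithin_le_nhds
      have : (⟨t, s * 0⟩ : ℂ) = t := by apply Complex.ext <;> simp
      rw [this, Metric.mem_ball, Complex.dist_eq, ← Complex.ofReal_sub, Complex.norm_real]
      exact ht
    filter_upwards [h2, self_mem_nhdsWithin] with r h2 hr
    refine ⟨h2, ?_⟩
    have hr : 0 < r := hr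
    rcases hs with rfl | rfl <;> simpa using hr
  obtain ⟨r₀, hr₀⟩ := (hmem t₀ (by simpa using hρ)).exists
  refine ⟨evalAt u (collar (D.curve c) ⟨t₀, s * r₀⟩), ?_⟩
  filter_upwards [Metric.ball_mem_nhds t₀ hρ] with t ht
  refine sideValue_eq ?_
  filter_upwards [hmem t ht] with r hr
  exact evalAt_eq_of_isPreconnected u hpre hd ⟨_, hr, rfl⟩ ⟨_, hr₀, rfl⟩

/-- A connected set off the diagram joins points next to the half strand `σ`, on the side `s`, to
points near the corner ray `ζ`. The sign condition `hsign` says that `τ` times the other velocity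
points to the side `s`. -/
theorem eventually_sideValue_crossing (u : D.Region S → ℤ) (c : Fin l) (t₀ : ℝ) {b : Passage l}
    (hb : D.point b = D.curve c t₀)
    (h : ∀ a, D.point a = D.curve c t₀ → a = passage c t₀ ∨ a = b) {σ τ s : ℝ}
    (hσ : σ = 1 ∨ σ = -1) (hs : s = 1 ∨ s = -1)
    (hsign : 0 < s * τ * planeDet (deriv (D.curve c) t₀) (D.velocity b)) (hτ : τ = 1 ∨ τ = -1)
    {ζ : ℂ} (hζ : ζ = σ * deriv (D.curve c) t₀ + τ * D.velocity b) {ε : ℝ} (hε : 0 < ε)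
    (hball : ∀ r : ℝ, 0 < r → r < ε → ∀ z, ‖z - (D.curve c t₀ + r * ζ)‖ < ε * r → z ∉ D.image)
    {n : ℤ} (hn : ∀ᶠ r : ℝ in 𝓝[>] 0, evalAt u (D.curve c t₀ + r * ζ) = n) :
    ∀ᶠ δ : ℝ in 𝓝[>] 0, sideValue u c s (t₀ + σ * δ) = n := by
  set v := deriv (D.curve c) t₀ with hv
  have hv0 : v ≠ 0 := D.immersed c t₀
  obtain ⟨β, hβ⟩ : ∃ β, D.velocity b / v = β := ⟨_, rfl⟩
  have hdet : planeDet v (D.velocity b) ≠ 0 := by intro h0; simp [h0] at hsign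
  have hσσ : σ * σ = 1 := by rcases hσ with rfl | rfl <;> norm_num
  have hττ : τ * τ = 1 := by rcases hτ with rfl | rfl <;> norm_num
  have hss : s * s = 1 := by rcases hs with rfl | rfl <;> norm_num
  have hsβ : 0 < s * τ * β.im := by
    rcases hdet.lt_or_gt with h1 | h1
    · have h2 : β.im < 0 := hβ ▸ im_div_neg_iff.2 h1
      nlinarith
    · have h2 : 0 < β.im := hβ ▸ im_div_pos_iff.2 h1
      nlinarith
  have hβ0 : β.im ≠ 0 := by intro h0; simp [h0] at hsβ
  obtain ⟨ρ, hρ, h1⟩ := exists_collar_crossing c t₀ hb h hβ hβ0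
  -- Writing `z - t₀ = X + Y * β` with real `X` and `Y`, the conditions are `0 < τ * Y` and `τ * Y /
  -- 2 < σ * X`. This is a convex sector that avoids the strand itself and the double sector `|X| ≤
  -- |Y| / 2` around the other one.
  set Q : Set ℂ := Metric.ball (t₀ : ℂ) ρ ∩ ({z | 0 < τ * (z.im / β.im)} ∩
    {z | 0 < σ * ((z - t₀).re - z.im / β.im * β.re) - τ * (z.im / β.im) / 2}) with hQ
  have hconv : Convex ℝ Q := by
    refine (convex_ball _ _).inter (Convex.inter ?_ ?_)
    · exact convex_halfSpace_gt (f := fun z : ℂ => τ * (z.im / β.im))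
        ⟨fun x y => by simp; ring, fun r x => by simp; ring⟩ 0
    · have := convex_halfSpace_gt (𝕜 := ℝ)
        (f := fun z : ℂ => σ * (z.re - z.im / β.im * β.re) - τ * (z.im / β.im) / 2)
        ⟨fun x y => by simp; ring, fun r x => by simp; ring⟩ (σ * t₀)
      have e : {z : ℂ | 0 < σ * ((z - t₀).re - z.im / β.im * β.re) - τ * (z.im / β.im) / 2} =
          {z : ℂ | σ * t₀ < σ * (z.re - z.im / β.im * β.re) - τ * (z.im / β.im) / 2} := by
        ext z
        simp only [Set.mem_ofPred_eq, Complex.sub_re, Complex.ofReal_re]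
        constructor <;> intro h <;> linarith
      rwa [e]
  have hpre : IsPreconnected (collar (D.curve c) '' Q) :=
    hconv.isPreconnected.image _ (continuous_collar (D.smooth c)).continuousOn
  have hd : ∀ z ∈ collar (D.curve c) '' Q, z ∉ D.image := by
    rintro _ ⟨z, ⟨hz1, hz2, hz3⟩, rfl⟩ hm
    simp only [Set.mem_ofPred_eq] at hz2 hz3
    rcases h1 z (by simpa [dist_eq_norm] using hz1) hm with h2 | h2
    · simp [h2] at hz2
    · have e1 : |z.im / β.im| = τ * (z.im / β.im) := by
        rw [← abs_of_pos hz2, abs_mul]; rcases hτ with rfl | rfl <;> simp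
      have e2 : σ * ((z - t₀).re - z.im / β.im * β.re) ≤
          |(z - t₀).re - z.im / β.im * β.re| := by
        rcases hσ with rfl | rfl
        · rw [one_mul]; exact le_abs_self _
        · rw [neg_one_mul]; exact neg_le_abs _
      rw [e1] at h2
      linarith
  -- a point of `Q` whose image is close to the corner
  have hcorner : ∀ᶠ r : ℝ in 𝓝[>] 0, (t₀ + r * (σ + τ * β) : ℂ) ∈ Q ∧
      ‖collar (D.curve c) (t₀ + r * (σ + τ * β)) - (D.curve c t₀ + r * ζ)‖ < ε * r := by
    have hc : Continuous fun r : ℝ => (t₀ + r * (σ + τ * β) : ℂ) := by fun_prop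
    have h2 : ∀ᶠ r : ℝ in 𝓝[>] 0, (t₀ + r * (σ + τ * β) : ℂ) ∈ Metric.ball (t₀ : ℂ) ρ := by
      refine ((hc.tendsto 0).eventually (Metric.isOpen_ball.mem_nhds ?_)).filter_mono
        nhdsWithin_le_nhds
      simpa using hρ
    have h3 := (hasStrictDerivAt_collar (D.smooth c) t₀).hasDerivAt
    have h4 : HasDerivAt (fun r : ℝ => (t₀ + r * (σ + τ * β) : ℂ)) (σ + τ * β) 0 := by
      simpa using (((hasDerivAt_id (0 : ℝ)).ofReal_comp).mul_const (σ + τ * β : ℂ)).const_add (t₀ : ℂ)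
    have h5 : HasDerivAt (fun r : ℝ => collar (D.curve c) (t₀ + r * (σ + τ * β))) ζ 0 := by
      have h3' : HasDerivAt (collar (D.curve c)) v ((t₀ : ℂ) + (0 : ℝ) * (σ + τ * β)) := by
        simpa using h3
      refine (h3'.comp (0 : ℝ) h4).congr_deriv ?_
      rw [hζ, ← hβ]; field_simp
    have h6 := h5.tendsto_slope_zero_right
    have h7 : ∀ᶠ r : ℝ in 𝓝[>] 0, dist (r⁻¹ • (collar (D.curve c) (t₀ + (0 + r : ℝ) * (σ + τ * β)) -
        collar (D.curve c) (t₀ + (0 : ℝ) * (σ + τ * β)))) ζ < ε :=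
      h6.eventually (Metric.ball_mem_nhds ζ hε)
    filter_upwards [h2, h7, self_mem_nhdsWithin] with r h2 h7 hr
    have hr : 0 < r := hr
    have hr0 : (r : ℂ) ≠ 0 := by exact_mod_cast hr.ne'
    refine ⟨⟨h2, ?_, ?_⟩, ?_⟩
    · have : (t₀ + r * (σ + τ * β) : ℂ).im / β.im = r * τ := by
        simp; field_simp
      simp only [Set.mem_ofPred_eq, this]
      nlinarith
    · have : (t₀ + r * (σ + τ * β) : ℂ).im / β.im = r * τ := by
        simp; field_simp
      simp only [Set.mem_ofPred_eq, this]
      have e : (t₀ + r * (σ + τ * β) - t₀ : ℂ).re - r * τ * β.re = r * σ := by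
        simp; ring
      rw [e]
      nlinarith
    · rw [zero_add, Complex.ofReal_zero, zero_mul, add_zero, collar_ofReal, dist_eq_norm,
        Complex.real_smul, Complex.ofReal_inv] at h7
      have e : collar (D.curve c) (t₀ + r * (σ + τ * β)) - (D.curve c t₀ + r * ζ) =
          r * ((r : ℂ)⁻¹ * (collar (D.curve c) (t₀ + r * (σ + τ * β)) - D.curve c t₀) - ζ) := by
        field_simp; ring
      rw [e, norm_mul, Complex.norm_real, Real.norm_of_nonneg hr.le, mul_comm]
      exact mul_lt_mul_of_pos_right h7 hr
  obtain ⟨r₀, ⟨hr₀Q, hr₀⟩, hr₀n, hr₀0⟩ := (hcorner.and (hn.and (Ioo_mem_nhdsGT hε))).exists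
  have hval : evalAt u (collar (D.curve c) (t₀ + r₀ * (σ + τ * β))) = n := by
    rw [← hr₀n]
    -- The collar point and the point of the corner ray lie in a common disc that is free of the
    -- diagram.
    refine evalAt_eq_of_isPreconnected u (s := Metric.ball (D.curve c t₀ + r₀ * ζ) (ε * r₀))
      (convex_ball _ _).isPreconnected (fun z hz => hball r₀ hr₀0.1 hr₀0.2 z ?_) ?_ ?_
    · rwa [Metric.mem_ball, dist_eq_norm] at hz
    · rwa [Metric.mem_ball, dist_eq_norm]
    · exact Metric.mem_ball_self (mul_pos hε hr₀0.1)
  filter_upwards [Ioo_mem_nhdsGT hρ] with δ hδ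
  refine sideValue_eq ?_
  have hmem : ∀ᶠ r : ℝ in 𝓝[>] 0, (⟨t₀ + σ * δ, s * r⟩ : ℂ) ∈ Q := by
    have hc : Continuous fun r : ℝ => (⟨t₀ + σ * δ, s * r⟩ : ℂ) := by
      have : (fun r : ℝ => (⟨t₀ + σ * δ, s * r⟩ : ℂ)) =
          fun r : ℝ => ((t₀ + σ * δ : ℝ) : ℂ) + (s * r : ℝ) * Complex.I := by
        funext r; apply Complex.ext <;> simp
      rw [this]; fun_prop
    have h2 : ∀ᶠ r : ℝ in 𝓝[>] 0, (⟨t₀ + σ * δ, s * r⟩ : ℂ) ∈ Metric.ball (t₀ : ℂ) ρ := by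
      refine ((hc.tendsto 0).eventually (Metric.isOpen_ball.mem_nhds ?_)).filter_mono
        nhdsWithin_le_nhds
      have : (⟨t₀ + σ * δ, s * 0⟩ : ℂ) = ((t₀ + σ * δ : ℝ) : ℂ) := by apply Complex.ext <;> simp
      rw [this, Metric.mem_ball, Complex.dist_eq, ← Complex.ofReal_sub, Complex.norm_real,
        add_sub_cancel_left, norm_mul, Real.norm_of_nonneg hδ.1.le]
      rcases hσ with rfl | rfl <;> simpa using hδ.2
    have hc3 : Continuous fun r : ℝ => σ * (((⟨t₀ + σ * δ, s * r⟩ : ℂ) - t₀).re -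
        (⟨t₀ + σ * δ, s * r⟩ : ℂ).im / β.im * β.re) -
        τ * ((⟨t₀ + σ * δ, s * r⟩ : ℂ).im / β.im) / 2 := by
      simp only [Complex.sub_re]
      fun_prop
    have h3 := ((hc3.tendsto 0).eventually_const_lt (u := 0) (by
      simp only [Complex.sub_re, Complex.ofReal_re, mul_zero, zero_div, zero_mul, sub_zero,
        add_sub_cancel_left, ← mul_assoc, hσσ, one_mul]
      exact hδ.1)).filter_mono (nhdsWithin_le_nhds (s := Set.Ioi 0))
    filter_upwards [h2, h3, self_mem_nhdsWithin] with r h2 h3 hr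
    refine ⟨h2, ?_, h3⟩
    have hr : 0 < r := hr
    have e : τ * (s * r / β.im) = (s * τ * β.im) * r / (β.im * β.im) := by field_simp
    simp only [Set.mem_ofPred_eq, e]
    have : 0 < β.im * β.im := mul_self_pos.2 hβ0
    positivity
  filter_upwards [hmem] with r hr
  rw [← hval]
  exact evalAt_eq_of_isPreconnected u hpre hd ⟨_, hr, rfl⟩ ⟨_, hr₀Q, rfl⟩

end Sides

end LinkDiagram

/-! ## The jumps of a periodic function -/

/-- The ceiling is constant just to the left of every point and jumps by one just after each
integer; its translates are the model step functions for `sum_jumps_eq_zero`. -/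
theorem eventually_ceil_left (x : ℝ) : ∀ᶠ t in 𝓝[<] x, ⌈t⌉ = ⌈x⌉ := by
  have h := Int.ceil_lt_add_one x
  have hx : (⌈x⌉ : ℝ) - 1 < x := by linarith
  filter_upwards [Ioo_mem_nhdsLT hx] with t ht
  rw [Int.ceil_eq_iff]
  exact ⟨ht.1, ht.2.le.trans (Int.le_ceil x)⟩

open Classical in
theorem eventually_ceil_right (x : ℝ) :
    ∀ᶠ t in 𝓝[>] x, ⌈t⌉ = ⌈x⌉ + if ∃ n : ℤ, x = n then 1 else 0 := by
  have h := Int.le_ceil x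
  have h' := Int.ceil_lt_add_one x
  split_ifs with hx
  · obtain ⟨n, rfl⟩ := hx
    filter_upwards [Ioo_mem_nhdsGT (show (n : ℝ) < n + 1 by linarith)] with t ht
    rw [Int.ceil_intCast, Int.ceil_eq_iff]
    push_cast
    exact ⟨by linarith [ht.1], ht.2.le⟩
  · have hlt : x < ⌈x⌉ := lt_of_le_of_ne h fun e => hx ⟨_, e⟩
    filter_upwards [Ioo_mem_nhdsGT hlt] with t ht
    rw [add_zero, Int.ceil_eq_iff]
    exact ⟨by linarith [ht.1], ht.2.le⟩

open Classical in
/-- If a function of period `1` is locally constant up to jumps, then the sum of its jumps over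
one period vanishes. -/
theorem sum_jumps_eq_zero {ι : Type*} [Fintype ι] (V : ℝ → ℤ) (hV : ∀ t, V (t + 1) = V t)
    (τ : ι → ℝ) (j : ι → ℤ)
    (h : ∀ t₀, ∃ n, (∀ᶠ t in 𝓝[<] t₀, V t = n) ∧
      ∀ᶠ t in 𝓝[>] t₀, V t = n + ∑ i, if ∃ k : ℤ, t₀ = τ i + k then j i else 0) :
    ∑ i, j i = 0 := by
  -- Subtracting step functions with the same jumps leaves a function without jumps, constant up to
  -- isolated exceptional values. Over one period `V` returns to its value while each ceiling grows
  -- by one, so the sum of the `j i` must vanish.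
  set F : ℝ → ℤ := fun t => V t - ∑ i, j i * ⌈t - τ i⌉ with hF
  have hloc : ∀ t₀, ∃ n, ∀ᶠ t in 𝓝[≠] t₀, F t = n := by
    intro t₀
    obtain ⟨n, hl, hr⟩ := h t₀
    refine ⟨n - ∑ i, j i * ⌈t₀ - τ i⌉, ?_⟩
    have tl : ∀ i, Tendsto (fun t => t - τ i) (𝓝[<] t₀) (𝓝[<] (t₀ - τ i)) := fun i =>
      tendsto_nhdsWithin_iff.2 ⟨(continuous_sub_right (τ i)).continuousAt.mono_left
        nhdsWithin_le_nhds, by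
          filter_upwards [self_mem_nhdsWithin] with t ht
          exact sub_lt_sub_right (Set.mem_Iio.1 ht) _⟩
    have tr : ∀ i, Tendsto (fun t => t - τ i) (𝓝[>] t₀) (𝓝[>] (t₀ - τ i)) := fun i =>
      tendsto_nhdsWithin_iff.2 ⟨(continuous_sub_right (τ i)).continuousAt.mono_left
        nhdsWithin_le_nhds, by
          filter_upwards [self_mem_nhdsWithin] with t ht
          exact sub_lt_sub_right (Set.mem_Ioi.1 ht) _⟩
    rw [← Set.Iio_union_Ioi, nhdsWithin_union, eventually_sup]
    constructor
    · filter_upwards [hl, eventually_all.2 fun i => (tl i).eventually (eventually_ceil_left _)]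
        with t h1 h2
      simp only [hF, h1, h2]
    · filter_upwards [hr, eventually_all.2 fun i => (tr i).eventually (eventually_ceil_right _)]
        with t h1 h2
      simp only [hF, h1, h2, mul_add, Finset.sum_add_distrib, mul_ite, mul_one, mul_zero,
        sub_eq_iff_eq_add (b := τ _), add_comm _ (τ _)]
      ring
  choose val hval using hloc
  have hconst : ∀ t t', val t = val t' := by
    have : IsLocallyConstant val := by
      refine (IsLocallyConstant.iff_eventually_eq _).2 fun t₀ => ?_
      have h1 := eventually_eventually_nhdsWithin.2 (hval t₀)
      rw [eventually_nhdsWithin_iff] at h1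
      filter_upwards [h1] with t ht
      by_cases htt : t = t₀
      · rw [htt]
      have h2 : ∀ᶠ s in 𝓝[≠] t, F s = val t₀ := by
        have h3 : ∀ᶠ s in 𝓝 t, s ∈ ({t₀}ᶜ : Set ℝ) := isOpen_compl_singleton.mem_nhds htt
        have h4 := ht htt
        rw [eventually_nhdsWithin_iff] at h4
        refine Eventually.filter_mono nhdsWithin_le_nhds ?_
        filter_upwards [h3, h4] with s h3 h4 using h4 h3
      obtain ⟨s, h5, h6⟩ := ((hval t).and h2).exists
      exact h5.symm.trans h6
    exact fun t t' => this.apply_eq_of_preconnectedSpace t t'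
  have hshift : Tendsto (fun t : ℝ => t + 1) (𝓝[≠] 0) (𝓝[≠] (0 + 1)) :=
    tendsto_nhdsWithin_iff.2 ⟨(continuous_add_const (1 : ℝ)).continuousAt.mono_left
      nhdsWithin_le_nhds, by
        filter_upwards [self_mem_nhdsWithin] with t ht
        intro h
        exact ht (add_right_cancel h)⟩
  obtain ⟨t, h1, h2⟩ := ((hval 0).and (hshift.eventually (hval (0 + 1)))).exists
  rw [hconst (0 + 1) 0, ← h1] at h2
  have e : ∀ i, ⌈t + 1 - τ i⌉ = ⌈t - τ i⌉ + 1 := fun i => by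
    rw [show t + 1 - τ i = t - τ i + 1 by ring, Int.ceil_add_one]
  simp only [hF, hV, e, mul_add, mul_one, Finset.sum_add_distrib] at h2
  linarith

namespace LinkDiagram

/-! ### Jumps of the side difference along a component -/

section Jumps

variable {l : ℕ} {D : LinkDiagram l} {S : DiagramSurface}

/-- The difference of the values on the two sides of a curve. -/
def sideDiff (u : D.Region S → ℤ) (c : Fin l) (t : ℝ) : ℤ :=
  sideValue u c 1 t - sideValue u c (-1) t

/-- The alternating sum of the values at the four corners of a crossing. -/
def altSum (u : D.Region S → ℤ) (x : D.Crossing) : ℤ :=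
  ∑ κ : Corner, ((κ.1 * κ.2 : ℤˣ) : ℤ) * u (cornerRegion S x κ)

/-- The unit `d` is the sign of the determinant, so along either half strand the corner on the left
has `τ = d`. The map `κ` names the corners relative to the strand that is followed, which covers
overpasses and underpasses at once. -/
theorem eventually_sideDiff_crossing (u : D.Region S → ℤ) (x : D.Crossing) (c : Fin l) (t₀ : ℝ)
    {b : Passage l} (hb : D.point b = D.curve c t₀) (hx : D.curve c t₀ = x.center)
    (h : ∀ a, D.point a = D.curve c t₀ → a = passage c t₀ ∨ a = b)
    {κ : ℤˣ → ℤˣ → Corner} (hκ : ∀ σ τ : ℤˣ, x.ray (κ σ τ) =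
      ((σ : ℤ) : ℂ) * deriv (D.curve c) t₀ + ((τ : ℤ) : ℂ) * D.velocity b) (d : ℤˣ)
    (hd : 0 < (d : ℤ) * planeDet (deriv (D.curve c) t₀) (D.velocity b)) (σ : ℤˣ) :
    ∀ᶠ δ : ℝ in 𝓝[>] 0, sideDiff u c (t₀ + (σ : ℤ) * δ) =
      d * (u (cornerRegion S x (κ σ 1)) - u (cornerRegion S x (κ σ (-1)))) := by
  have hunit : ∀ e : ℤˣ, ((e : ℤ) : ℝ) = 1 ∨ ((e : ℤ) : ℝ) = -1 := fun e => by
    rcases Int.units_eq_one_or e with rfl | rfl <;> simp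
  have key : ∀ s τ : ℤˣ, s * τ = d → ∀ᶠ δ : ℝ in 𝓝[>] 0,
      sideValue u c (s : ℤ) (t₀ + (σ : ℤ) * δ) = u (cornerRegion S x (κ σ τ)) := by
    intro s τ hsτ
    obtain ⟨ε, hε, hball⟩ := x.exists_ball_disjoint (κ σ τ)
    refine eventually_sideValue_crossing u c t₀ hb h (σ := (σ : ℤ)) (τ := (τ : ℤ)) (s := (s : ℤ))
      (ζ := x.ray (κ σ τ)) (hunit σ) (hunit s) ?_ (hunit τ) ?_ hε ?_ ?_
    · rw [← hsτ] at hd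
      push_cast at hd
      exact hd
    · rw [hκ]; push_cast; rfl
    · rw [hx]; exact hball
    · rw [hx]
      filter_upwards [eventually_evalAt_cornerPoint u x (κ σ τ)] with r hr using hr.2
  have k1 := key 1 d (one_mul d)
  have k2 := key (-1) (-d) (by simp)
  filter_upwards [k1, k2] with δ k1 k2
  push_cast at k1 k2
  rw [sideDiff, k1, k2]
  rcases Int.units_eq_one_or d with rfl | rfl <;> simp

theorem tendsto_add_sub (t₀ : ℝ) : Tendsto (fun t => t - t₀) (𝓝[>] t₀) (𝓝[>] 0) ∧
    Tendsto (fun t => t₀ - t) (𝓝[<] t₀) (𝓝[>] 0) := by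
  refine ⟨tendsto_nhdsWithin_iff.2 ⟨?_, ?_⟩, tendsto_nhdsWithin_iff.2 ⟨?_, ?_⟩⟩
  · exact ((continuous_sub_right t₀).tendsto' _ _ (sub_self t₀)).mono_left nhdsWithin_le_nhds
  · filter_upwards [self_mem_nhdsWithin] with t ht using sub_pos.2 (Set.mem_Ioi.1 ht)
  · exact ((continuous_sub_left t₀).tendsto' _ _ (sub_self t₀)).mono_left nhdsWithin_le_nhds
  · filter_upwards [self_mem_nhdsWithin] with t ht using sub_pos.2 (Set.mem_Iio.1 ht)

/-- The jump of `sideDiff` at a crossing. -/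
theorem exists_jump_crossing (u : D.Region S → ℤ) (x : D.Crossing) (c : Fin l) (t₀ : ℝ)
    {b : Passage l} (hb : D.point b = D.curve c t₀) (hx : D.curve c t₀ = x.center)
    (h : ∀ a, D.point a = D.curve c t₀ → a = passage c t₀ ∨ a = b)
    {κ : ℤˣ → ℤˣ → Corner} (hκ : ∀ σ τ : ℤˣ, x.ray (κ σ τ) =
      ((σ : ℤ) : ℂ) * deriv (D.curve c) t₀ + ((τ : ℤ) : ℂ) * D.velocity b) (d : ℤˣ)
    (hd : 0 < (d : ℤ) * planeDet (deriv (D.curve c) t₀) (D.velocity b)) :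
    ∃ n, (∀ᶠ t in 𝓝[<] t₀, sideDiff u c t = n) ∧
      ∀ᶠ t in 𝓝[>] t₀, sideDiff u c t = n + d *
        ((u (cornerRegion S x (κ 1 1)) - u (cornerRegion S x (κ 1 (-1)))) -
        (u (cornerRegion S x (κ (-1) 1)) - u (cornerRegion S x (κ (-1) (-1))))) := by
  have h1 := (tendsto_add_sub t₀).1.eventually
    (eventually_sideDiff_crossing u x c t₀ hb hx h hκ d hd 1)
  have h2 := (tendsto_add_sub t₀).2.eventually
    (eventually_sideDiff_crossing u x c t₀ hb hx h hκ d hd (-1))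
  refine ⟨d * (u (cornerRegion S x (κ (-1) 1)) - u (cornerRegion S x (κ (-1) (-1)))),
    h2.mono fun t ht => ?_, h1.mono fun t ht => ?_⟩
  · rw [← ht]; congr 1; push_cast; ring
  · have e : t₀ + ((1 : ℤˣ) : ℤ) * (t - t₀) = t := by push_cast; ring
    rw [e] at ht
    rw [ht]; ring

theorem exists_jump_simple (u : D.Region S → ℤ) (c : Fin l) (t₀ : ℝ)
    (h : ∀ a, D.point a = D.curve c t₀ → a = passage c t₀) :
    ∃ n, (∀ᶠ t in 𝓝[<] t₀, sideDiff u c t = n) ∧ ∀ᶠ t in 𝓝[>] t₀, sideDiff u c t = n := by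
  obtain ⟨n₁, h1⟩ := eventually_sideValue_simple u c (Or.inl rfl) t₀ h
  obtain ⟨n₂, h2⟩ := eventually_sideValue_simple u c (Or.inr rfl) t₀ h
  have : ∀ᶠ t in 𝓝 t₀, sideDiff u c t = n₁ - n₂ := by
    filter_upwards [h1, h2] with t h1 h2
    rw [sideDiff, h1, h2]
  exact ⟨_, this.filter_mono nhdsWithin_le_nhds, this.filter_mono nhdsWithin_le_nhds⟩

theorem exists_crossing_of_ne {a b : Passage l} (hab : a ≠ b) (h : D.point a = D.point b) :
    ∃ x : D.Crossing, (x.overPass = a ∧ x.underPass = b) ∨ (x.overPass = b ∧ x.underPass = a) := by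
  by_cases ha : a ∈ D.overPasses
  · exact ⟨⟨a, b, hab, h, ha, (D.mem_overPasses_iff a b hab h).1 ha⟩, Or.inl ⟨rfl, rfl⟩⟩
  · have hb : b ∈ D.overPasses := by
      by_contra hb
      exact ha ((D.mem_overPasses_iff a b hab h).2 hb)
    exact ⟨⟨b, a, hab.symm, h.symm, hb, ha⟩, Or.inr ⟨rfl, rfl⟩⟩

open Classical in
/-- Walking once around the component `c`: the alternating sums at the crossings that it passes,
counted with the sign at overpasses and with the opposite sign at underpasses, add up to zero. -/
theorem sum_altSum_eq_zero [Fintype D.Crossing] (u : D.Region S → ℤ) (c : Fin l) :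
    ∑ x : D.Crossing, x.sign * altSum u x *
      ((if x.overPass.1 = c then 1 else 0) - (if x.underPass.1 = c then 1 else 0)) = 0 := by
  -- One potential jump for each passage: `true` stands for the overpass and `false` for the
  -- underpass, with jump `0` if that passage is not on `c`.
  have key := sum_jumps_eq_zero (ι := D.Crossing × Bool) (sideDiff u c)
    (fun t => by simp only [sideDiff, sideValue_add_one])
    (fun i => if i.2 then i.1.overPass.2 else i.1.underPass.2)
    (fun i => if i.2 then (if i.1.overPass.1 = c then i.1.sign * altSum u i.1 else 0)
      else (if i.1.underPass.1 = c then -(i.1.sign * altSum u i.1) else 0)) ?_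
  · rw [Fintype.sum_prod_type] at key
    simp only [Fintype.sum_bool, if_true, Bool.false_eq_true, if_false] at key
    refine Eq.trans ?_ key
    refine Finset.sum_congr rfl fun x _ => ?_
    split_ifs <;> ring
  · intro t₀
    have hpass : ∀ (a : Passage l), a.1 = c → ((∃ k : ℤ, t₀ = a.2 + k) ↔ passage c t₀ = a) := by
      rintro a rfl
      conv_rhs => rw [← passage_coe a]
      rw [passage_eq_iff]
      simp
    have hterm : ∀ x : D.Crossing,
        ((if ∃ k : ℤ, t₀ = x.overPass.2 + k then
          (if x.overPass.1 = c then x.sign * altSum u x else 0) else 0) =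
          if passage c t₀ = x.overPass then x.sign * altSum u x else 0) ∧
        ((if ∃ k : ℤ, t₀ = x.underPass.2 + k then
          (if x.underPass.1 = c then -(x.sign * altSum u x) else 0) else 0) =
          if passage c t₀ = x.underPass then -(x.sign * altSum u x) else 0) := by
      intro x
      constructor
      · by_cases hc : x.overPass.1 = c
        · simp only [hc, if_true, hpass _ hc]
        · have : passage c t₀ ≠ x.overPass := fun h => hc (by rw [← h]; rfl)
          simp [hc, this]
      · by_cases hc : x.underPass.1 = c
        · simp only [hc, if_true, hpass _ hc]
        · have : passage c t₀ ≠ x.underPass := fun h => hc (by rw [← h]; rfl)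
          simp [hc, this]
    rw [Fintype.sum_prod_type]
    simp only [Fintype.sum_bool, if_true, Bool.false_eq_true, if_false, (hterm _).1, (hterm _).2]
    by_cases hsimple : ∀ a, D.point a = D.curve c t₀ → a = passage c t₀
    · obtain ⟨n, h1, h2⟩ := exists_jump_simple u c t₀ hsimple
      refine ⟨n, h1, ?_⟩
      rw [Finset.sum_eq_zero, add_zero]
      · exact h2
      · intro x _
        have o1 : passage c t₀ ≠ x.overPass := fun h => x.ne (by
          rw [hsimple x.underPass, h]
          rw [← x.same_point, ← h, point_passage])
        have o2 : passage c t₀ ≠ x.underPass := fun h => x.ne (by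
          rw [hsimple x.overPass, h]
          rw [x.same_point, ← h, point_passage])
        simp [o1, o2]
    · push Not at hsimple
      obtain ⟨b, hb, hne⟩ := hsimple
      have h : ∀ a, D.point a = D.curve c t₀ → a = passage c t₀ ∨ a = b := by
        intro a ha
        rcases D.double a (passage c t₀) b (by change D.point _ = D.point _; simpa using ha)
          (by change D.point _ = D.point _; simpa using hb.symm) with h | h | h
        · exact Or.inl h
        · exact absurd h.symm hne
        · exact Or.inr h
      obtain ⟨x, hx⟩ := exists_crossing_of_ne (D := D) (a := passage c t₀) (b := b) hne.symm
        (by simpa using hb.symm)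
      have hcen : D.curve c t₀ = x.center := by
        rcases hx with ⟨h1, _⟩ | ⟨_, h1⟩
        · exact x.curve_eq_of_passage_eq_over h1.symm
        · exact x.curve_eq_of_passage_eq_under h1.symm
      have hsum : ∑ y : D.Crossing, ((if passage c t₀ = y.overPass then y.sign * altSum u y else 0) +
          if passage c t₀ = y.underPass then -(y.sign * altSum u y) else 0) =
          (if passage c t₀ = x.overPass then x.sign * altSum u x else 0) +
          if passage c t₀ = x.underPass then -(x.sign * altSum u x) else 0 := by
        refine Finset.sum_eq_single x (fun y _ hy => ?_) (by simp)
        have o1 : passage c t₀ ≠ y.overPass := fun h => hy (Crossing.ext_of_center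
          ((y.curve_eq_of_passage_eq_over h).symm.trans hcen))
        have o2 : passage c t₀ ≠ y.underPass := fun h => hy (Crossing.ext_of_center
          ((y.curve_eq_of_passage_eq_under h).symm.trans hcen))
        simp [o1, o2]
      rw [hsum]
      have hdet := x.det_ne_zero
      rcases hx with ⟨h1, h2⟩ | ⟨h2, h1⟩
      · have hv : deriv (D.curve c) t₀ = D.velocity x.overPass := by rw [h1, velocity_passage]
        have hne' : passage c t₀ ≠ x.underPass := by rw [h2]; exact hne.symm
        rw [if_pos h1.symm, if_neg hne', add_zero]
        rw [← h2] at hb h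
        obtain ⟨d, hd, hds⟩ : ∃ d : ℤˣ, 0 < ((d : ℤ) : ℝ) *
            planeDet (D.velocity x.overPass) (D.velocity x.underPass) ∧ x.sign = d := by
          unfold Crossing.sign
          rcases hdet.lt_or_gt with h | h
          · exact ⟨-1, by simpa using h, by simp [h.not_gt]⟩
          · exact ⟨1, by simpa using h, by simp [h]⟩
        obtain ⟨n, k1, k2⟩ := exists_jump_crossing u x c t₀ hb hcen h
          (κ := fun σ τ => (σ, τ)) (fun σ τ => by rw [hv, x.ray_eq]) d (by rwa [hv])
        refine ⟨n, k1, k2.mono fun t ht => ?_⟩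
        rw [ht, hds, altSum, sum_corner]
        simp
        ring
      · have hv : deriv (D.curve c) t₀ = D.velocity x.underPass := by rw [h1, velocity_passage]
        have hne' : passage c t₀ ≠ x.overPass := by rw [h2]; exact hne.symm
        rw [if_pos h1.symm, if_neg hne', zero_add]
        rw [← h2] at hb h
        -- At an underpass the strands exchange roles, which reverses the determinant; hence the
        -- opposite sign.
        obtain ⟨d, hd, hds⟩ : ∃ d : ℤˣ, 0 < ((d : ℤ) : ℝ) *
            planeDet (D.velocity x.underPass) (D.velocity x.overPass) ∧ x.sign = -d := by
          unfold Crossing.sign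
          rw [planeDet_swap] at hdet
          rw [planeDet_swap]
          have hdet := neg_ne_zero.1 hdet
          rw [planeDet_swap (D.velocity x.overPass)]
          rcases hdet.lt_or_gt with h | h
          · exact ⟨-1, by simpa using h, by simp [h]⟩
          · exact ⟨1, by simpa using h, by simp [h.le]⟩
        obtain ⟨n, k1, k2⟩ := exists_jump_crossing u x c t₀ hb hcen h
          (κ := fun σ τ => (τ, σ)) (fun σ τ => by rw [hv, x.ray_eq, add_comm]) d (by rwa [hv])
        refine ⟨n, k1, k2.mono fun t ht => ?_⟩
        rw [ht, hds, altSum, sum_corner]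
        simp
        ring

end Jumps

end LinkDiagram

namespace LinkDiagram

/-! ## Lobes at self-crossings -/

section Lobes

variable {l : ℕ} {D : LinkDiagram l} {S : DiagramSurface}

/-- The arc of the component `c` from time `a` to time `b` is one of the two closed curves into
which the component is cut at the self-crossing `x`; it leaves along the overpass if `e = 1` and
along the underpass if `e = -1`. -/
structure IsLobe (x : D.Crossing) (c : Fin l) (a b : ℝ) (e : ℤˣ) : Prop where
  lt : a < b
  lt' : b < a + 1
  ends : (e = 1 ∧ passage c a = x.overPass ∧ passage c b = x.underPass) ∨
    (e = -1 ∧ passage c a = x.underPass ∧ passage c b = x.overPass)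

theorem Crossing.IsSelf.exists_lobe_one {x : D.Crossing} (hx : x.IsSelf) :
    ∃ c a b, IsLobe x c a b 1 := by
  have ho := passage_coe x.overPass
  have hu := passage_coe x.underPass
  rw [← hx] at hu
  have h1 := x.overPass.2.2
  have h2 := x.underPass.2.2
  have hne : (x.overPass.2 : ℝ) ≠ x.underPass.2 := fun h => x.ne (by
    rw [← ho, ← hu, h])
  rcases hne.lt_or_gt with h | h
  · exact ⟨_, _, _, h, by linarith [h1.1, h2.2], Or.inl ⟨rfl, ho, hu⟩⟩
  -- If the underpass comes earlier in the period, its next occurrence is used.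
  · refine ⟨_, x.overPass.2, x.underPass.2 + (1 : ℤ), ?_, ?_, Or.inl ⟨rfl, ho, ?_⟩⟩
    · push_cast; linarith [h1.2, h2.1]
    · push_cast; linarith
    · rw [passage_add_int, hu]

variable {x : D.Crossing} {c : Fin l} {a b : ℝ} {e : ℤˣ}

namespace IsLobe

theorem next (h : IsLobe x c a b e) : IsLobe x c b (a + 1) (-e) := by
  have h1 : passage c (a + 1) = passage c a := by simpa using passage_add_int c a 1
  refine ⟨h.lt', by linarith [h.lt], ?_⟩
  rw [h1]
  rcases h.ends with ⟨rfl, h2, h3⟩ | ⟨rfl, h2, h3⟩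
  · exact Or.inr ⟨rfl, h3, h2⟩
  · exact Or.inl ⟨neg_neg 1, h3, h2⟩

theorem curve_left (h : IsLobe x c a b e) : D.curve c a = x.center := by
  rcases h.ends with ⟨_, h2, _⟩ | ⟨_, h2, _⟩
  exacts [x.curve_eq_of_passage_eq_over h2, x.curve_eq_of_passage_eq_under h2]

theorem curve_right (h : IsLobe x c a b e) : D.curve c b = x.center := by
  rcases h.ends with ⟨_, _, h2⟩ | ⟨_, _, h2⟩
  exacts [x.curve_eq_of_passage_eq_under h2, x.curve_eq_of_passage_eq_over h2]

theorem passage_eq (h : IsLobe x c a b e) {c' : Fin l} {t : ℝ} (ht : D.curve c' t = x.center) :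
    c' = c ∧ ∃ n : ℤ, t = a + n ∨ t = b + n := by
  have key : passage c' t = passage c a ∨ passage c' t = passage c b := by
    rcases h.ends with ⟨_, h2, h3⟩ | ⟨_, h2, h3⟩ <;> rw [h2, h3]
    exacts [x.passage_eq ht, (x.passage_eq ht).symm]
  rcases key with h1 | h1 <;> obtain ⟨h2, n, h3⟩ := passage_eq_iff.1 h1
  exacts [⟨h2, n, Or.inl h3⟩, ⟨h2, n, Or.inr h3⟩]

theorem curve_ne_of_mem (h : IsLobe x c a b e) {t : ℝ} (ht : t ∈ Set.Ioo a b) :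
    D.curve c t ≠ x.center := by
  intro h0
  obtain ⟨_, n, rfl | rfl⟩ := h.passage_eq h0
  · have h1 : (0 : ℝ) < n := by linarith [ht.1]
    have h2 : (n : ℝ) < 1 := by linarith [ht.2, h.lt']
    have h1' : 0 < n := by exact_mod_cast h1
    have h2' : n < 1 := by exact_mod_cast h2
    omega
  · have h1 : (-1 : ℝ) < n := by linarith [ht.1, h.lt']
    have h2 : (n : ℝ) < 0 := by linarith [ht.2]
    have h1' : -1 < n := by exact_mod_cast h1
    have h2' : n < 0 := by exact_mod_cast h2
    omega

theorem curve_ne_of_component_ne (h : IsLobe x c a b e) {c' : Fin l} (hc : c' ≠ c) (t : ℝ) :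
    D.curve c' t ≠ x.center := fun h0 => hc (h.passage_eq h0).1

theorem det_ne_zero (h : IsLobe x c a b e) :
    planeDet (deriv (D.curve c) a) (deriv (D.curve c) b) ≠ 0 := by
  rw [← velocity_passage, ← velocity_passage]
  rcases h.ends with ⟨_, h2, h3⟩ | ⟨_, h2, h3⟩ <;> rw [h2, h3]
  · exact x.det_ne_zero
  · rw [planeDet_swap]; exact neg_ne_zero.2 x.det_ne_zero

theorem ray_eq (h : IsLobe x c a b e) (κ : Corner) :
    x.ray κ = ((if e = 1 then κ.1 else κ.2 : ℤˣ) : ℤ) * deriv (D.curve c) a +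
      ((if e = 1 then κ.2 else κ.1 : ℤˣ) : ℤ) * deriv (D.curve c) b := by
  rw [← velocity_passage, ← velocity_passage, x.ray_eq]
  rcases h.ends with ⟨rfl, h2, h3⟩ | ⟨rfl, h2, h3⟩ <;> rw [h2, h3]
  · simp
  · rw [if_neg (by decide), if_neg (by decide), add_comm]

theorem isClosedChain (h : IsLobe x c a b e) :
    IsClosedChain D (fun _ : Unit => c) (fun _ => a) (fun _ => b) := fun w => by
  simp only [h.curve_left, h.curve_right]

/-- The turning contribution is the same at three of the corners and different at the
fourth one. -/
theorem turnLog_ray (h : IsLobe x c a b e) {κ : Corner} (hκ : κ ≠ (e, -e)) :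
    turnLog (deriv (D.curve c) a) (deriv (D.curve c) b) (x.ray κ) =
      Complex.log (-deriv (D.curve c) a / deriv (D.curve c) b) := by
  refine turnLog_of_corner h.det_ne_zero ?_
  rw [h.ray_eq]
  obtain ⟨κ₁, κ₂⟩ := κ
  rcases Int.units_eq_one_or e with rfl | rfl <;> rcases Int.units_eq_one_or κ₁ with rfl | rfl <;>
    rcases Int.units_eq_one_or κ₂ with rfl | rfl
  all_goals first
    | exact absurd rfl hκ
    | (left; simp; done)
    | (right; left; simp [sub_eq_add_neg]; done)
    | (right; right; left; simp [sub_eq_add_neg, add_comm]; done)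

/-- The corner `(e, -e)` is the one between the two ends of the lobe: its ray is the leaving
direction minus the arriving one. -/
theorem turnLog_ray_odd (h : IsLobe x c a b e) :
    turnLog (deriv (D.curve c) a) (deriv (D.curve c) b) (x.ray (e, -e)) ≠
      Complex.log (-deriv (D.curve c) a / deriv (D.curve c) b) := by
  have e1 : x.ray (e, -e) = deriv (D.curve c) a - deriv (D.curve c) b := by
    rw [h.ray_eq]
    rcases Int.units_eq_one_or e with rfl | rfl <;> simp [sub_eq_add_neg]
  rw [e1, turnLog_sub h.det_ne_zero]
  intro h0
  rw [sub_eq_self] at h0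
  have := Complex.two_pi_I_ne_zero
  split_ifs at h0 with h1
  · exact this h0
  · exact this (neg_eq_zero.1 h0)

variable {u : D.Region S → ℤ} (h : IsLobe x c a b e)
  (hu : ∀ z, z ∉ D.image → evalAt u z =
    chainIndex D (fun _ : Unit => c) (fun _ => a) (fun _ => b) z)
include h hu

theorem sub_eq_turnLog (κ κ' : Corner) : 2 * Real.pi * Complex.I *
      ((u (cornerRegion S x κ) : ℂ) - u (cornerRegion S x κ')) =
    turnLog (deriv (D.curve c) a) (deriv (D.curve c) b) (x.ray κ) -
      turnLog (deriv (D.curve c) a) (deriv (D.curve c) b) (x.ray κ') := by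
  rw [x.sub_eq h.isClosedChain hu (fun _ => h.lt) (fun _ t ht => h.curve_ne_of_mem ht) κ κ']
  simp [sideLog, h.curve_left, h.curve_right, turnLog]

theorem apply_odd_ne {κ : Corner} (hκ : κ ≠ (e, -e)) :
    u (cornerRegion S x (e, -e)) ≠ u (cornerRegion S x κ) := by
  intro h0
  have h1 := h.sub_eq_turnLog hu (e, -e) κ
  rw [h0, sub_self, mul_zero, h.turnLog_ray hκ, eq_comm, sub_eq_zero] at h1
  exact h.turnLog_ray_odd h1

theorem apply_eq {κ κ' : Corner} (hκ : κ ≠ (e, -e)) (hκ' : κ' ≠ (e, -e)) :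
    u (cornerRegion S x κ) = u (cornerRegion S x κ') := by
  have h1 := h.sub_eq_turnLog hu κ κ'
  rw [h.turnLog_ray hκ, h.turnLog_ray hκ', sub_self, mul_eq_zero,
    or_iff_right Complex.two_pi_I_ne_zero, sub_eq_zero] at h1
  exact_mod_cast h1

/-- If the lobe does not meet the rest of its component, then on this rest the index
function has the value that it has at three of the corners. -/
theorem chainIndex_eq (hdisj : ∀ p ∈ Set.Ioo a b, ∀ q ∈ Set.Ioo b (a + 1), D.curve c p ≠ D.curve c q)
    {q : ℝ} (hq : q ∈ Set.Ioo b (a + 1)) :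
    chainIndex D (fun _ : Unit => c) (fun _ => a) (fun _ => b) (D.curve c q) =
      u (cornerRegion S x (1, 1)) := by
  have hav : ∀ q ∈ Set.Ioo b (a + 1),
      ChainAvoids D (fun _ : Unit => c) (fun _ => a) (fun _ => b) (D.curve c q) := by
    intro q hq _ t ht he
    rw [Set.uIcc_of_le h.lt.le] at ht
    have hqc := h.next.curve_ne_of_mem hq
    rcases ht.1.eq_or_lt with rfl | h1
    · exact hqc (by rw [← he, h.curve_left])
    rcases ht.2.eq_or_lt with rfl | h2
    · exact hqc (by rw [← he, h.curve_right])
    exact hdisj t ⟨h1, h2⟩ q hq he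
  have hslope : Tendsto (fun r : ℝ => (D.curve c (b + r) - x.center) / r) (𝓝[>] 0)
      (𝓝 (deriv (D.curve c) b)) := by
    have := tendsto_slope_side (D.contDiff_one c) b (s := 1) (Or.inl rfl)
    simpa [h.curve_right] using this
  have hB0 : deriv (D.curve c) b ≠ 0 := D.immersed c b
  have hconst : ∀ᶠ r : ℝ in 𝓝[>] 0,
      chainIndex D (fun _ : Unit => c) (fun _ => a) (fun _ => b) (D.curve c (b + r)) =
      chainIndex D (fun _ : Unit => c) (fun _ => a) (fun _ => b) (D.curve c q) := by
    filter_upwards [Ioo_mem_nhdsGT (sub_pos.2 h.lt')] with r hr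
    refine h.isClosedChain.eq_of_isPreconnected (s := D.curve c '' Set.Ioo b (a + 1))
      (isPreconnected_Ioo.image _ (D.continuous_curve c).continuousOn) ?_
      ⟨b + r, ⟨by linarith [hr.1], by linarith [hr.2]⟩, rfl⟩ ⟨q, hq, rfl⟩
    rintro _ ⟨t, ht, rfl⟩
    exact hav t ht
  have hone : ((1, 1) : Corner) ≠ (e, -e) := by
    rcases Int.units_eq_one_or e with rfl | rfl <;> decide
  -- The index just after time `b` is compared with that at the corner `(1, 1)`. The former is
  -- approached in the arriving direction itself, which gives the same turning contribution as `(1,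
  -- 1)`.
  have h1 := h.isClosedChain.sub_eq (p := x.center) (fun _ => h.lt)
    (fun _ t ht => h.curve_ne_of_mem ht)
    (w := fun k => if k then fun r => D.curve c (b + r) else x.cornerPoint (1, 1))
    (ζ := fun k => if k then deriv (D.curve c) b else x.ray (1, 1))
    (N := fun k => if k then chainIndex D (fun _ : Unit => c) (fun _ => a) (fun _ => b) (D.curve c q)
      else u (cornerRegion S x (1, 1)))
    (fun k => by cases k <;> simp [hslope, x.tendsto_cornerPoint])
    (fun _ _ k => by
      cases k
      · exact (x.slit h.curve_left _).1
      · exact mem_slitPlane_of_planeDet_ne_zero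
          (by rw [planeDet_neg_left]; exact neg_ne_zero.2 h.det_ne_zero))
    (fun _ _ k => by
      cases k
      · exact (x.slit h.curve_right _).2
      · simp [div_self hB0])
    (fun k => by
      cases k
      · exact x.eventually_chainIndex hu _
      · exact hconst)
  have h2 : turnLog (deriv (D.curve c) a) (deriv (D.curve c) b) (deriv (D.curve c) b) =
      turnLog (deriv (D.curve c) a) (deriv (D.curve c) b) (x.ray (1, 1)) := by
    rw [h.turnLog_ray hone,
      turnLog_of_corner h.det_ne_zero (Or.inr (Or.inr (Or.inr rfl)))]
  have h3 : 2 * Real.pi * Complex.I *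
      ((chainIndex D (fun _ : Unit => c) (fun _ => a) (fun _ => b) (D.curve c q) : ℂ) -
        u (cornerRegion S x (1, 1))) =
      turnLog (deriv (D.curve c) a) (deriv (D.curve c) b) (deriv (D.curve c) b) -
      turnLog (deriv (D.curve c) a) (deriv (D.curve c) b) (x.ray (1, 1)) := by
    simpa [sideLog, h.curve_left, h.curve_right, turnLog] using h1
  rw [h2, sub_self, mul_eq_zero, or_iff_right Complex.two_pi_I_ne_zero, sub_eq_zero] at h3
  exact_mod_cast h3

theorem altSum_self : altSum u x = e * x.sign := by
  have h1 := x.alternating_sum_eq h.isClosedChain hu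
  change 2 * Real.pi * Complex.I * (altSum u x : ℂ) = _ at h1
  rw [Fintype.sum_unique] at h1
  have h2 : x.altLog c a - x.altLog c b = 2 * Real.pi * Complex.I * ((e : ℤ) * x.sign : ℤ) := by
    rcases h.ends with ⟨rfl, h3, h4⟩ | ⟨rfl, h3, h4⟩
    · rw [x.altLog_sub h3 h4]; simp
    · rw [← neg_sub, x.altLog_sub h4 h3]; simp
  rw [h2] at h1
  exact_mod_cast mul_left_cancel₀ Complex.two_pi_I_ne_zero h1

theorem altSum_of_ne {y : D.Crossing} (hy : y ≠ x) : altSum u y = 0 := by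
  have h1 := y.alternating_sum_eq h.isClosedChain hu
  change 2 * Real.pi * Complex.I * (altSum u y : ℂ) = _ at h1
  have hc : x.center ≠ y.center := fun h0 => hy (Crossing.ext_of_center h0).symm
  rw [Fintype.sum_unique, y.altLog_of_ne (by rwa [h.curve_left]),
    y.altLog_of_ne (by rwa [h.curve_right]), sub_self, mul_eq_zero,
    or_iff_right Complex.two_pi_I_ne_zero] at h1
  exact_mod_cast h1

end IsLobe

theorem IsLobe.exists_index_function (h : IsLobe x c a b e) (S : DiagramSurface) :
    ∃ u : D.Region S → ℤ, ∀ z, z ∉ D.image → evalAt u z =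
      chainIndex D (fun _ : Unit => c) (fun _ => a) (fun _ => b) z :=
  h.isClosedChain.exists_region_function S

/-- The winding number of the lobe takes a different value at the corner between its two ends. -/
theorem IsLobe.cornerRegion_odd_ne (h : IsLobe x c a b e) {κ : Corner} (hκ : κ ≠ (e, -e)) :
    cornerRegion S x (e, -e) ≠ cornerRegion S x κ := by
  obtain ⟨u, hu⟩ := h.exists_index_function S
  exact fun h0 => h.apply_odd_ne hu hκ (congrArg u h0)

theorem Crossing.IsSelf.exists_lobe (hx : x.IsSelf) (e : ℤˣ) : ∃ c a b, IsLobe x c a b e := by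
  obtain ⟨c, a, b, h⟩ := hx.exists_lobe_one
  rcases Int.units_eq_one_or e with rfl | rfl
  exacts [⟨c, a, b, h⟩, ⟨c, b, a + 1, h.next⟩]

/-! ## The regions at a crossing -/

/-- The four regions at a crossing of two different components are distinct. -/
theorem cornerRegion_injective_of_not_isSelf (hx : ¬x.IsSelf) : Injective (cornerRegion S x) := by
  have hpt : D.curve x.overPass.1 x.overPass.2 = x.center := rfl
  have key : ∀ p : Passage l, D.point p = x.center →
      (∀ q : Passage l, D.point q = x.center → q ≠ p → q.1 ≠ p.1) → ∀ κ κ' : Corner,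
      0 < planeDet (D.velocity p) (x.ray κ) → planeDet (D.velocity p) (x.ray κ') < 0 →
      cornerRegion S x κ ≠ cornerRegion S x κ' := by
    intro p hp hother κ κ' h1 h2
    have hper : D.curve p.1 (p.2 + 1) = D.curve p.1 p.2 := by simpa using D.curve_add_int p.1 p.2 1
    have hder : deriv (D.curve p.1) (p.2 + 1) = deriv (D.curve p.1) p.2 := by
      simpa using D.deriv_add_int p.1 p.2 1
    -- The whole component, cut open at `p`, is a closed chain. The other strand at `x` belongs to
    -- another component, so this chain passes through `x` once and straight.
    have hc : IsClosedChain D (fun _ : Unit => p.1) (fun _ => (p.2 : ℝ)) (fun _ => p.2 + 1) := by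
      intro w; simp only [hper]
    obtain ⟨u, hu⟩ := hc.exists_region_function S
    refine x.ne_of_straight hc hu (fun _ => by linarith) ?_ (i₀ := ()) (i₁ := ())
      (v := D.velocity p) hp (hper.trans hp) rfl hder (fun i hi => absurd rfl hi)
      (fun i hi => absurd rfl hi) h1 h2
    intro _ t ht h0
    have h3 : passage p.1 t = p := by
      by_contra h4
      exact hother _ (by rwa [point_passage]) h4 rfl
    obtain ⟨_, n, hn⟩ := passage_eq_iff.1 (h3.trans (passage_coe p).symm)
    have h5 : (0 : ℝ) < n := by linarith [ht.1]
    have h6 : (n : ℝ) < 1 := by linarith [ht.2]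
    have h5' : 0 < n := by exact_mod_cast h5
    have h6' : n < 1 := by exact_mod_cast h6
    omega
  have hover := key x.overPass rfl (fun q hq hne h0 => by
    rcases x.eq_or_eq hq with rfl | rfl
    exacts [hne rfl, hx h0.symm])
  have hunder := key x.underPass x.same_point.symm (fun q hq hne h0 => by
    rcases x.eq_or_eq hq with rfl | rfl
    exacts [hx h0, hne rfl])
  have hdet := x.det_ne_zero
  intro κ κ' he
  simp only [x.det_over_ray] at hover
  simp only [x.det_under_ray] at hunder
  obtain ⟨κ₁, κ₂⟩ := κ
  obtain ⟨κ₁', κ₂'⟩ := κ'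
  -- The overstrand separates corners with different second signs, and the understrand those with
  -- different first signs.
  have e2 : κ₂ = κ₂' := by
    by_contra h0
    rcases hdet.lt_or_gt with h3 | h3 <;> rcases Int.units_eq_one_or κ₂ with rfl | rfl <;>
      rcases Int.units_eq_one_or κ₂' with rfl | rfl
    all_goals first
      | exact h0 rfl
      | exact hover _ _ (by simpa using h3) (by simpa using h3) he
      | exact hover _ _ (by simpa using h3) (by simpa using h3) he.symm
  have e1 : κ₁ = κ₁' := by
    by_contra h0
    rcases hdet.lt_or_gt with h3 | h3 <;> rcases Int.units_eq_one_or κ₁ with rfl | rfl <;>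
      rcases Int.units_eq_one_or κ₁' with rfl | rfl
    all_goals first
      | exact h0 rfl
      | exact hunder _ _ (by simpa using h3) (by simpa using h3) he
      | exact hunder _ _ (by simpa using h3) (by simpa using h3) he.symm
  rw [e1, e2]

/-- Adjacent corners of a crossing belong to different regions. -/
theorem mul_eq_mul_of_cornerRegion_eq (x : D.Crossing) {κ κ' : Corner}
    (h : cornerRegion S x κ = cornerRegion S x κ') : κ.1 * κ.2 = κ'.1 * κ'.2 := by
  by_cases hx : x.IsSelf
  -- A corner `(σ, -σ)` lies between the two ends of the lobe with `e = σ`, so it shares its region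
  -- with no other corner. Only `(1, 1)` and `(-1, -1)` can coincide, and their products agree.
  · have key : ∀ κ κ' : Corner, cornerRegion S x κ = cornerRegion S x κ' → κ.2 = -κ.1 → κ = κ' := by
      intro κ κ' h0 h1
      obtain ⟨c, a, b, hl⟩ := hx.exists_lobe κ.1
      by_contra h2
      have : κ = (κ.1, -κ.1) := Prod.ext rfl h1
      rw [this] at h0 h2
      exact hl.cornerRegion_odd_ne (Ne.symm h2) h0
    have hdec : ∀ κ : Corner, κ.2 = -κ.1 ∨ κ.1 * κ.2 = 1 := by decide
    rcases hdec κ with h1 | h1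
    · rw [key _ _ h h1]
    · rcases hdec κ' with h2 | h2
      · rw [key _ _ h.symm h2]
      · rw [h1, h2]
  · rw [cornerRegion_injective_of_not_isSelf hx h]

theorem homA2_eq_altSum {n : ℕ} (e : Fin n ≃ D.Crossing) (u : D.Region S → ℤ) (i : Fin n) :
    homA2 S e u i = -((e i).sign * altSum u (e i)) := by
  rw [homA2_apply e u i fun κ κ' h => mul_eq_mul_of_cornerRegion_eq _ h, altSum, Finset.mul_sum,
    ← Finset.sum_neg_distrib]
  refine Finset.sum_congr rfl fun κ _ => ?_
  rw [Crossing.cornerSign]; ring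

/-! ## Crossings that a region touches twice -/

theorem exists_int_add_mem_Ico (a t : ℝ) : ∃ n : ℤ, t + n ∈ Set.Ico a (a + 1) :=
  ⟨-⌊t - a⌋, by push_cast; linarith [Int.floor_le (t - a)], by
    push_cast; linarith [Int.lt_floor_add_one (t - a)]⟩

section Twice

variable {κ : Corner} (hκ : cornerRegion S x κ = cornerRegion S x (-κ))
include hκ

omit hκ in
-- Opposite corners lie on opposite sides of each strand. In contrapositive form: a crossing that a
-- region touches twice admits no closed chain that runs straight through it once.
theorem cornerRegion_ne_neg_of_straight {ι : Type*} [Fintype ι] {c : ι → Fin l} {a b : ι → ℝ}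
    (hc : IsClosedChain D c a b) (hab : ∀ i, a i < b i)
    (hint : ∀ i, ∀ t ∈ Set.Ioo (a i) (b i), D.curve (c i) t ≠ x.center) {i₀ i₁ : ι}
    (ha₀ : D.curve (c i₀) (a i₀) = x.center) (hb₁ : D.curve (c i₁) (b i₁) = x.center)
    (hv : deriv (D.curve (c i₀)) (a i₀) = deriv (D.curve (c i₁)) (b i₁))
    (ha : ∀ i, i ≠ i₀ → D.curve (c i) (a i) ≠ x.center)
    (hb : ∀ i, i ≠ i₁ → D.curve (c i) (b i) ≠ x.center) (κ : Corner) :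
    cornerRegion S x κ ≠ cornerRegion S x (-κ) := by
  obtain ⟨u, hu⟩ := hc.exists_region_function S
  have hdet := x.det_ray_ne_zero (a := passage (c i₀) (a i₀)) (by rwa [point_passage]) κ
  rw [velocity_passage] at hdet
  have hneg := planeDet_neg_right (deriv (D.curve (c i₀)) (a i₀)) (x.ray κ)
  rw [← x.ray_neg] at hneg
  rcases hdet.lt_or_gt with h | h
  · exact (x.ne_of_straight hc hu hab hint ha₀ hb₁ rfl hv.symm ha hb (κ := -κ) (κ' := κ)
      (by linarith) h).symm
  · exact x.ne_of_straight hc hu hab hint ha₀ hb₁ rfl hv.symm ha hb h (by linarith)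

theorem isSelf_of_twice : x.IsSelf := by
  by_contra hx
  have h1 := cornerRegion_injective_of_not_isSelf hx hκ
  have : ∀ κ : Corner, κ ≠ -κ := by decide
  exact this κ h1

/-- A meeting point of the two lobes would allow a shortcut: follow the first lobe from `x` to this
point and then the second one back to `x`. This closed chain arrives along the strand on which it
left. -/
theorem IsLobe.curve_ne_of_twice (h : IsLobe x c a b e) {p q : ℝ} (hp : p ∈ Set.Ioo a b)
    (hq : q ∈ Set.Ioo b (a + 1)) : D.curve c p ≠ D.curve c q := by
  intro hpq
  have hper : D.curve c (a + 1) = D.curve c a := by simpa using D.curve_add_int c a 1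
  have hder : deriv (D.curve c) (a + 1) = deriv (D.curve c) a := by
    simpa using D.deriv_add_int c a 1
  refine cornerRegion_ne_neg_of_straight (x := x) (c := fun _ : Bool => c)
    (a := fun k => cond k a q) (b := fun k => cond k p (a + 1)) (i₀ := true) (i₁ := false)
    ?_ ?_ ?_ h.curve_left (hper.trans h.curve_left) hder.symm ?_ ?_ κ hκ
  · intro w
    simp only [Fintype.prod_bool, cond_true, cond_false, hper, hpq]
    ring
  · rintro (_ | _)
    exacts [hq.2, hp.1]
  · rintro (_ | _) t ht
    · exact h.next.curve_ne_of_mem ⟨hq.1.trans ht.1, ht.2⟩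
    · exact h.curve_ne_of_mem ⟨ht.1, ht.2.trans hp.2⟩
  · rintro (_ | _) hk
    · exact h.next.curve_ne_of_mem hq
    · exact absurd rfl hk
  · rintro (_ | _) hk
    · exact absurd rfl hk
    · exact h.curve_ne_of_mem hp

/-- The same shortcut, with a detour along `c'` that leads from the first lobe to the second. -/
theorem IsLobe.not_meets_both_of_twice (h : IsLobe x c a b e) {c' : Fin l} (hc : c' ≠ c)
    {p q s s' : ℝ} (hp : p ∈ Set.Ioo a b) (hq : q ∈ Set.Ioo b (a + 1))
    (hs : D.curve c' s = D.curve c p) (hs' : D.curve c' s' = D.curve c q) : False := by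
  have hper : D.curve c (a + 1) = D.curve c a := by simpa using D.curve_add_int c a 1
  have hder : deriv (D.curve c) (a + 1) = deriv (D.curve c) a := by
    simpa using D.deriv_add_int c a 1
  -- The arcs have to run forward in time; adding periods to `s'` achieves this.
  wlog hss : s < s' generalizing s'
  · obtain ⟨n, hn⟩ := exists_int_add_mem_Ico (s + 1) s'
    exact this (s' := s' + n) (by rwa [curve_add_int]) (by linarith [hn.1])
  refine cornerRegion_ne_neg_of_straight (x := x) (c := ![c, c', c]) (a := ![a, s, q])
    (b := ![p, s', a + 1]) (i₀ := 0) (i₁ := 2)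
    ?_ ?_ ?_ h.curve_left (hper.trans h.curve_left) hder.symm ?_ ?_ κ hκ
  · intro w
    simp [Fin.prod_univ_three, hper, hs, hs']
    ring
  · intro i
    fin_cases i
    exacts [hp.1, hss, hq.2]
  · intro i t ht
    fin_cases i
    · exact h.curve_ne_of_mem ⟨ht.1, lt_trans ht.2 hp.2⟩
    · exact h.curve_ne_of_component_ne hc t
    · exact h.next.curve_ne_of_mem ⟨hq.1.trans ht.1, ht.2⟩
  · intro i hi
    fin_cases i
    · exact absurd rfl hi
    · exact h.curve_ne_of_component_ne hc s
    · exact h.next.curve_ne_of_mem hq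
  · intro i hi
    fin_cases i
    · exact h.curve_ne_of_mem hp
    · exact h.curve_ne_of_component_ne hc s'
    · exact absurd rfl hi

end Twice

/-- A lobe that is separated by its crossing from the rest of the diagram: it meets neither the
rest of its component nor the component `c'`, while the rest of its component meets `c'`. -/
structure IsIsolatedLobe (x : D.Crossing) (c c' : Fin l) (a b : ℝ) (e : ℤˣ) : Prop
    extends IsLobe x c a b e where
  curve_ne : ∀ p ∈ Set.Ioo a b, ∀ q ∈ Set.Ioo b (a + 1), D.curve c p ≠ D.curve c q
  component_ne : c' ≠ c
  disjoint : ∀ p ∈ Set.Icc a b, ∀ s, D.curve c' s ≠ D.curve c p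
  meets : ∃ q ∈ Set.Ioo b (a + 1), ∃ s, D.curve c' s = D.curve c q

/-- Another component meets `c` on one of the two lobes, hence not on the other, and that other lobe
is the isolated one. -/
theorem exists_isolatedLobe {κ : Corner} (hκ : cornerRegion S x κ = cornerRegion S x (-κ))
    (hmeet : ∀ c : Fin l, ∃ c', c' ≠ c ∧ ∃ t s, D.curve c t = D.curve c' s) :
    ∃ c c' a b e, IsIsolatedLobe x c c' a b e := by
  obtain ⟨c, a, b, h⟩ := (isSelf_of_twice hκ).exists_lobe 1
  obtain ⟨c', hc, t, s, hts⟩ := hmeet c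
  have key : ∀ (a b : ℝ) (e : ℤˣ), IsLobe x c a b e → ∀ q ∈ Set.Ioo b (a + 1),
      D.curve c' s = D.curve c q → IsIsolatedLobe x c c' a b e := by
    intro a b e h q hq he
    refine ⟨h, fun p hp q hq => h.curve_ne_of_twice hκ hp hq, hc, ?_, q, hq, s, he⟩
    intro p hp s' hs'
    rcases hp.1.eq_or_lt with rfl | h1
    · exact h.curve_ne_of_component_ne hc s' (hs'.trans h.curve_left)
    rcases hp.2.eq_or_lt with rfl | h2
    · exact h.curve_ne_of_component_ne hc s' (hs'.trans h.curve_right)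
    exact h.not_meets_both_of_twice hκ hc ⟨h1, h2⟩ hq hs' he
  obtain ⟨n, hn⟩ := exists_int_add_mem_Ico a t
  rw [← D.curve_add_int c t n] at hts
  have hne := h.curve_ne_of_component_ne hc s
  rcases hn.1.eq_or_lt with h1 | h1
  · exact absurd (by rw [← hts, ← h1, h.curve_left]) hne
  rcases lt_trichotomy (t + n) b with h2 | h2 | h2
  · refine ⟨c, c', b, a + 1, -1, key _ _ _ h.next (t + n + 1) ⟨by linarith, by linarith⟩ ?_⟩
    rw [← hts]
    simpa using (D.curve_add_int c (t + n) 1).symm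
  · exact absurd (by rw [← hts, h2, h.curve_right]) hne
  · exact ⟨c, c', a, b, 1, key _ _ _ h (t + n) ⟨h2, hn.2⟩ hts.symm⟩

end Lobes

end LinkDiagram

namespace LinkDiagram

/-! ## Functions that solve the equations of a single crossing -/

section TwoComponents

variable {D : LinkDiagram 2} {S : DiagramSurface}

theorem altSum_sub_const {l : ℕ} {D : LinkDiagram l} (u : D.Region S → ℤ) (k : ℤ) (x : D.Crossing) :
    altSum (fun R => u R - k) x = altSum u x := by
  simp only [altSum, sum_corner]
  simp
  ring

/-- The function is the index function of the lobe minus its value at the corner `(1, 1)`. The rest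
of `c` and the component `c'` together form a connected set off the lobe, on which the index has
exactly that value; every crossing off the lobe lies in this set. -/
theorem IsIsolatedLobe.exists_function {x : D.Crossing} {c c' : Fin 2} {a b : ℝ} {e : ℤˣ}
    (h : IsIsolatedLobe x c c' a b e) (S : DiagramSurface) :
    ∃ w : D.Region S → ℤ, altSum w x = e * x.sign ∧ (∀ y, y ≠ x → altSum w y = 0) ∧
      (∀ κ, cornerRegion S x κ = cornerRegion S x (-κ) → w (cornerRegion S x κ) = 0) ∧
      ∀ y : D.Crossing, (∀ t ∈ Set.Icc a b, D.curve c t ≠ y.center) →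
        ∀ κ, w (cornerRegion S y κ) = 0 := by
  have hl := h.toIsLobe
  obtain ⟨u, hu⟩ := hl.exists_index_function S
  refine ⟨fun R => u R - u (cornerRegion S x (1, 1)), ?_, fun y hy => ?_, fun κ hκ => ?_,
    fun y hy κ => ?_⟩
  · rw [altSum_sub_const, hl.altSum_self hu]
  · rw [altSum_sub_const, hl.altSum_of_ne hu hy]
  · have hneg : ∀ κ : Corner, -κ ≠ κ := by decide
    have h11 : ∀ e : ℤˣ, ((1, 1) : Corner) ≠ (e, -e) := by decide
    refine sub_eq_zero.2 (hl.apply_eq hu ?_ (h11 e))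
    rintro rfl
    exact hl.cornerRegion_odd_ne (hneg _) hκ
  · refine sub_eq_zero.2 ?_
    have hav : ∀ z, (∀ t ∈ Set.Icc a b, D.curve c t ≠ z) →
        ChainAvoids D (fun _ : Unit => c) (fun _ => a) (fun _ => b) z := by
      intro z hz _ t ht
      rw [Set.uIcc_of_le hl.lt.le] at ht
      exact hz t ht
    have hrest : ∀ q ∈ Set.Ioo b (a + 1), ∀ t ∈ Set.Icc a b, D.curve c t ≠ D.curve c q := by
      intro q hq t ht he
      have hqc := hl.next.curve_ne_of_mem hq
      rcases ht.1.eq_or_lt with rfl | h1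
      · exact hqc (by rw [← he, hl.curve_left])
      rcases ht.2.eq_or_lt with rfl | h2
      · exact hqc (by rw [← he, hl.curve_right])
      exact h.curve_ne t ⟨h1, h2⟩ q hq he
    obtain ⟨q, hq, s, hs⟩ := h.meets
    have hY : IsPreconnected (D.curve c '' Set.Ioo b (a + 1) ∪ D.curve c' '' Set.univ) :=
      IsPreconnected.union' ⟨D.curve c q, ⟨q, hq, rfl⟩, ⟨s, trivial, hs⟩⟩
        (isPreconnected_Ioo.image _ (D.continuous_curve c).continuousOn)
        (isPreconnected_univ.image _ (D.continuous_curve c').continuousOn)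
    have hYav : ∀ z ∈ D.curve c '' Set.Ioo b (a + 1) ∪ D.curve c' '' Set.univ,
        ChainAvoids D (fun _ : Unit => c) (fun _ => a) (fun _ => b) z := by
      rintro z (⟨t, ht, rfl⟩ | ⟨t, _, rfl⟩)
      · exact hav _ (hrest t ht)
      · exact hav _ fun p hp => (h.disjoint p hp t).symm
    have hyY : y.center ∈ D.curve c '' Set.Ioo b (a + 1) ∪ D.curve c' '' Set.univ := by
      by_cases hc : y.overPass.1 = c
      · left
        obtain ⟨n, hn⟩ := exists_int_add_mem_Ico a y.overPass.2
        have hcen : D.curve c (y.overPass.2 + n) = y.center := by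
          rw [curve_add_int, ← hc]; rfl
        refine ⟨_, ⟨?_, hn.2⟩, hcen⟩
        by_contra h0
        exact hy _ ⟨hn.1, not_lt.1 h0⟩ hcen
      · right
        have hc' : y.overPass.1 = c' := by
          have := h.component_ne
          omega
        exact ⟨y.overPass.2, trivial, by rw [← hc']; rfl⟩
    have e1 := hl.isClosedChain.eq_of_isPreconnected hY hYav hyY (Or.inl ⟨q, hq, rfl⟩)
    rw [hl.chainIndex_eq hu h.curve_ne hq] at e1
    -- The lobe avoids `y`, so the index at `y` is also the index near `y`, in particular at its
    -- corners.
    have e2 := hl.isClosedChain.eventually_eq (hYav _ hyY)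
    have e3 := (tendsto_of_tendsto_div (y.tendsto_cornerPoint κ)).eventually e2
    obtain ⟨r, h1, h2⟩ := (e3.and (y.eventually_chainIndex hu κ)).exists
    rw [← h2, h1, e1]

/-- An isolated lobe through a crossing on another isolated lobe is shorter. -/
theorem IsIsolatedLobe.length_lt {x y : D.Crossing} {c₁ c₁' c₂ c₂' : Fin 2} {a₁ b₁ a₂ b₂ : ℝ}
    {e₁ e₂ : ℤˣ} (hx : IsIsolatedLobe x c₁ c₁' a₁ b₁ e₁) (hy : IsIsolatedLobe y c₂ c₂' a₂ b₂ e₂)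
    (hne : y ≠ x) {p : ℝ} (hp : p ∈ Set.Icc a₁ b₁) (hpy : D.curve c₁ p = y.center) :
    b₂ - a₂ < b₁ - a₁ := by
  have hcen : y.center ≠ x.center := fun h => hne (Crossing.ext_of_center h)
  have hc : c₂ = c₁ := by
    by_contra h0
    have h1 : c₂ = c₁' := by have := hx.component_ne; omega
    exact hx.disjoint p hp a₂ (by rw [hpy, ← h1, hy.curve_left])
  have hc' : c₂' = c₁' := by have := hx.component_ne; have := hy.component_ne; omega
  subst hc hc'
  have hpa : a₁ ≠ p := by rintro rfl; exact hcen (hpy.symm.trans hx.curve_left)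
  have hpb : p ≠ b₁ := by rintro rfl; exact hcen (hpy.symm.trans hx.curve_right)
  have hp' : p ∈ Set.Ioo a₁ b₁ := ⟨lt_of_le_of_ne hp.1 hpa, lt_of_le_of_ne hp.2 hpb⟩
  obtain ⟨n, hn⟩ := exists_int_add_mem_Ico a₁ a₂
  have hA : D.curve c₂ (a₂ + n) = y.center := by rw [curve_add_int, hy.curve_left]
  have hB : D.curve c₂ (b₂ + n) = y.center := by rw [curve_add_int, hy.curve_right]
  have hper : D.curve c₂ (a₁ + 1) = D.curve c₂ a₁ := by simpa using D.curve_add_int c₂ a₁ 1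
  -- The lobe of `x` does not meet the rest of its component, so both passages through `y` take
  -- place on that lobe.
  have hmid : ∀ t, D.curve c₂ t = y.center → t ≤ b₁ ∨ a₁ + 1 ≤ t := by
    intro t ht
    by_contra! h0
    exact hx.curve_ne p hp' t h0 (hpy.trans ht.symm)
  have hAb : a₂ + n ≤ b₁ := (hmid _ hA).resolve_right (not_le.2 hn.2)
  rcases hmid _ hB with h1 | h1
  · have h2 : a₂ + n ≠ a₁ := fun h0 => hcen (by rw [← hA, h0, hx.curve_left])
    have := lt_of_le_of_ne hn.1 (Ne.symm h2)
    linarith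
  -- Otherwise the lobe of `y` contains the whole rest of the component, where the other component
  -- is met.
  · exfalso
    obtain ⟨q, hq, s, hs⟩ := hx.meets
    exact hy.disjoint (q + (-n : ℤ)) ⟨by push_cast; linarith [hq.1], by
      push_cast; linarith [hq.2]⟩ s (by rw [curve_add_int, hs])

/-! ## The image of the double counting rule -/

/-- The coefficient of a crossing in the linear relation that defines the image. -/
def mixedSign (x : D.Crossing) : ℤ :=
  (if x.overPass.1 = 0 then 1 else 0) - (if x.underPass.1 = 0 then 1 else 0)

theorem mixedSign_of_isSelf {x : D.Crossing} (hx : x.IsSelf) : mixedSign x = 0 := by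
  rw [mixedSign, show x.overPass.1 = x.underPass.1 from hx, sub_self]

theorem mixedSign_of_isBetween {x : D.Crossing} (hx : x.IsBetween 0 1) :
    mixedSign x = 1 ∨ mixedSign x = -1 := by
  rcases hx with ⟨h1, h2⟩ | ⟨h1, h2⟩ <;> simp [mixedSign, h1, h2]

open Classical in
-- Exchanging over and under changes the sign of a crossing but not the side from which the second
-- component comes. The combination of the two therefore records only which component is above.
theorem sign_of_crossesRightToLeft {x : D.Crossing} (hx : x.IsBetween 0 1) :
    (if x.CrossesRightToLeft 0 1 then -x.sign else x.sign) = -mixedSign x := by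
  have hdet := x.det_ne_zero
  unfold Crossing.CrossesRightToLeft Crossing.sign mixedSign
  rw [planeDet_swap (D.velocity x.underPass)]
  rcases hx with ⟨h1, h2⟩ | ⟨h1, h2⟩ <;> rw [h1, h2] <;> rcases hdet.lt_or_gt with h | h <;>
    simp [h, h.not_gt]

theorem sign_eq_mixedSign {x : D.Crossing} (hx : x.CrossesRightToLeft 0 1) :
    x.sign = mixedSign x := by
  unfold Crossing.sign mixedSign
  rcases hx with ⟨h1, h2, h⟩ | ⟨h1, h2, h⟩
  · simp [h1, h2, h]
  · rw [planeDet_swap] at h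
    simp [h1, h2, not_lt.2 (by linarith : planeDet (D.velocity x.overPass)
      (D.velocity x.underPass) ≤ 0)]

theorem exists_times_of_isBetween {x : D.Crossing} (hx : x.IsBetween 0 1) :
    ∃ t₀ t₁, D.curve 0 t₀ = x.center ∧ D.curve 1 t₁ = x.center ∧
      x.altLog 0 t₀ - x.altLog 1 t₁ = 2 * Real.pi * Complex.I * ((x.sign * mixedSign x : ℤ) : ℂ) := by
  have ho := passage_coe x.overPass
  have hu := passage_coe x.underPass
  rcases hx with ⟨h1, h2⟩ | ⟨h1, h2⟩
  · rw [h1] at ho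
    rw [h2] at hu
    refine ⟨_, _, x.curve_eq_of_passage_eq_over ho, x.curve_eq_of_passage_eq_under hu, ?_⟩
    rw [x.altLog_sub ho hu]
    simp [mixedSign, h1, h2]
  · rw [h1] at ho
    rw [h2] at hu
    refine ⟨_, _, x.curve_eq_of_passage_eq_under hu, x.curve_eq_of_passage_eq_over ho, ?_⟩
    rw [← neg_sub, x.altLog_sub ho hu]
    simp [mixedSign, h1, h2]

/-- For two crossings of the components there is a function on the regions whose alternating sum
vanishes at all other crossings. -/
theorem exists_altSum_pair {x y : D.Crossing} (hx : x.IsBetween 0 1) (hy : y.IsBetween 0 1)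
    (hxy : x ≠ y) (S : DiagramSurface) :
    ∃ u : D.Region S → ℤ, altSum u x = x.sign * mixedSign x ∧
      altSum u y = -(y.sign * mixedSign y) ∧ ∀ z, z ≠ x → z ≠ y → altSum u z = 0 := by
  obtain ⟨t₀, t₁, hx0, hx1, hx2⟩ := exists_times_of_isBetween hx
  obtain ⟨s₀, s₁, hy0, hy1, hy2⟩ := exists_times_of_isBetween hy
  -- Along the first component from `x` to `y` and back along the second. The times may decrease
  -- along an arc, since only its ends matter for alternating sums.
  have hc : IsClosedChain D ![0, 1] ![t₀, s₁] ![s₀, t₁] := by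
    intro w
    simp [Fin.prod_univ_two, hx0, hx1, hy0, hy1, mul_comm]
  obtain ⟨u, hu⟩ := hc.exists_region_function S
  have key : ∀ z : D.Crossing, 2 * Real.pi * Complex.I * (altSum u z : ℂ) =
      (z.altLog 0 t₀ - z.altLog 0 s₀) + (z.altLog 1 s₁ - z.altLog 1 t₁) := by
    intro z
    have := z.alternating_sum_eq hc hu
    rw [Fin.sum_univ_two] at this
    exact this
  have hzero : ∀ {z w : D.Crossing} {c : Fin 2} {t : ℝ}, z ≠ w → D.curve c t = w.center →
      z.altLog c t = 0 := by
    intro z w c t hzw ht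
    refine z.altLog_of_ne fun h => hzw (Crossing.ext_of_center ?_)
    rw [← h, ht]
  refine ⟨u, ?_, ?_, fun z hzx hzy => ?_⟩
  · have := key x
    rw [hzero hxy hy0, hzero hxy hy1, sub_zero, zero_sub, ← sub_eq_add_neg, hx2] at this
    exact_mod_cast mul_left_cancel₀ Complex.two_pi_I_ne_zero this
  · have := key y
    rw [hzero hxy.symm hx0, hzero hxy.symm hx1, sub_zero, zero_sub, neg_add_eq_sub, ← neg_sub, hy2,
      ← mul_neg] at this
    exact_mod_cast mul_left_cancel₀ Complex.two_pi_I_ne_zero this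
  · have := key z
    rw [hzero hzx hx0, hzero hzx hx1, hzero hzy hy0, hzero hzy hy1, sub_zero, add_zero,
      mul_eq_zero, or_iff_right Complex.two_pi_I_ne_zero] at this
    exact_mod_cast this

section Images

variable {n : ℕ} (x : Fin n ≃ D.Crossing)

/-- The integer vectors that satisfy the linear relation between the crossings of the
two components. -/
def relationSubmodule : Submodule ℤ (Fin n → ℤ) :=
  LinearMap.ker (∑ i, mixedSign (x i) • LinearMap.proj i : (Fin n → ℤ) →ₗ[ℤ] ℤ)

theorem mem_relationSubmodule {v : Fin n → ℤ} :
    v ∈ relationSubmodule x ↔ ∑ i, mixedSign (x i) * v i = 0 := by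
  simp [relationSubmodule]

variable (S) in
-- The relation is the balance of jumps along the first component.
theorem range_homA2_le : LinearMap.range (homA2 S x) ≤ relationSubmodule x := by
  rintro _ ⟨u, rfl⟩
  rw [mem_relationSubmodule]
  have : Fintype D.Crossing := Fintype.ofEquiv _ x
  have h := sum_altSum_eq_zero u (0 : Fin 2)
  rw [← x.sum_comp] at h
  rw [← neg_eq_zero, ← h, ← Finset.sum_neg_distrib]
  refine Finset.sum_congr rfl fun i _ => ?_
  rw [homA2_eq_altSum, mixedSign]
  ring

theorem sign_mul_self {l : ℕ} {D : LinkDiagram l} (x : D.Crossing) : x.sign * x.sign = 1 := by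
  rcases x.sign_eq with h | h <;> rw [h] <;> rfl

theorem exists_homA2_self {i : Fin n} {e : ℤˣ} {w : D.Region S → ℤ}
    (h1 : altSum w (x i) = e * (x i).sign) (h2 : ∀ y, y ≠ x i → altSum w y = 0) :
    homA2 S x (-(e : ℤ) • w) = Pi.single i 1 := by
  have hee : (e : ℤ) * e = 1 := by
    rcases Int.units_eq_one_or e with rfl | rfl <;> rfl
  funext j
  rw [map_smul, Pi.smul_apply, homA2_eq_altSum]
  by_cases hj : j = i
  · subst hj
    rw [h1, Pi.single_eq_same, smul_eq_mul]
    linear_combination (e : ℤ) * e * sign_mul_self (x j) + hee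
  · rw [h2 _ fun h => hj (x.injective h), Pi.single_eq_of_ne hj, mul_zero, neg_zero, smul_zero]

/-- The crossing is touched by some region at two opposite corners. -/
def TouchedTwice {l : ℕ} {D : LinkDiagram l} (S : DiagramSurface) (y : D.Crossing) : Prop :=
  ∃ κ, cornerRegion S y κ = cornerRegion S y (-κ)

theorem homA1_apply_eq_of_not_touchedTwice (u : D.Region S → ℤ) {i : Fin n}
    (hi : ¬TouchedTwice S (x i)) : homA1 S x u i = homA2 S x u i :=
  homA1_apply_eq x u i fun κ hκ => absurd ⟨κ, hκ⟩ hi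

/-- The two rules differ only at crossings touched twice; these are self-crossings and have
coefficient zero in the relation. -/
theorem range_homA1_le : LinearMap.range (homA1 S x) ≤ relationSubmodule x := by
  rintro _ ⟨u, rfl⟩
  have h := range_homA2_le S x ⟨u, rfl⟩
  rw [mem_relationSubmodule] at h ⊢
  rw [← h]
  refine Finset.sum_congr rfl fun i _ => ?_
  by_cases hi : TouchedTwice S (x i)
  · obtain ⟨κ, hκ⟩ := hi
    rw [mixedSign_of_isSelf (isSelf_of_twice hκ), zero_mul, zero_mul]
  · rw [homA1_apply_eq_of_not_touchedTwice x u hi]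

theorem mem_of_forall_single_mem {P : Submodule ℤ (Fin n → ℤ)} {v : Fin n → ℤ}
    (h : ∀ i, v i ≠ 0 → Pi.single i 1 ∈ P) : v ∈ P := by
  have hv : v = ∑ i, v i • (Pi.single i 1 : Fin n → ℤ) := by
    funext j
    simp [Finset.sum_apply, Pi.single_apply]
  rw [hv]
  refine Submodule.sum_mem _ fun i _ => ?_
  by_cases hi : v i = 0
  · rw [hi, zero_smul]; exact Submodule.zero_mem _
  · exact Submodule.smul_mem _ _ (h i hi)

/-- Induction on the length of the isolated lobe. Its function yields the unit vector under the
double rule, and the error made by the single rule is supported at doubly touched crossings with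
shorter lobes. -/
theorem single_mem_range_homA1
    (hmeet : ∀ c : Fin 2, ∃ c', c' ≠ c ∧ ∃ t s, D.curve c t = D.curve c' s) (i : Fin n)
    (hi : TouchedTwice S (x i)) : Pi.single i 1 ∈ LinearMap.range (homA1 S x) := by
  have hlobe : ∀ i : Fin n, TouchedTwice S (x i) →
      ∃ c c' a b e, IsIsolatedLobe (x i) c c' a b e := by
    rintro i ⟨κ, hκ⟩
    exact exists_isolatedLobe hκ hmeet
  choose! c c' a b e hl using hlobe
  -- The lengths are real numbers, but there are only finitely many crossings.
  have wf : WellFounded fun i j : Fin n => b i - a i < b j - a j :=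
    @Finite.wellFounded_of_trans_of_irrefl _ _ _ ⟨fun _ _ _ h h' => lt_trans h h'⟩
      ⟨fun _ => lt_irrefl _⟩
  induction i using wf.induction with
  | _ i ih =>
    obtain ⟨w, h1, h2, h3, h4⟩ := (hl i hi).exists_function S
    set w' := -(e i : ℤ) • w with hw'
    have hA2 : homA2 S x w' = Pi.single i 1 := exists_homA2_self x h1 h2
    have hd : homA2 S x w' - homA1 S x w' ∈ LinearMap.range (homA1 S x) := by
      refine mem_of_forall_single_mem fun j hj => ?_
      -- The rules can disagree at `x j` only if `w` is nonzero on a region that touches it twice.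
      -- This excludes `x i` itself and all crossings off the lobe.
      have hvanish : ¬∀ κ, cornerRegion S (x j) κ = cornerRegion S (x j) (-κ) →
          w (cornerRegion S (x j) κ) = 0 := by
        intro h5
        apply hj
        rw [Pi.sub_apply, homA1_apply_eq, sub_self]
        intro κ hκ
        rw [hw', Pi.smul_apply, h5 κ hκ, smul_zero]
      push Not at hvanish
      obtain ⟨κ, hκ, hne⟩ := hvanish
      have hji : x j ≠ x i := by
        intro h5
        rw [h5] at hκ hne
        exact hne (h3 κ hκ)
      have hmem : ∃ t ∈ Set.Icc (a i) (b i), D.curve (c i) t = (x j).center := by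
        by_contra! h5
        exact hne (h4 _ h5 κ)
      obtain ⟨t, ht, htc⟩ := hmem
      exact ih j ((hl i hi).length_lt (hl j ⟨κ, hκ⟩) hji ht htc) ⟨κ, hκ⟩
    have := Submodule.add_mem _ hd ⟨w', rfl⟩
    rwa [sub_add_cancel, hA2] at this

theorem range_homA2_le_range_homA1
    (hmeet : ∀ c : Fin 2, ∃ c', c' ≠ c ∧ ∃ t s, D.curve c t = D.curve c' s) :
    LinearMap.range (homA2 S x) ≤ LinearMap.range (homA1 S x) := by
  rintro _ ⟨u, rfl⟩
  have hd : homA2 S x u - homA1 S x u ∈ LinearMap.range (homA1 S x) := by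
    refine mem_of_forall_single_mem fun j hj => single_mem_range_homA1 x hmeet j ?_
    by_contra h
    apply hj
    rw [Pi.sub_apply, homA1_apply_eq_of_not_touchedTwice x u h, sub_self]
  have := Submodule.add_mem _ hd ⟨u, rfl⟩
  rwa [sub_add_cancel] at this

end Images

/-! ### The vectors `e_i` as a basis of the relation lattice -/

section ImageVectors

variable {m k : ℕ} (x : Fin (m + 1) ≃ D.Crossing)
  (hself : ∀ i : Fin (m + 1), (i : ℕ) < k → (x i).IsSelf)
  (hmixed : ∀ i : Fin (m + 1), k ≤ (i : ℕ) → (x i).IsBetween 0 1)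
  (hlast : (x (Fin.last m)).CrossesRightToLeft 0 1)

include hmixed hlast in
theorem imageVector_of_le {i : Fin m} (hi : k ≤ (i : ℕ)) :
    imageVector x k i = Pi.single i.castSucc (-mixedSign (x i.castSucc)) +
      Pi.single (Fin.last m) (mixedSign (x (Fin.last m))) := by
  rw [imageVector, if_neg (not_lt.2 hi), sign_eq_mixedSign hlast,
    sign_of_crossesRightToLeft (hmixed i.castSucc hi)]

include hmixed hlast in
-- Without the last coordinate the vectors form a diagonal matrix with entries `±1`, which gives
-- both independence and the coefficients of an expansion.
theorem imageVector_castSucc (i j : Fin m) : imageVector x k i j.castSucc =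
    if j = i then (if (i : ℕ) < k then 1 else -mixedSign (x i.castSucc)) else 0 := by
  split_ifs with h1 h2
  · subst h1
    rw [imageVector, if_pos h2, Pi.single_eq_same]
  · subst h1
    rw [imageVector_of_le x hmixed hlast (not_lt.1 h2), Pi.add_apply, Pi.single_eq_same,
      Pi.single_eq_of_ne (Fin.castSucc_ne_last j), add_zero]
  · have h3 : j.castSucc ≠ i.castSucc := fun h => h1 (Fin.castSucc_injective m h)
    by_cases h2 : (i : ℕ) < k
    · rw [imageVector, if_pos h2, Pi.single_eq_of_ne h3]
    · rw [imageVector_of_le x hmixed hlast (not_lt.1 h2), Pi.add_apply, Pi.single_eq_of_ne h3,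
        Pi.single_eq_of_ne (Fin.castSucc_ne_last j), add_zero]

include hmixed hlast in
theorem linearIndependent_imageVector : LinearIndependent ℤ (imageVector x k) := by
  rw [Fintype.linearIndependent_iff]
  intro g hg i
  have h := congrFun hg i.castSucc
  simp only [Finset.sum_apply, Pi.smul_apply, imageVector_castSucc x hmixed hlast, smul_eq_mul,
    mul_ite, mul_zero, Finset.sum_ite_eq, Finset.mem_univ, if_true, Pi.zero_apply] at h
  split_ifs at h with h1
  · simpa using h
  · rcases mixedSign_of_isBetween (hmixed i.castSucc (not_lt.1 h1)) with h2 | h2 <;>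
      simpa [h2] using h

include hself hmixed hlast in
theorem imageVector_mem_range (i : Fin m) :
    imageVector x k i ∈ LinearMap.range (homA2 S x) := by
  by_cases hi : (i : ℕ) < k
  · rw [imageVector, if_pos hi]
    obtain ⟨c, a, b, h⟩ := (hself i.castSucc hi).exists_lobe 1
    obtain ⟨u, hu⟩ := h.exists_index_function S
    exact ⟨_, exists_homA2_self x (h.altSum_self hu) fun y hy => h.altSum_of_ne hu hy⟩
  · rw [imageVector_of_le x hmixed hlast (not_lt.1 hi)]
    have hne : Fin.last m ≠ i.castSucc := (Fin.castSucc_ne_last i).symm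
    have hlast' := hmixed (Fin.last m) (by rw [Fin.val_last]; omega)
    -- Taking the last crossing first gives it the coefficient `mixedSign`, and `-mixedSign` to the
    -- other one.
    obtain ⟨u, h1, h2, h3⟩ := exists_altSum_pair hlast' (hmixed i.castSucc (not_lt.1 hi))
      (fun h => hne (x.injective h)) S
    refine ⟨-u, ?_⟩
    funext j
    rw [map_neg, Pi.neg_apply, homA2_eq_altSum, neg_neg, Pi.add_apply]
    by_cases hj : j = Fin.last m
    · subst hj
      rw [h1, Pi.single_eq_of_ne hne, Pi.single_eq_same, ← mul_assoc, sign_mul_self, one_mul,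
        zero_add]
    · rw [Pi.single_eq_of_ne hj, add_zero]
      by_cases hj' : j = i.castSucc
      · subst hj'
        rw [h2, Pi.single_eq_same, mul_neg, ← mul_assoc, sign_mul_self, one_mul]
      · rw [Pi.single_eq_of_ne hj', h3 _ (fun h => hj (x.injective h))
          (fun h => hj' (x.injective h)), mul_zero]

include hself hmixed hlast in
theorem relationSubmodule_le_span (hk : k < m + 1) :
    relationSubmodule x ≤ Submodule.span ℤ (Set.range (imageVector x k)) := by
  intro v hv
  rw [mem_relationSubmodule, Fin.sum_univ_castSucc] at hv
  have hsq : ∀ i : Fin (m + 1), k ≤ (i : ℕ) → mixedSign (x i) * mixedSign (x i) = 1 := by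
    intro i hi
    rcases mixedSign_of_isBetween (hmixed i hi) with h | h <;> rw [h] <;> rfl
  -- The coefficients are read off from the first `m` coordinates. The last coordinate then agrees
  -- by the relation, whose coefficient there is `±1`.
  have key : v = ∑ i : Fin m, (if (i : ℕ) < k then v i.castSucc
      else -mixedSign (x i.castSucc) * v i.castSucc) • imageVector x k i := by
    funext j
    rw [Finset.sum_apply]
    refine Fin.lastCases ?_ (fun j => ?_) j
    · have hl := hsq (Fin.last m) (by rw [Fin.val_last]; omega)
      have hterm : ∀ i : Fin m, ((if (i : ℕ) < k then v i.castSucc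
          else -mixedSign (x i.castSucc) * v i.castSucc) • imageVector x k i) (Fin.last m) =
          -mixedSign (x (Fin.last m)) * (mixedSign (x i.castSucc) * v i.castSucc) := by
        intro i
        have hne : Fin.last m ≠ i.castSucc := (Fin.castSucc_ne_last i).symm
        split_ifs with h
        · rw [mixedSign_of_isSelf (hself i.castSucc h), zero_mul, mul_zero, Pi.smul_apply,
            imageVector, if_pos h, Pi.single_eq_of_ne hne, smul_zero]
        · rw [Pi.smul_apply, imageVector_of_le x hmixed hlast (not_lt.1 h), Pi.add_apply,
            Pi.single_eq_of_ne hne, Pi.single_eq_same, zero_add, smul_eq_mul]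
          ring
      rw [Finset.sum_congr rfl fun i _ => hterm i, ← Finset.mul_sum]
      linear_combination (-v (Fin.last m)) * hl + mixedSign (x (Fin.last m)) * hv
    · simp only [Pi.smul_apply, imageVector_castSucc x hmixed hlast, smul_eq_mul, mul_ite, mul_zero,
        Finset.sum_ite_eq, Finset.mem_univ, if_true]
      split_ifs with h
      · rw [mul_one]
      · linear_combination (-v j.castSucc) * hsq j.castSucc (not_lt.1 h)
  rw [key]
  exact Submodule.sum_mem _ fun i _ => Submodule.smul_mem _ _ (Submodule.subset_span ⟨i, rfl⟩)

end ImageVectors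

end TwoComponents

end LinkDiagram

end

/-! ### The images of both rules and the solvable systems -/

theorem mainTheorem6 (S : DiagramSurface) (D : LinkDiagram 2) (hD : D.Connected)
    (m k : ℕ) (x : Fin (m + 1) ≃ D.Crossing) (hk : k < m + 1)
    (hself : ∀ i : Fin (m + 1), (i : ℕ) < k → (x i).IsSelf)
    (hmixed : ∀ i : Fin (m + 1), k ≤ (i : ℕ) → (x i).IsBetween 0 1)
    (hlast : (x (Fin.last m)).CrossesRightToLeft 0 1) :
    (∃ b : Module.Basis (Fin m) ℤ (LinearMap.range (LinkDiagram.homA2 S x)),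
      ∀ i, (b i : Fin (m + 1) → ℤ) = LinkDiagram.imageVector x k i) ∧
    LinearMap.range (LinkDiagram.homA1 S x) = LinearMap.range (LinkDiagram.homA2 S x) ∧
    (∀ c : Fin (m + 1) → ℤ,
      ((∃ u : D.Region S → ℤ, LinkDiagram.homA1 S x u + c = 0) ↔
        c ∈ Submodule.span ℤ (Set.range (LinkDiagram.imageVector x k))) ∧
      ((∃ w : D.Region S → ℤ, LinkDiagram.homA2 S x w + c = 0) ↔
        c ∈ Submodule.span ℤ (Set.range (LinkDiagram.imageVector x k)))) := by
  open LinkDiagram in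
  have hspan : LinearMap.range (homA2 S x) = Submodule.span ℤ (Set.range (imageVector x k)) :=
    le_antisymm ((range_homA2_le S x).trans (relationSubmodule_le_span x hself hmixed hlast hk))
      (Submodule.span_le.2 (Set.range_subset_iff.2 (imageVector_mem_range x hself hmixed hlast)))
  -- The last crossing is mixed, so each component meets the other.
  have hmeet : ∀ c : Fin 2, ∃ c', c' ≠ c ∧ ∃ t s, D.curve c t = D.curve c' s := by
    obtain ⟨t₀, t₁, h0, h1, _⟩ := LinkDiagram.exists_times_of_isBetween
      (hmixed (Fin.last m) (by rw [Fin.val_last]; omega))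
    intro c
    fin_cases c
    · exact ⟨1, by decide, t₀, t₁, h0.trans h1.symm⟩
    · exact ⟨0, by decide, t₁, t₀, h1.trans h0.symm⟩
  have h12 : LinearMap.range (LinkDiagram.homA1 S x) = LinearMap.range (LinkDiagram.homA2 S x) :=
    le_antisymm ((LinkDiagram.range_homA1_le x).trans
      ((LinkDiagram.relationSubmodule_le_span x hself hmixed hlast hk).trans hspan.ge))
      (LinkDiagram.range_homA2_le_range_homA1 x hmeet)
  have hsolve : ∀ (f : (D.Region S → ℤ) →ₗ[ℤ] (Fin (m + 1) → ℤ)) (c : Fin (m + 1) → ℤ),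
      (∃ u, f u + c = 0) ↔ c ∈ LinearMap.range f := by
    intro f c
    constructor
    · rintro ⟨u, hu⟩
      exact ⟨-u, by rw [map_neg]; exact (eq_neg_of_add_eq_zero_right hu).symm⟩
    · rintro ⟨u, rfl⟩
      exact ⟨-u, by rw [map_neg, neg_add_cancel]⟩
  refine ⟨⟨(Module.Basis.span (LinkDiagram.linearIndependent_imageVector x hmixed hlast)).map
    (LinearEquiv.ofEq _ _ hspan.symm), fun i => ?_⟩, h12, fun c => ⟨?_, ?_⟩⟩
  · rw [Module.Basis.map_apply, LinearEquiv.coe_ofEq_apply, Module.Basis.span_apply]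
  · rw [hsolve, h12, hspan]
  · rw [hsolve, hspan]
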